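/- **Theorem (stocBiO).** *Problem.* Let $\Phi(x)=f(x,y^*(x))$, $y^*(x)=\arg\min_{y\in\mathbb R^q}g(x,y)$, $x\in\mathbb R^p$, where $f(z)=\mathbb E_\xi F(z;\xi)$, $g(z)=\mathbb E_\zeta G(z;\zeta)$, $z=(x,y)$ (the finite-sum case being that of uniform distributions on finite sets). Let $L>0$, $M,\tau,\rho\ge0$, $0<\mu\le L$, $\sigma>0$, $\kappa=L/\mu$. Assume that $F(z;\cdot)$ and $G(z;\cdot)$ are measurable and integrable, that $F(\cdot;\xi)$, $G(\cdot;\zeta)$ and $\nabla_yG(\cdot;\zeta)$ are differentiable, that $\Phi$ is bounded below (it may be nonconvex), and that for all $\xi,\zeta$: $G(x,\cdot;\zeta)$ is $\mu$-strongly convex for every $x$; $F(\cdot;\xi)$ is $M$-Lipschitz; $\nabla F(\cdot;\xi)$ and $\nabla G(\cdot;\zeta)$ are $L$-Lipschitz; $\nabla_x\nabla_yG(\cdot;\zeta)$ is $\tau$-Lipschitz and $\nabla_y^2G(\cdot;\zeta)$ is $\rho$-Lipschitz; and $\mathbb E_\zeta\|\nabla G(z;\zeta)-\nabla g(z)\|^2\le\sigma^2$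 for all $z$. *Algorithm (stocBiO).* All samples are independent, and $h(\cdot;\mathcal B)$ denotes the average over a batch $\mathcal B$. Start from $x_0$ and $y_0^0=y_0$. In iteration $k=0,1,\dots,K-1$: (i) for $t=1,\dots,D$ set $y_k^t=y_k^{t-1}-\alpha\nabla_yG(x_k,y_k^{t-1};\mathcal S_{t-1})$ with $|\mathcal S_{t-1}|=S$; (ii) draw $\mathcal D_F,\mathcal D_G,\mathcal B_1,\dots,\mathcal B_Q$ with $|\mathcal D_F|=D_f$, $|\mathcal D_G|=D_g$, $|\mathcal B_{Q+1-j}|=\lceil BQ(1-\eta\mu)^{j-1}\rceil$; set $r_Q=\nabla_yF(x_k,y_k^D;\mathcal D_F)$, $r_{i-1}=r_i-\eta\nabla_y^2G(x_k,y_k^D;\mathcal B_i)r_i$ for $i=Q,\dots,1$, and $v_Q=\eta\sum_{i=0}^Qr_i$; (iii) set $x_{k+1}=x_k-\beta\big(\nabla_xF(x_k,y_k^D;\mathcal D_F)-\nabla_x\nabla_yG(x_k,y_k^D;\mathcal D_G)v_Q\big)$ and $y_{k+1}^0=y_k^D$. Here $K,D,Q,S,D_g,D_f\ge1$ are integers,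 $\alpha=\frac2{L+\mu}$, $\beta=\frac1{4L_\Phi}$ with $$L_\Phi=L+\frac{2L^2+\tau M^2}{\mu}+\frac{\rho LM+L^3+\tau ML}{\mu^2}+\frac{\rho L^2M}{\mu^3},$$ $0<\eta<\frac1L$, and $B$ is a real number with $B\ge\frac1{Q(1-\eta\mu)^{Q-1}}$. Let $P=L+\frac{L^2}\mu+\frac{M\tau}\mu+\frac{LM\rho}{\mu^2}$ and $$D_{\min}=\max\left\{\frac{\log\big(12+\frac{48\beta^2L^2}{\mu^2}P^2\big)}{2\log\frac{L+\mu}{L-\mu}},\ \frac{\log(\sqrt\beta\,P)}{\log\frac{L+\mu}{L-\mu}}\right\}\qquad(D_{\min}=0\text{ if }\mu=L).$$ Let $\Delta_0,R_0$ be such that $\Phi(x_0)-\inf\Phi\le\Delta_0$ and $\|y_0-y^*(x_0)\|\le R_0$. *(a) Rate.* There is a constant $C$ depending only on $L,M,\tau,\rho,\Delta_0,R_0$ such that $D_{\min}\le C\kappa(1+\log\kappa)$ and, whenever $D\ge D_{\min}$, $\Phi$ is differentiable, $\mathbb E\|\nabla\Phi(x_k)\|^2<\infty$ for $k<K$, and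 $$\frac1K\sum_{k=0}^{K-1}\mathbb E\|\nabla\Phi(x_k)\|^2\le C\Big(\frac{L_\Phi}K+\kappa^2(1-\eta\mu)^{2Q}+\frac{\kappa^5\sigma^2}S+\frac{\kappa^2}{D_g}+\frac{\kappa^2}{D_f}+\frac{\kappa^2}B\Big).$$ *(b) Complexity.* Let $0<c<1$. There is a constant $C$ depending only on $L,M,\tau,\rho,\Delta_0,R_0,\sigma,c$ such that for all $\mu\in(0,L]$, $\eta\in[\frac cL,\frac1L)$ and $\epsilon\in(0,1]$ there are $K,D,Q,S,D_g,D_f,B$ as above (the condition $D\ge D_{\min}$ is not imposed here), the same for all such problems and starting points, for which $\mathbb E\|\nabla\Phi(\bar x)\|^2\le\epsilon$, where $\bar x$ is chosen uniformly at random from $x_0,\dots,x_{K-1}$, while the $K$ iterations use - at most $C\kappa^5\epsilon^{-2}$ partial gradients of $F$ and at most $C\kappa^9\epsilon^{-2}$ partial gradients of $G$ on single samples, - at most $C\kappa^5\epsilon^{-2}$ Jacobian-vector products $\nabla_x\nabla_yG(x,y;\zeta)v$ and at most $C\kappa^6\epsilon^{-2}\big(1+\log\frac{\kappa^2}\epsilon\big)$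 Hessian-vector products $\nabla_y^2G(x,y;\zeta)v$. -/

import Mathlib

noncomputable section

open MeasureTheory ProbabilityTheory

namespace StocBiO

/-! ### Euclidean variables and partial derivatives -/

/-- The Euclidean space `ℝⁿ`. -/
abbrev Vec (n : ℕ) := EuclideanSpace ℝ (Fin n)

/-- The space of joint variables `z = (x, y) ∈ ℝᵖ × ℝ^q`, with the Euclidean norm
`‖z‖² = ‖x‖² + ‖y‖²`. -/
abbrev Joint (p q : ℕ) := WithLp 2 (Vec p × Vec q)

/-- The joint variable `z = (x, y)`. -/
def pair {p q : ℕ} (x : Vec p) (y : Vec q) : Joint p q := WithLp.toLp 2 (x, y)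

/-- Partial gradient `∇ₓ h(x, y)`. -/
def gradX {p q : ℕ} (h : Joint p q → ℝ) (x : Vec p) (y : Vec q) : Vec p :=
  gradient (fun x' => h (pair x' y)) x

/-- Partial gradient `∇_y h(x, y)`. -/
def gradY {p q : ℕ} (h : Joint p q → ℝ) (x : Vec p) (y : Vec q) : Vec q :=
  gradient (fun y' => h (pair x y')) y

/-- Hessian block `∇_y² h(x, y)`, as an operator on `ℝ^q`. -/
def hessY {p q : ℕ} (h : Joint p q → ℝ) (x : Vec p) (y : Vec q) : Vec q →L[ℝ] Vec q :=
  fderiv ℝ (fun y' => gradY h x y') y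

/-- Jacobian block `∇ₓ∇_y h(x, y)`, a `p × q` matrix seen as an operator `ℝ^q → ℝᵖ`:
`∇ₓ∇_y h(x, y) v` is the gradient in `x` of `⟨∇_y h(x, y), v⟩`, so this is the transpose of the
derivative in `x` of `∇_y h`. -/
def jacXY {p q : ℕ} (h : Joint p q → ℝ) (x : Vec p) (y : Vec q) : Vec q →L[ℝ] Vec p :=
  ContinuousLinearMap.adjoint (fderiv ℝ (fun x' => gradY h x' y) x)

/-! ### The stochastic bilevel problem -/

/-- A stochastic bilevel problem: sample losses `F(z; ξ)` and `G(z; ζ)` and the distributions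
of `ξ` and `ζ`. The finite-sum case is that of uniform distributions on finite sets. -/
structure Problem (p q : ℕ) (Ξ Z : Type*) [MeasurableSpace Ξ] [MeasurableSpace Z] where
  F : Joint p q → Ξ → ℝ
  G : Joint p q → Z → ℝ
  lawξ : Measure Ξ
  lawζ : Measure Z

section Problem

variable {p q : ℕ} {Ξ Z : Type*} [MeasurableSpace Ξ] [MeasurableSpace Z]

/-- Upper-level function `f(z) = E_ξ F(z; ξ)`. -/
def Problem.f (P : Problem p q Ξ Z) (z : Joint p q) : ℝ := ∫ ξ, P.F z ξ ∂P.lawξ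

/-- Lower-level function `g(z) = E_ζ G(z; ζ)`. -/
def Problem.g (P : Problem p q Ξ Z) (z : Joint p q) : ℝ := ∫ ζ, P.G z ζ ∂P.lawζ

/-- `y*(x) = argmin_y g(x, y)`. -/
def Problem.yStar (P : Problem p q Ξ Z) (x : Vec p) : Vec q :=
  Classical.epsilon fun y => ∀ y' : Vec q, P.g (pair x y) ≤ P.g (pair x y')

/-- The total objective `Φ(x) = f(x, y*(x))`. -/
def Problem.Phi (P : Problem p q Ξ Z) (x : Vec p) : ℝ := P.f (pair x (P.yStar x))

/-- The standing assumptions on the losses. -/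
structure Problem.Assumptions (P : Problem p q Ξ Z) (L M τ ρ μ σ : ℝ) : Prop where
  prob_ξ : IsProbabilityMeasure P.lawξ
  prob_ζ : IsProbabilityMeasure P.lawζ
  measurable_F : ∀ z, Measurable (P.F z)
  measurable_G : ∀ z, Measurable (P.G z)
  integrable_F : ∀ z, Integrable (P.F z) P.lawξ
  integrable_G : ∀ z, Integrable (P.G z) P.lawζ
  differentiable_F : ∀ ξ, Differentiable ℝ fun z => P.F z ξ
  differentiable_G : ∀ ζ, Differentiable ℝ fun z => P.G z ζ
  differentiable_gradY_G : ∀ ζ,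
    Differentiable ℝ fun z : Joint p q => gradY (fun z' => P.G z' ζ) z.fst z.snd
  /-- `G(x, ·; ζ)` is `μ`-strongly convex. -/
  strongConvex : ∀ ζ x, StrongConvexOn Set.univ μ fun y => P.G (pair x y) ζ
  /-- `Φ` is bounded below. -/
  bddBelow : BddBelow (Set.range P.Phi)
  /-- `F(·; ξ)` is `M`-Lipschitz. -/
  lipschitz_F : ∀ ξ z z', |P.F z ξ - P.F z' ξ| ≤ M * ‖z - z'‖
  /-- `∇F(·; ξ)` is `L`-Lipschitz. -/
  lipschitz_grad_F : ∀ ξ z z',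
    ‖gradient (fun w => P.F w ξ) z - gradient (fun w => P.F w ξ) z'‖ ≤ L * ‖z - z'‖
  /-- `∇G(·; ζ)` is `L`-Lipschitz. -/
  lipschitz_grad_G : ∀ ζ z z',
    ‖gradient (fun w => P.G w ζ) z - gradient (fun w => P.G w ζ) z'‖ ≤ L * ‖z - z'‖
  /-- `∇ₓ∇_y G(·; ζ)` is `τ`-Lipschitz. -/
  lipschitz_jac_G : ∀ ζ (z z' : Joint p q),
    ‖jacXY (fun w => P.G w ζ) z.fst z.snd - jacXY (fun w => P.G w ζ) z'.fst z'.snd‖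
      ≤ τ * ‖z - z'‖
  /-- `∇_y² G(·; ζ)` is `ρ`-Lipschitz. -/
  lipschitz_hess_G : ∀ ζ (z z' : Joint p q),
    ‖hessY (fun w => P.G w ζ) z.fst z.snd - hessY (fun w => P.G w ζ) z'.fst z'.snd‖
      ≤ ρ * ‖z - z'‖
  /-- `E_ζ ‖∇G(z; ζ) - ∇g(z)‖² ≤ σ²`. -/
  variance_grad_G : ∀ z,
    ∫⁻ ζ, ‖gradient (fun w => P.G w ζ) z - gradient P.g z‖ₑ ^ 2 ∂P.lawζ ≤ ENNReal.ofReal (σ ^ 2)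

end Problem

/-! ### The algorithm -/

/-- Parameters of stocBiO: the number `K` of outer iterations, the number `D` of inner SGD steps,
the number `Q` of Hessian-vector steps, the batch sizes `S`, `Dg`, `Df`, the batch parameter `B` of
the Hessian batches, the inner and outer stepsizes `α`, `β`, and the Neumann-series constant `η`. -/
structure Params where
  K : ℕ
  D : ℕ
  Q : ℕ
  S : ℕ
  Dg : ℕ
  Df : ℕ
  B : ℝ
  α : ℝ
  β : ℝ
  η : ℝ

/-- Size of the Hessian batch `B_j`, `j = 1, …, Q`: `|B_{Q+1-i}| = B Q (1 - ημ)^{i-1}`,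
rounded up to an integer. -/
def Params.hessBatch (θ : Params) (μ : ℝ) (j : ℕ) : ℕ :=
  ⌈θ.B * θ.Q * (1 - θ.η * μ) ^ (θ.Q - j)⌉₊

/-- Labels of the draws of `ζ` in outer iteration `k`: the `i`-th element of the inner batch `S_t`,
of `D_G`, and of the Hessian batch `B_j`. -/
inductive GDraw
  | inner (k t i : ℕ)
  | jac (k i : ℕ)
  | hess (k j i : ℕ)

/-- Average of the first `n` terms. -/
def batchMean {V : Type*} [AddCommGroup V] [Module ℝ V] (n : ℕ) (a : ℕ → V) : V :=
  (1 / (n : ℝ)) • ∑ i ∈ Finset.range n, a i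

/-- Neumann iteration: `neumann η Q H v₀ s` is `r_{Q-s}`, where `r_Q = v₀` and
`r_{i-1} = r_i - η H_i r_i`. -/
def neumann {q : ℕ} (η : ℝ) (Q : ℕ) (H : ℕ → Vec q →L[ℝ] Vec q) (v₀ : Vec q) : ℕ → Vec q
  | 0 => v₀
  | s + 1 => neumann η Q H v₀ s - η • H (Q - s) (neumann η Q H v₀ s)

section Algorithm

variable {p q : ℕ} {Ξ Z : Type*} [MeasurableSpace Ξ] [MeasurableSpace Z]

/-- Inner loop: `t` steps of mini-batch SGD on `g(x, ·)` from `y`, where `smp t i` is the `i`-th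
sample of the `t`-th batch. -/
def innerLoop (P : Problem p q Ξ Z) (θ : Params) (smp : ℕ → ℕ → Z) (x : Vec p) (y : Vec q) :
    ℕ → Vec q
  | 0 => y
  | t + 1 =>
      innerLoop P θ smp x y t -
        θ.α • batchMean θ.S fun i =>
          gradY (fun w => P.G w (smp t i)) x (innerLoop P θ smp x y t)

/-- `v_Q = η ∑_{i=0}^Q r_i`, from `v₀` and the Hessian samples: `smp j i` is the `i`-th sample of
`B_j`. -/
def vQ (P : Problem p q Ξ Z) (θ : Params) (μ : ℝ) (smp : ℕ → ℕ → Z) (x : Vec p) (y v₀ : Vec q) :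
    Vec q :=
  θ.η • ∑ s ∈ Finset.range (θ.Q + 1),
    neumann θ.η θ.Q
      (fun j => batchMean (θ.hessBatch μ j) fun i => hessY (fun w => P.G w (smp j i)) x y) v₀ s

/-- The hypergradient estimator
`∇ₓF(x, y; D_F) - ∇ₓ∇_yG(x, y; D_G) v_Q`, with `v₀ = ∇_yF(x, y; D_F)`. -/
def hyperGrad (P : Problem p q Ξ Z) (θ : Params) (μ : ℝ) (smpF : ℕ → Ξ) (smpG : ℕ → Z)
    (smpH : ℕ → ℕ → Z) (x : Vec p) (y : Vec q) : Vec p :=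
  batchMean θ.Df (fun i => gradX (fun w => P.F w (smpF i)) x y) -
    batchMean θ.Dg (fun i => jacXY (fun w => P.G w (smpG i)) x y)
      (vQ P θ μ smpH x y (batchMean θ.Df fun i => gradY (fun w => P.F w (smpF i)) x y))

/-- State `(x_k, y_k^0)` of stocBiO at the start of outer iteration `k`, as a function of the
samples: `ξ (k, i)` is the `i`-th element of the batch `D_F` of iteration `k`. The inner loop is
warm-started, `y_{k+1}^0 = y_k^D`. -/
def stocBiO (P : Problem p q Ξ Z) (θ : Params) (μ : ℝ) (x₀ : Vec p) (y₀ : Vec q)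
    (ξ : ℕ × ℕ → Ξ) (ζ : GDraw → Z) : ℕ → Vec p × Vec q
  | 0 => (x₀, y₀)
  | k + 1 =>
      let x := (stocBiO P θ μ x₀ y₀ ξ ζ k).1
      let yD := innerLoop P θ (fun t i => ζ (.inner k t i)) x (stocBiO P θ μ x₀ y₀ ξ ζ k).2 θ.D
      (x - θ.β • hyperGrad P θ μ (fun i => ξ (k, i)) (fun i => ζ (.jac k i))
          (fun j i => ζ (.hess k j i)) x yD,
        yD)

/-- All samples are mutually independent, the `ξ`'s with the distribution of `ξ` and the `ζ`'s
with that of `ζ`. -/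
structure IsSampling (P : Problem p q Ξ Z) {Ω : Type*} [MeasurableSpace Ω] (Pr : Measure Ω)
    (ξ : ℕ × ℕ → Ω → Ξ) (ζ : GDraw → Ω → Z) : Prop where
  measurable_ξ : ∀ i, Measurable (ξ i)
  measurable_ζ : ∀ d, Measurable (ζ d)
  law_ξ : ∀ i, Pr.map (ξ i) = P.lawξ
  law_ζ : ∀ d, Pr.map (ζ d) = P.lawζ
  indep_ξ : iIndepFun ξ Pr
  indep_ζ : iIndepFun ζ Pr
  indep : IndepFun (fun ω i => ξ i ω) (fun ω d => ζ d ω) Pr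

/-- The random outer iterate `x_k`. -/
def iterate (P : Problem p q Ξ Z) (θ : Params) (μ : ℝ) (x₀ : Vec p) (y₀ : Vec q) {Ω : Type*}
    (ξ : ℕ × ℕ → Ω → Ξ) (ζ : GDraw → Ω → Z) (k : ℕ) (ω : Ω) : Vec p :=
  (stocBiO P θ μ x₀ y₀ (fun i => ξ i ω) (fun d => ζ d ω) k).1

/-- The random output `x̄` of `K` outer iterations: an element of `x_0, …, x_{K-1}` chosen by an
index that is uniform on `{0, …, K-1}` and independent of the samples. It lives on `Ω × Fin K`
with the product measure `outputMeasure`. -/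
def output (P : Problem p q Ξ Z) (θ : Params) (μ : ℝ) (x₀ : Vec p) (y₀ : Vec q) {Ω : Type*}
    (ξ : ℕ × ℕ → Ω → Ξ) (ζ : GDraw → Ω → Z) (s : Ω × Fin θ.K) : Vec p :=
  iterate P θ μ x₀ y₀ ξ ζ s.2 s.1

/-- Joint law of the samples and the uniform output index. -/
def outputMeasure {Ω : Type*} [MeasurableSpace Ω] (Pr : Measure Ω) (K : ℕ) :
    Measure (Ω × Fin K) :=
  Pr.prod (uniformOn (Set.univ : Set (Fin K)))

/-- A random point `xbar` is an `ε`-accurate stationary point: `E ‖∇Φ(xbar)‖² ≤ ε`. -/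
def IsAccurateStationary (P : Problem p q Ξ Z) {Ω' : Type*} [MeasurableSpace Ω'] (νout : Measure Ω')
    (xbar : Ω' → Vec p) (ε : ℝ) : Prop :=
  Integrable (fun s => ‖gradient P.Phi (xbar s)‖ ^ 2) νout ∧
    ∫ s, ‖gradient P.Phi (xbar s)‖ ^ 2 ∂νout ≤ ε

end Algorithm

/-! ### Complexity counts over `K` outer iterations -/

/-- Number of evaluations of `∇ₓF(x, y; ξ)` or `∇_yF(x, y; ξ)`: both are evaluated once on every
element of `D_F`. -/
def Params.gcF (θ : Params) : ℕ := θ.K * (2 * θ.Df)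

/-- Number of evaluations of `∇_yG(x, y; ζ)`: the `D` inner SGD steps with batches of size `S`,
and the maps `G_j(y) = y - η ∇_yG(x, y; B_j)` that are differentiated in the construction of
`v_Q`. -/
def Params.gcG (θ : Params) (μ : ℝ) : ℕ :=
  θ.K * (θ.D * θ.S + ∑ j ∈ Finset.Icc 1 θ.Q, θ.hessBatch μ j)

/-- Number of Jacobian-vector products `∇ₓ∇_yG(x, y; ζ) v`: one for every element of `D_G`. -/
def Params.jvG (θ : Params) : ℕ := θ.K * θ.Dg

/-- Number of Hessian-vector products `∇_y²G(x, y; ζ) v`: one for every element of every `B_j`. -/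
def Params.hvG (θ : Params) (μ : ℝ) : ℕ := θ.K * ∑ j ∈ Finset.Icc 1 θ.Q, θ.hessBatch μ j

/-! ### Constants -/

/-- The smoothness parameter `L_Φ`. -/
def LPhi (L M τ ρ μ : ℝ) : ℝ :=
  L + (2 * L ^ 2 + τ * M ^ 2) / μ + (ρ * L * M + L ^ 3 + τ * M * L) / μ ^ 2
    + ρ * L ^ 2 * M / μ ^ 3

/-- The constant `L + L²/μ + Mτ/μ + LMρ/μ²`. -/
def errConst (L M τ ρ μ : ℝ) : ℝ := L + L ^ 2 / μ + M * τ / μ + L * M * ρ / μ ^ 2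

/-- The lower bound on the number `D` of inner steps, with `β = 1 / (4 L_Φ)`. For `μ = L` the
denominators are infinite and the value is `0`, which is also what the Lean conventions give. -/
def innerThreshold (L M τ ρ μ : ℝ) : ℝ :=
  max
    (Real.log (12 + 48 * (1 / (4 * LPhi L M τ ρ μ)) ^ 2 * L ^ 2 / μ ^ 2 * errConst L M τ ρ μ ^ 2)
      / (2 * Real.log ((L + μ) / (L - μ))))
    (Real.log (√(1 / (4 * LPhi L M τ ρ μ)) * errConst L M τ ρ μ)
      / Real.log ((L + μ) / (L - μ)))

/-- The parameter choices common to all runs: `α = 2/(L+μ)`, `β = 1/(4 L_Φ)`, `0 < η < 1/L`,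
positive counts, and `B ≥ 1 / (Q (1-ημ)^{Q-1})`. -/
structure Params.IsTuned (θ : Params) (L M τ ρ μ : ℝ) : Prop where
  K_pos : 1 ≤ θ.K
  D_pos : 1 ≤ θ.D
  Q_pos : 1 ≤ θ.Q
  S_pos : 1 ≤ θ.S
  Dg_pos : 1 ≤ θ.Dg
  Df_pos : 1 ≤ θ.Df
  α_eq : θ.α = 2 / (L + μ)
  β_eq : θ.β = 1 / (4 * LPhi L M τ ρ μ)
  η_pos : 0 < θ.η
  η_lt : θ.η < 1 / L
  B_ge : 1 / (θ.Q * (1 - θ.η * μ) ^ (θ.Q - 1)) ≤ θ.B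

end StocBiO

end

noncomputable section

open MeasureTheory ProbabilityTheory Filter Topology Asymptotics

namespace StocBiO

/-! ### Symmetric operators with bounded quadratic form -/

section Operators

variable {E : Type*} [NormedAddCommGroup E] [InnerProductSpace ℝ E]

/-! The formula ∇Φ(x) = ∇ₓf − ∇ₓ∇_yg [∇_y²g]⁻¹ ∇_yf at y = y*(x) extends to a map `hyper` of all (x,
y), which is Lipschitz with constant P = `errConst` = O(κ²) (`hyper_lipschitz`) and bounded by O(κ)
(`norm_hyper_le`). Hence ∇Φ is Lipschitz with constant at most 2 L_Φ, and stocBiO is inexact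
gradient descent on Φ. With d_k the direction used, the descent inequality `Phi_sub_smul_le` retains
a term −β/4 ‖d_k‖² and is charged β/2 ‖d_k − ∇Φ(x_k)‖². The error d_k − ∇Φ(x_k) is the error of the
estimator of hyper(x_k, y_k^D), plus a bias of size at most P ‖y_k^D − y*(x_k)‖. Only mean squares
matter, so d_k need not be unbiased.

Estimator. Telescoping the Neumann iteration (`hess_dirV`) shows that v_Q solves the system ∇_y²g v
= ∇_yf up to the noise of D_F, a last residual of norm at most (1 − ημ)^Q M, and the accumulated
sampling error of the Hessian batches. That last error is a sum of martingale differences. Since T²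
≤ LT when 0 ≤ T ≤ L, the variance of a sampled Hessian-vector product is controlled by the energy
E⟨∇_y²G r, r⟩, and each Neumann step dissipates this energy: E‖r_{i−1}‖² + η · energy ≤ E‖r_i‖². The
batch sizes, proportional to (1 − ημ)^j, put weights (1 − ημ)^{−j} on the energies; a summation by
parts (`weighted_dissipation_le`) then gives the total 2M²/(BQ). Bounding each variance by L²‖r‖²
would lose a factor κ. The resulting term κ²/(BQ) is stronger than κ²/B in (a), and it is what makes
κ⁶ε⁻² Hessian-vector products sufficient in (b).

Inner loop. Let t_k and δ_k be the mean squares of y_k^D − y*(x_k) and y_k^0 − y*(x_k). SGD gives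
t_k ≤ λ δ_k + σ²/(LμS) with λ = ((L − μ)/(L + μ))^{2D}; the warm start and the Lipschitz continuity
of y* give δ_{k+1} ≤ 2 t_k + 2κ²β² E‖d_k‖². For λ ≤ 1/12 this is a contraction whose forcing is
absorbed by the retained descent term, because κP ≤ L_Φ. The initial inner error needs care: summed
naively it costs P²R₀², of order κ⁴. But the bias is also bounded by some H = O(κ), so a part w of
the inner error costs at most min(P²w², H²) ≤ P w H. With w decaying geometrically the sum is O(κ P
R₀) = O(L_Φ), the same order as the initial gap of Φ (`le_add_mul_of_le_sq`, `sum_grad_le`). So a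
contraction by a fixed factor suffices, and D of order κ is enough in (b).

All expectations are computed on the canonical product space of samples. Conditioning is replaced
there by overwriting one coordinate with a fresh copy (`FreshBatch`). -/

/-- A symmetric operator with `0 ≤ T ≤ c` satisfies `T² ≤ c T`. -/
lemma norm_sq_apply_le_of_symm {T : E →L[ℝ] E} {c : ℝ} (hc : 0 ≤ c)
    (hsymm : ∀ v w, inner ℝ (T v) w = inner ℝ v (T w))
    (hpos : ∀ v, 0 ≤ inner ℝ (T v) v) (hle : ∀ v, inner ℝ (T v) v ≤ c * ‖v‖ ^ 2) (v : E) :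
    ‖T v‖ ^ 2 ≤ c * inner ℝ (T v) v := by
  -- The form of `T` is nonnegative at v − t T v. The best choice is t = 1/c; t = 1 settles the case
  -- c = 0.
  have key : ∀ t : ℝ, 0 ≤ inner ℝ (T v) v - 2 * t * ‖T v‖ ^ 2 + t ^ 2 * (c * ‖T v‖ ^ 2) := by
    intro t
    have h := hpos (v - t • T v)
    have e : inner ℝ (T (v - t • T v)) (v - t • T v)
        = inner ℝ (T v) v - 2 * t * ‖T v‖ ^ 2 + t ^ 2 * inner ℝ (T (T v)) (T v) := by
      simp only [map_sub, map_smul, inner_sub_left, inner_sub_right, real_inner_smul_left,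
        real_inner_smul_right]
      rw [hsymm (T v) v, real_inner_self_eq_norm_sq]
      ring
    rw [e] at h
    have h2 := mul_le_mul_of_nonneg_left (hle (T v)) (sq_nonneg t)
    linarith
  rcases hc.eq_or_lt with h0 | h0
  · subst h0
    have h1 := hle v
    have h2 := key 1
    have h3 := hpos v
    nlinarith [sq_nonneg ‖T v‖]
  · have h1 := key (1 / c)
    have h2 : inner ℝ (T v) v - 2 * (1 / c) * ‖T v‖ ^ 2 + (1 / c) ^ 2 * (c * ‖T v‖ ^ 2)
        = inner ℝ (T v) v - ‖T v‖ ^ 2 / c := by field_simp; ring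
    rw [h2, sub_nonneg, div_le_iff₀ h0] at h1
    linarith

/-- A gradient step with a symmetric operator `μ ≤ T ≤ L` contracts by `1 - cμ`. -/
lemma norm_sub_smul_apply_le {T : E →L[ℝ] E} {μ L c : ℝ} (hμL : μ ≤ L)
    (hc : 0 ≤ c) (hcL : c * (L + μ) ≤ 2)
    (hsymm : ∀ v w, inner ℝ (T v) w = inner ℝ v (T w))
    (hge : ∀ v, μ * ‖v‖ ^ 2 ≤ inner ℝ (T v) v) (hle : ∀ v, inner ℝ (T v) v ≤ L * ‖v‖ ^ 2) (v : E) :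
    ‖v - c • T v‖ ≤ (1 - c * μ) * ‖v‖ := by
  have hcμ : 0 ≤ 1 - c * μ := by nlinarith
  -- The shifted operator lies between 0 and L − μ, so T'² ≤ (L − μ) T'. After expanding the square,
  -- ⟨T'v, v⟩ carries the factor −c(2 − c(L + μ)) ≤ 0.
  set T' : E →L[ℝ] E := T - μ • ContinuousLinearMap.id ℝ E with hT'
  have hT'v : ∀ w, T' w = T w - μ • w := fun w => by simp [hT']
  have hin : ∀ w, inner ℝ (T' w) w = inner ℝ (T w) w - μ * ‖w‖ ^ 2 := fun w => by
    rw [hT'v, inner_sub_left, real_inner_smul_left, real_inner_self_eq_norm_sq]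
  have h1 := norm_sq_apply_le_of_symm (T := T') (c := L - μ) (by linarith)
    (fun w w' => by
      rw [hT'v, hT'v, inner_sub_left, inner_sub_right, hsymm, real_inner_smul_left,
        real_inner_smul_right])
    (fun w => by rw [hin]; linarith [hge w]) (fun w => by rw [hin]; linarith [hle w]) v
  have hpos : 0 ≤ inner ℝ (T' v) v := by rw [hin]; linarith [hge v]
  have e : v - c • T v = (1 - c * μ) • v - c • T' v := by rw [hT'v]; module
  have e2 : ‖v - c • T v‖ ^ 2 = (1 - c * μ) ^ 2 * ‖v‖ ^ 2
      - 2 * c * (1 - c * μ) * inner ℝ (T' v) v + c ^ 2 * ‖T' v‖ ^ 2 := by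
    rw [e, norm_sub_sq_real, norm_smul, norm_smul, real_inner_smul_left, real_inner_smul_right,
      real_inner_comm, mul_pow, mul_pow, Real.norm_eq_abs, Real.norm_eq_abs, sq_abs, sq_abs]
    ring
  have h3 : c ^ 2 * ‖T' v‖ ^ 2 ≤ c ^ 2 * ((L - μ) * inner ℝ (T' v) v) := by gcongr
  have h4 : 0 ≤ c * inner ℝ (T' v) v * (2 - c * (L + μ)) := by
    apply mul_nonneg (mul_nonneg hc hpos); linarith
  apply le_of_sq_le_sq _ (by positivity)
  rw [e2, mul_pow]
  nlinarith

end Operators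

/-! ### Joint variables -/

section Pair

variable {p q : ℕ}

/-- The embedding `x ↦ (x, 0)`. -/
def inlL (p q : ℕ) : Vec p →L[ℝ] Joint p q :=
  (WithLp.prodContinuousLinearEquiv 2 ℝ (Vec p) (Vec q)).symm.toContinuousLinearMap.comp
    (ContinuousLinearMap.inl ℝ (Vec p) (Vec q))

/-- The embedding `y ↦ (0, y)`. -/
def inrL (p q : ℕ) : Vec q →L[ℝ] Joint p q :=
  (WithLp.prodContinuousLinearEquiv 2 ℝ (Vec p) (Vec q)).symm.toContinuousLinearMap.comp
    (ContinuousLinearMap.inr ℝ (Vec p) (Vec q))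

lemma inlL_apply (x : Vec p) : inlL p q x = pair x 0 := rfl

lemma inrL_apply (y : Vec q) : inrL p q y = pair 0 y := rfl

@[simp] lemma pair_fst (x : Vec p) (y : Vec q) : (pair x y).fst = x := rfl

@[simp] lemma pair_snd (x : Vec p) (y : Vec q) : (pair x y).snd = y := rfl

lemma pair_eq (x : Vec p) (y : Vec q) : pair x y = inlL p q x + inrL p q y := by
  rw [inlL_apply, inrL_apply]
  simp only [pair, ← WithLp.toLp_add, Prod.mk_add_mk, add_zero, zero_add]

lemma pair_sub (x x' : Vec p) (y y' : Vec q) : pair x y - pair x' y' = pair (x - x') (y - y') := rfl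

lemma norm_pair_sq (x : Vec p) (y : Vec q) : ‖pair x y‖ ^ 2 = ‖x‖ ^ 2 + ‖y‖ ^ 2 :=
  WithLp.prod_norm_sq_eq_of_L2 _

lemma norm_pair_le (x : Vec p) (y : Vec q) : ‖pair x y‖ ≤ ‖x‖ + ‖y‖ := by
  apply le_of_sq_le_sq _ (by positivity)
  rw [norm_pair_sq]
  nlinarith [norm_nonneg x, norm_nonneg y]

lemma norm_pair_zero_left (y : Vec q) : ‖(pair 0 y : Joint p q)‖ = ‖y‖ := by
  rw [← sq_eq_sq₀ (by positivity) (by positivity), norm_pair_sq]; simp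

lemma norm_pair_zero_right (x : Vec p) : ‖(pair x 0 : Joint p q)‖ = ‖x‖ := by
  rw [← sq_eq_sq₀ (by positivity) (by positivity), norm_pair_sq]; simp

lemma norm_fst_le' (z : Joint p q) : ‖z.fst‖ ≤ ‖z‖ := by
  apply le_of_sq_le_sq _ (by positivity)
  rw [WithLp.prod_norm_sq_eq_of_L2 z]
  nlinarith [sq_nonneg ‖z.snd‖]

lemma norm_snd_le' (z : Joint p q) : ‖z.snd‖ ≤ ‖z‖ := by
  apply le_of_sq_le_sq _ (by positivity)
  rw [WithLp.prod_norm_sq_eq_of_L2 z]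
  nlinarith [sq_nonneg ‖z.fst‖]

lemma norm_inlL_le : ‖inlL p q‖ ≤ 1 :=
  ContinuousLinearMap.opNorm_le_bound _ zero_le_one fun x => by
    rw [inlL_apply, norm_pair_zero_right, one_mul]

lemma norm_inrL_le : ‖inrL p q‖ ≤ 1 :=
  ContinuousLinearMap.opNorm_le_bound _ zero_le_one fun x => by
    rw [inrL_apply, norm_pair_zero_left, one_mul]

lemma hasFDerivAt_pair_left (x : Vec p) (y : Vec q) :
    HasFDerivAt (fun x' => pair x' y) (inlL p q) x := by
  have : (fun x' => pair x' y) = fun x' => inlL p q x' + inrL p q y := by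
    funext x'; exact pair_eq x' y
  rw [this]
  exact (inlL p q).hasFDerivAt.add_const _

lemma hasFDerivAt_pair_right (x : Vec p) (y : Vec q) :
    HasFDerivAt (fun y' => pair x y') (inrL p q) y := by
  have : (fun y' => pair x y') = fun y' => inlL p q x + inrL p q y' := by
    funext y'; exact pair_eq x y'
  rw [this]
  exact (inrL p q).hasFDerivAt.const_add _

lemma continuous_pair : Continuous fun z : Vec p × Vec q => pair z.1 z.2 :=
  (WithLp.prodContinuousLinearEquiv 2 ℝ (Vec p) (Vec q)).symm.continuous

lemma inner_joint (z w : Joint p q) :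
    inner ℝ z w = inner ℝ z.fst w.fst + inner ℝ z.snd w.snd :=
  WithLp.prod_inner_apply z w

variable {h : Joint p q → ℝ}

lemma fderiv_apply_eq_inner_gradient (z w : Joint p q) :
    fderiv ℝ h z w = inner ℝ (gradient h z) w := by
  rw [gradient, InnerProductSpace.toDual_symm_apply]

lemma hasGradientAt_snd {x : Vec p} {y : Vec q} (hd : DifferentiableAt ℝ h (pair x y)) :
    HasGradientAt (fun y' => h (pair x y')) (gradient h (pair x y)).snd y := by
  rw [hasGradientAt_iff_hasFDerivAt]
  have h1 := hd.hasFDerivAt.comp y (hasFDerivAt_pair_right x y)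
  refine h1.congr_fderiv ?_
  ext v
  rw [ContinuousLinearMap.comp_apply, fderiv_apply_eq_inner_gradient, inner_joint, inrL_apply]
  simp

lemma hasGradientAt_fst {x : Vec p} {y : Vec q} (hd : DifferentiableAt ℝ h (pair x y)) :
    HasGradientAt (fun x' => h (pair x' y)) (gradient h (pair x y)).fst x := by
  rw [hasGradientAt_iff_hasFDerivAt]
  have h1 := HasFDerivAt.comp x hd.hasFDerivAt (hasFDerivAt_pair_left x y)
  refine h1.congr_fderiv ?_
  ext v
  rw [ContinuousLinearMap.comp_apply, fderiv_apply_eq_inner_gradient, inner_joint, inlL_apply]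
  simp

lemma gradY_eq {x : Vec p} {y : Vec q} (hd : DifferentiableAt ℝ h (pair x y)) :
    gradY h x y = (gradient h (pair x y)).snd := (hasGradientAt_snd hd).gradient

lemma gradX_eq {x : Vec p} {y : Vec q} (hd : DifferentiableAt ℝ h (pair x y)) :
    gradX h x y = (gradient h (pair x y)).fst := (hasGradientAt_fst hd).gradient

lemma hasGradientAt_gradY {x : Vec p} {y : Vec q} (hd : DifferentiableAt ℝ h (pair x y)) :
    HasGradientAt (fun y' => h (pair x y')) (gradY h x y) y := by
  rw [gradY_eq hd]; exact hasGradientAt_snd hd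

/-- The joint derivative in terms of the partial gradients. -/
lemma fderiv_eq_partial {x : Vec p} {y : Vec q} (hd : DifferentiableAt ℝ h (pair x y))
    (w : Joint p q) :
    fderiv ℝ h (pair x y) w = inner ℝ (gradX h x y) w.fst + inner ℝ (gradY h x y) w.snd := by
  rw [fderiv_apply_eq_inner_gradient, inner_joint, gradX_eq hd, gradY_eq hd]

end Pair

/-! ### A sample of the lower-level loss -/

section Sample

variable {p q : ℕ} {h : Joint p q → ℝ}

lemma hasFDerivAt_gradY_right {z : Joint p q}
    (hd : DifferentiableAt ℝ (fun z : Joint p q => gradY h z.fst z.snd) z) :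
    HasFDerivAt (fun y' => gradY h z.fst y')
      ((fderiv ℝ (fun z : Joint p q => gradY h z.fst z.snd) z).comp (inrL p q)) z.snd :=
  HasFDerivAt.comp (g := fun z : Joint p q => gradY h z.fst z.snd) z.snd hd.hasFDerivAt
    (hasFDerivAt_pair_right z.fst z.snd)

lemma hasFDerivAt_gradY_left {z : Joint p q}
    (hd : DifferentiableAt ℝ (fun z : Joint p q => gradY h z.fst z.snd) z) :
    HasFDerivAt (fun x' => gradY h x' z.snd)
      ((fderiv ℝ (fun z : Joint p q => gradY h z.fst z.snd) z).comp (inlL p q)) z.fst :=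
  HasFDerivAt.comp (g := fun z : Joint p q => gradY h z.fst z.snd) z.fst hd.hasFDerivAt
    (hasFDerivAt_pair_left z.fst z.snd)

lemma hessY_eq {z : Joint p q}
    (hd : DifferentiableAt ℝ (fun z : Joint p q => gradY h z.fst z.snd) z) :
    hessY h z.fst z.snd
      = (fderiv ℝ (fun z : Joint p q => gradY h z.fst z.snd) z).comp (inrL p q) :=
  (hasFDerivAt_gradY_right hd).fderiv

lemma jacXY_eq {z : Joint p q}
    (hd : DifferentiableAt ℝ (fun z : Joint p q => gradY h z.fst z.snd) z) :
    jacXY h z.fst z.snd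
      = ContinuousLinearMap.adjoint
        ((fderiv ℝ (fun z : Joint p q => gradY h z.fst z.snd) z).comp (inlL p q)) := by
  rw [jacXY, (hasFDerivAt_gradY_left hd).fderiv]

/-- Regularity of one sample `G(·; ζ)` of the lower-level loss. -/
structure SampleRegular (h : Joint p q → ℝ) (L μ : ℝ) : Prop where
  diff : Differentiable ℝ h
  diff_gradY : Differentiable ℝ fun z : Joint p q => gradY h z.fst z.snd
  strongConvex : ∀ x, StrongConvexOn Set.univ μ fun y => h (pair x y)
  lipschitz : ∀ z z', ‖gradient h z - gradient h z'‖ ≤ L * ‖z - z'‖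

variable {L μ : ℝ}

lemma norm_gradY_sub_le {h : Joint p q → ℝ} (hd : Differentiable ℝ h)
    (hl : ∀ z z', ‖gradient h z - gradient h z'‖ ≤ L * ‖z - z'‖) (z z' : Joint p q) :
    ‖gradY h z.fst z.snd - gradY h z'.fst z'.snd‖ ≤ L * ‖z - z'‖ := by
  rw [gradY_eq (hd _), gradY_eq (hd _)]
  exact (norm_snd_le' (gradient h z - gradient h z')).trans (hl z z')

lemma norm_gradX_sub_le {h : Joint p q → ℝ} (hd : Differentiable ℝ h)
    (hl : ∀ z z', ‖gradient h z - gradient h z'‖ ≤ L * ‖z - z'‖) (z z' : Joint p q) :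
    ‖gradX h z.fst z.snd - gradX h z'.fst z'.snd‖ ≤ L * ‖z - z'‖ := by
  rw [gradX_eq (hd _), gradX_eq (hd _)]
  exact (norm_fst_le' (gradient h z - gradient h z')).trans (hl z z')

namespace SampleRegular

variable (S : SampleRegular h L μ)
include S

lemma norm_fderiv_gradY_le (hL : 0 ≤ L) (z : Joint p q) :
    ‖fderiv ℝ (fun z : Joint p q => gradY h z.fst z.snd) z‖ ≤ L :=
  (S.diff_gradY z).hasFDerivAt.le_of_lip' hL
    (Eventually.of_forall fun z' => norm_gradY_sub_le S.diff S.lipschitz z' z)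

lemma norm_hessY_le (hL : 0 ≤ L) (x : Vec p) (y : Vec q) : ‖hessY h x y‖ ≤ L := by
  have := hessY_eq (S.diff_gradY (pair x y))
  simp only [pair_fst, pair_snd] at this
  rw [this]
  refine (ContinuousLinearMap.opNorm_comp_le _ _).trans ?_
  calc _ ≤ L * 1 := mul_le_mul (S.norm_fderiv_gradY_le hL _) norm_inrL_le (norm_nonneg _) hL
    _ = L := mul_one L

lemma norm_jacXY_le (hL : 0 ≤ L) (x : Vec p) (y : Vec q) : ‖jacXY h x y‖ ≤ L := by
  have := jacXY_eq (S.diff_gradY (pair x y))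
  simp only [pair_fst, pair_snd] at this
  rw [this, LinearIsometryEquiv.norm_map]
  refine (ContinuousLinearMap.opNorm_comp_le _ _).trans ?_
  calc _ ≤ L * 1 := mul_le_mul (S.norm_fderiv_gradY_le hL _) norm_inlL_le (norm_nonneg _) hL
    _ = L := mul_one L

lemma hasFDerivAt_gradY (x : Vec p) (y : Vec q) :
    HasFDerivAt (fun y' => gradY h x y') (hessY h x y) y := by
  have := hasFDerivAt_gradY_right (S.diff_gradY (pair x y))
  have h2 := hessY_eq (S.diff_gradY (pair x y))
  simp only [pair_fst, pair_snd] at this h2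
  rw [h2]; exact this

/-- Symmetry of second derivatives, after the gradient is turned back into a differential by the
Riesz isometry. -/
lemma hessY_symm (x : Vec p) (y v w : Vec q) :
    inner ℝ (hessY h x y v) w = inner ℝ v (hessY h x y w) := by
  have h1 : ∀ y', HasFDerivAt (fun y' => h (pair x y'))
      (InnerProductSpace.toDual ℝ (Vec q) (gradY h x y')) y' := fun y' =>
    (hasGradientAt_gradY (S.diff (pair x y'))).hasFDerivAt
  have h2 : HasFDerivAt (fun y' => InnerProductSpace.toDual ℝ (Vec q) (gradY h x y'))
      (((InnerProductSpace.toDual ℝ (Vec q)).toContinuousLinearEquiv.toContinuousLinearMap).comp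
        (hessY h x y)) y :=
    ((InnerProductSpace.toDual ℝ (Vec q)).toContinuousLinearEquiv.toContinuousLinearMap).hasFDerivAt.comp
      y (S.hasFDerivAt_gradY x y)
  have h3 := second_derivative_symmetric h1 h2 v w
  simp only [ContinuousLinearMap.comp_apply] at h3
  change inner ℝ (hessY h x y v) w = inner ℝ (hessY h x y w) v at h3
  rw [h3, real_inner_comm]

/-- On the segment from y to y' the function h − μ/2 ‖·‖² is convex, so its derivative at the end is
at least its derivative at the start. -/
lemma gradY_strongMono (x : Vec p) (y y' : Vec q) :
    μ * ‖y' - y‖ ^ 2 ≤ inner ℝ (gradY h x y' - gradY h x y) (y' - y) := by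
  have hc := (strongConvexOn_iff_convex.1 (S.strongConvex x))
  set φ : Vec q → ℝ := fun y => h (pair x y) - μ / 2 * ‖y‖ ^ 2 with hφ
  set ℓ : ℝ →ᵃ[ℝ] Vec q := AffineMap.lineMap y y' with hℓ
  have hcl : ConvexOn ℝ Set.univ (φ ∘ ℓ) := by simpa using hc.comp_affineMap ℓ
  have hder : ∀ t : ℝ, HasDerivAt (φ ∘ ℓ)
      (inner ℝ (gradY h x (ℓ t)) (y' - y) - μ * inner ℝ (ℓ t) (y' - y)) t := by
    intro t
    have hl : HasDerivAt ℓ (y' - y) t := by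
      rw [hℓ]; exact AffineMap.hasDerivAt_lineMap
    have h1 := (hasGradientAt_gradY (S.diff (pair x (ℓ t)))).hasFDerivAt.comp_hasDerivAt t hl
    have h2 : HasDerivAt (fun s => ‖ℓ s‖ ^ 2) (2 * inner ℝ (ℓ t) (y' - y)) t := hl.norm_sq
    have h3 := h1.sub (h2.const_mul (μ / 2))
    refine h3.congr_deriv ?_
    simp
    ring
  have hmono := hcl.monotoneOn_deriv (fun t _ => (hder t).differentiableAt)
    (Set.mem_univ (0 : ℝ)) (Set.mem_univ (1 : ℝ)) zero_le_one
  rw [(hder 0).deriv, (hder 1).deriv] at hmono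
  simp only [hℓ, AffineMap.lineMap_apply_zero, AffineMap.lineMap_apply_one] at hmono
  have e : ‖y' - y‖ ^ 2 = inner ℝ y' (y' - y) - inner ℝ y (y' - y) := by
    rw [← inner_sub_left, real_inner_self_eq_norm_sq]
  rw [inner_sub_left, e]
  linarith

/-- Strong monotonicity makes t ↦ ⟨∇_y h(x, y + tv), v⟩ − tμ‖v‖² monotone; the claim is the sign of
its derivative at 0. -/
lemma le_inner_hessY (x : Vec p) (y v : Vec q) :
    μ * ‖v‖ ^ 2 ≤ inner ℝ (hessY h x y v) v := by
  have hd : HasDerivAt (fun t : ℝ => inner ℝ (gradY h x (y + t • v)) v - t * (μ * ‖v‖ ^ 2))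
      (inner ℝ (hessY h x y v) v - μ * ‖v‖ ^ 2) 0 := by
    have hl : HasDerivAt (fun t : ℝ => y + t • v) v 0 := by
      simpa using ((hasDerivAt_id (0 : ℝ)).smul_const v).const_add y
    have h0 : HasFDerivAt (fun y' => gradY h x y') (hessY h x y) (y + (0 : ℝ) • v) := by
      simpa using S.hasFDerivAt_gradY x y
    have h1 := (h0.comp_hasDerivAt (0 : ℝ) hl).inner ℝ (hasDerivAt_const (0 : ℝ) v)
    have h2 := h1.sub ((hasDerivAt_id (0 : ℝ)).mul_const (μ * ‖v‖ ^ 2))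
    refine h2.congr_deriv ?_
    simp
  have hmono : Monotone fun t : ℝ => inner ℝ (gradY h x (y + t • v)) v - t * (μ * ‖v‖ ^ 2) := by
    intro s t hst
    rcases hst.eq_or_lt with rfl | hlt
    · exact le_rfl
    have h1 := S.gradY_strongMono x (y + s • v) (y + t • v)
    have e : y + t • v - (y + s • v) = (t - s) • v := by module
    rw [e, norm_smul, real_inner_smul_right, mul_pow, Real.norm_eq_abs, sq_abs] at h1
    have h2 : (t - s) * (μ * ‖v‖ ^ 2)
        ≤ inner ℝ (gradY h x (y + t • v) - gradY h x (y + s • v)) v := by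
      have : 0 < t - s := by linarith
      refine le_of_mul_le_mul_left ?_ this
      nlinarith
    rw [inner_sub_left] at h2
    simp only
    linarith
  have := hmono.deriv_nonneg (x := 0)
  rw [hd.deriv] at this
  linarith

lemma inner_hessY_le (hL : 0 ≤ L) (x : Vec p) (y v : Vec q) :
    inner ℝ (hessY h x y v) v ≤ L * ‖v‖ ^ 2 := by
  calc inner ℝ (hessY h x y v) v ≤ ‖hessY h x y v‖ * ‖v‖ := real_inner_le_norm _ _
    _ ≤ (L * ‖v‖) * ‖v‖ := by
        gcongr
        exact (ContinuousLinearMap.le_opNorm _ _).trans (by gcongr; exact S.norm_hessY_le hL x y)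
    _ = L * ‖v‖ ^ 2 := by ring

lemma norm_sub_smul_hessY_le (hμL : μ ≤ L) (hμ : 0 ≤ μ) {c : ℝ} (hc : 0 ≤ c)
    (hcL : c * (L + μ) ≤ 2) (x : Vec p) (y : Vec q) (v : Vec q) :
    ‖v - c • hessY h x y v‖ ≤ (1 - c * μ) * ‖v‖ :=
  norm_sub_smul_apply_le hμL hc hcL (S.hessY_symm x y) (S.le_inner_hessY x y)
    (S.inner_hessY_le (hμ.trans hμL) x y) v

lemma norm_sq_hessY_le (hμ : 0 ≤ μ) (hL : 0 ≤ L) (x : Vec p) (y : Vec q) (v : Vec q) :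
    ‖hessY h x y v‖ ^ 2 ≤ L * inner ℝ (hessY h x y v) v :=
  norm_sq_apply_le_of_symm hL (S.hessY_symm x y)
    (fun w => (by positivity : 0 ≤ μ * ‖w‖ ^ 2).trans (S.le_inner_hessY x y w))
    (S.inner_hessY_le hL x y) v

/-- Mean value inequality: the derivative of the gradient step is I − c∇_y²h, a contraction by 1 −
cμ. For c = 2/(L + μ) the factor is (L − μ)/(L + μ). -/
lemma norm_gradStep_sub_le (hμL : μ ≤ L) (hμ : 0 ≤ μ) {c : ℝ} (hc : 0 ≤ c)
    (hcL : c * (L + μ) ≤ 2) (x : Vec p) (y y' : Vec q) :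
    ‖(y - c • gradY h x y) - (y' - c • gradY h x y')‖ ≤ (1 - c * μ) * ‖y - y'‖ := by
  have hcμ : 0 ≤ 1 - c * μ := by nlinarith
  refine convex_univ.norm_image_sub_le_of_norm_hasFDerivWithin_le (𝕜 := ℝ)
    (f := fun y => y - c • gradY h x y)
    (f' := fun y => ContinuousLinearMap.id ℝ _ - c • hessY h x y) (fun y _ => ?_) (fun y _ => ?_)
    (Set.mem_univ _) (Set.mem_univ _)
  · exact ((hasFDerivAt_id y).sub ((S.hasFDerivAt_gradY x y).const_smul c)).hasFDerivWithinAt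
  · refine ContinuousLinearMap.opNorm_le_bound _ hcμ fun v => ?_
    simpa using S.norm_sub_smul_hessY_le hμL hμ hc hcL x y v

end SampleRegular

end Sample

section MeanOracles

/-! ### Measurability and integration lemmas -/

section Integration

variable {Z : Type*} [MeasurableSpace Z]

/-- Directional derivatives are limits of difference quotients with increments 1/n, hence measurable
in the sample, and a linear map depends continuously on its values on a basis. -/
lemma measurable_fderiv_of_measurable {E F : Type*} [NormedAddCommGroup E] [NormedSpace ℝ E]
    [FiniteDimensional ℝ E] [NormedAddCommGroup F] [NormedSpace ℝ F] [SecondCountableTopology F]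
    [MeasurableSpace F] [BorelSpace F] {φ : E → Z → F} {x : E} (hm : ∀ e, Measurable (φ e))
    (hd : ∀ ζ, DifferentiableAt ℝ (fun e => φ e ζ) x) :
    Measurable fun ζ => fderiv ℝ (fun e => φ e ζ) x := by
  have happ : ∀ v : E, Measurable fun ζ => fderiv ℝ (fun e => φ e ζ) x v := by
    intro v
    have hc : Tendsto (fun n : ℕ => ‖((n : ℝ))‖) atTop atTop :=
      tendsto_norm_atTop_atTop.comp tendsto_natCast_atTop_atTop
    refine measurable_of_tendsto_metrizable
      (f := fun (n : ℕ) ζ => (n : ℝ) • (φ (x + (n : ℝ)⁻¹ • v) ζ - φ x ζ)) (fun n => ?_) ?_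
    · exact ((hm _).sub (hm _)).const_smul _
    · rw [tendsto_pi_nhds]
      intro ζ
      exact (hd ζ).hasFDerivAt.lim v hc
  let b := Module.finBasis ℝ E
  let Ψ : (Fin (Module.finrank ℝ E) → F) → (E →L[ℝ] F) := fun w =>
    ∑ i, (LinearMap.toContinuousLinearMap (b.coord i)).smulRight (w i)
  have hΨ : Continuous Ψ := by
    refine continuous_finsetSum _ fun i _ => ?_
    exact ((ContinuousLinearMap.smulRightL ℝ E F
      (LinearMap.toContinuousLinearMap (b.coord i))).continuous).comp (continuous_apply i)
  have e : (fun ζ => fderiv ℝ (fun e => φ e ζ) x)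
      = fun ζ => Ψ fun i => fderiv ℝ (fun e => φ e ζ) x (b i) := by
    funext ζ
    ext v
    have h1 := congrArg (fderiv ℝ (fun e => φ e ζ) x) (b.sum_repr v)
    rw [map_sum] at h1
    rw [← h1]
    simp [Ψ]
  rw [e]
  exact hΨ.measurable.comp (measurable_pi_lambda _ fun i => happ (b i))

lemma measurable_gradient_of_measurable {E : Type*} [NormedAddCommGroup E] [InnerProductSpace ℝ E]
    [FiniteDimensional ℝ E] [CompleteSpace E] [MeasurableSpace E] [BorelSpace E]
    {φ : E → Z → ℝ} {x : E} (hm : ∀ e, Measurable (φ e))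
    (hd : ∀ ζ, DifferentiableAt ℝ (fun e => φ e ζ) x) :
    Measurable fun ζ => gradient (fun e => φ e ζ) x :=
  (InnerProductSpace.toDual ℝ E).symm.continuous.measurable.comp
    (measurable_fderiv_of_measurable hm hd)

lemma norm_sq_eq_enorm {E : Type*} [SeminormedAddCommGroup E] (x : E) :
    ‖x‖ₑ ^ 2 = ENNReal.ofReal (‖x‖ ^ 2) := by
  rw [ENNReal.ofReal_pow (norm_nonneg _), ofReal_norm]

variable {ν : Measure Z} [IsProbabilityMeasure ν] {E : Type*} [NormedAddCommGroup E]
  [InnerProductSpace ℝ E] [CompleteSpace E]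

omit [IsProbabilityMeasure ν] [InnerProductSpace ℝ E] [CompleteSpace E] in
lemma memLp_two_of_lintegral_sq {X : Z → E} (hm : AEStronglyMeasurable X ν)
    (h : ∫⁻ ζ, ‖X ζ‖ₑ ^ 2 ∂ν ≠ ⊤) : MemLp X 2 ν := by
  refine ⟨hm, ?_⟩
  rw [eLpNorm_lt_top_iff_lintegral_rpow_enorm_lt_top (by norm_num) (by norm_num)]
  simpa using lt_of_le_of_ne le_top h

omit [IsProbabilityMeasure ν] [InnerProductSpace ℝ E] [CompleteSpace E] in
lemma integrable_norm_sq {X : Z → E} (h : MemLp X 2 ν) : Integrable (fun ζ => ‖X ζ‖ ^ 2) ν := by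
  simpa using h.integrable_norm_pow (by norm_num)

omit [IsProbabilityMeasure ν] [InnerProductSpace ℝ E] [CompleteSpace E] in
lemma lintegral_enorm_sq_eq {X : Z → E} (h : MemLp X 2 ν) :
    ∫⁻ ζ, ‖X ζ‖ₑ ^ 2 ∂ν = ENNReal.ofReal (∫ ζ, ‖X ζ‖ ^ 2 ∂ν) := by
  rw [ofReal_integral_eq_lintegral_ofReal (integrable_norm_sq h)
    (Eventually.of_forall fun _ => by positivity)]
  exact lintegral_congr fun ζ => norm_sq_eq_enorm _

lemma integral_norm_add_sq {X : Z → E} (h : MemLp X 2 ν) (h0 : ∫ ζ, X ζ ∂ν = 0) (a : E) :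
    ∫ ζ, ‖a + X ζ‖ ^ 2 ∂ν = ‖a‖ ^ 2 + ∫ ζ, ‖X ζ‖ ^ 2 ∂ν := by
  have hi : Integrable X ν := h.integrable (by norm_num)
  have e : ∀ ζ, ‖a + X ζ‖ ^ 2 = ‖a‖ ^ 2 + 2 * inner ℝ a (X ζ) + ‖X ζ‖ ^ 2 := fun ζ =>
    norm_add_sq_real _ _
  simp only [e]
  rw [integral_add, integral_add, integral_const_mul, integral_inner hi, h0]
  · simp
  · exact integrable_const _
  · exact (hi.const_inner a).const_mul 2
  · exact (integrable_const _).add ((hi.const_inner a).const_mul 2)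
  · exact integrable_norm_sq h

/-- Adding a centred random vector to a constant. -/
lemma lintegral_enorm_add_sq {X : Z → E} (h : MemLp X 2 ν) (h0 : ∫ ζ, X ζ ∂ν = 0) (a : E) :
    ∫⁻ ζ, ‖a + X ζ‖ₑ ^ 2 ∂ν = ‖a‖ₑ ^ 2 + ∫⁻ ζ, ‖X ζ‖ₑ ^ 2 ∂ν := by
  have h1 : MemLp (fun ζ => a + X ζ) 2 ν := (memLp_const a).add h
  rw [lintegral_enorm_sq_eq h1, lintegral_enorm_sq_eq h, integral_norm_add_sq h h0,
    ENNReal.ofReal_add (by positivity) (integral_nonneg fun _ => by positivity), norm_sq_eq_enorm]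

/-- The mean minimizes the mean square deviation. -/
lemma lintegral_enorm_sub_integral_sq_le {X : Z → E} (hm : AEStronglyMeasurable X ν) (c : E) :
    ∫⁻ ζ, ‖X ζ - ∫ ζ', X ζ' ∂ν‖ₑ ^ 2 ∂ν ≤ ∫⁻ ζ, ‖X ζ - c‖ₑ ^ 2 ∂ν := by
  by_cases h : ∫⁻ ζ, ‖X ζ - c‖ₑ ^ 2 ∂ν = ⊤
  · rw [h]; exact le_top
  have h1 : MemLp (fun ζ => X ζ - c) 2 ν :=
    memLp_two_of_lintegral_sq (hm.sub aestronglyMeasurable_const) h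
  have h2 : MemLp X 2 ν :=
    (h1.add (memLp_const c)).ae_eq (Eventually.of_forall fun ζ => by simp)
  set m := ∫ ζ, X ζ ∂ν with hmdef
  have hX : MemLp (fun ζ => X ζ - m) 2 ν := h2.sub (memLp_const m)
  have h0 : ∫ ζ, (X ζ - m) ∂ν = 0 := by
    rw [integral_sub (h2.integrable (by norm_num)) (integrable_const _)]; simp [hmdef]
  have e := lintegral_enorm_add_sq hX h0 (m - c)
  have e2 : ∀ ζ, m - c + (X ζ - m) = X ζ - c := fun ζ => by abel
  simp only [e2] at e
  rw [e]
  exact le_add_self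

end Integration

/-! ### Mean oracles -/

variable {p q : ℕ} {Ξ Z : Type*} [MeasurableSpace Ξ] [MeasurableSpace Z]

/-- `E ∇ₓF`. -/
def Problem.fx (P : Problem p q Ξ Z) (x : Vec p) (y : Vec q) : Vec p :=
  ∫ ξ, gradX (fun w => P.F w ξ) x y ∂P.lawξ

/-- `E ∇_yF`. -/
def Problem.fy (P : Problem p q Ξ Z) (x : Vec p) (y : Vec q) : Vec q :=
  ∫ ξ, gradY (fun w => P.F w ξ) x y ∂P.lawξ

/-- `E ∇_yG`. -/
def Problem.gy (P : Problem p q Ξ Z) (x : Vec p) (y : Vec q) : Vec q :=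
  ∫ ζ, gradY (fun w => P.G w ζ) x y ∂P.lawζ

/-- `E ∇_y²G`. -/
def Problem.hess (P : Problem p q Ξ Z) (x : Vec p) (y : Vec q) : Vec q →L[ℝ] Vec q :=
  ∫ ζ, hessY (fun w => P.G w ζ) x y ∂P.lawζ

/-- `E ∇ₓ∇_yG`. -/
def Problem.jac (P : Problem p q Ξ Z) (x : Vec p) (y : Vec q) : Vec q →L[ℝ] Vec p :=
  ∫ ζ, jacXY (fun w => P.G w ζ) x y ∂P.lawζ

namespace Problem.Assumptions

variable {P : Problem p q Ξ Z} {L M τ ρ μ σ : ℝ} (hP : P.Assumptions L M τ ρ μ σ)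
include hP

lemma sampleRegular (ζ : Z) : SampleRegular (fun w => P.G w ζ) L μ :=
  ⟨hP.differentiable_G ζ, hP.differentiable_gradY_G ζ, hP.strongConvex ζ, hP.lipschitz_grad_G ζ⟩

lemma differentiable_G_right (ζ : Z) (x : Vec p) : Differentiable ℝ fun y => P.G (pair x y) ζ :=
  fun y => (hasGradientAt_gradY (hP.differentiable_G ζ (pair x y))).differentiableAt

lemma differentiable_gradY_G_right (ζ : Z) (x : Vec p) :
    Differentiable ℝ fun y => gradY (fun w => P.G w ζ) x y :=
  fun y => ((hP.sampleRegular ζ).hasFDerivAt_gradY x y).differentiableAt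

lemma differentiable_gradY_G_left (ζ : Z) (y : Vec q) :
    Differentiable ℝ fun x => gradY (fun w => P.G w ζ) x y :=
  fun x => (hasFDerivAt_gradY_left (hP.differentiable_gradY_G ζ (pair x y))).differentiableAt

lemma norm_gradient_F_le (hM : 0 ≤ M) (ξ : Ξ) (z : Joint p q) :
    ‖gradient (fun w => P.F w ξ) z‖ ≤ M := by
  rw [gradient, LinearIsometryEquiv.norm_map]
  refine (hP.differentiable_F ξ z).hasFDerivAt.le_of_lip' hM (Eventually.of_forall fun z' => ?_)
  rw [Real.norm_eq_abs]
  exact hP.lipschitz_F ξ z' z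

lemma norm_gradX_F_le (hM : 0 ≤ M) (ξ : Ξ) (x : Vec p) (y : Vec q) :
    ‖gradX (fun w => P.F w ξ) x y‖ ≤ M := by
  rw [gradX_eq (hP.differentiable_F ξ _)]
  exact (norm_fst_le' _).trans (hP.norm_gradient_F_le hM ξ _)

lemma norm_gradY_F_le (hM : 0 ≤ M) (ξ : Ξ) (x : Vec p) (y : Vec q) :
    ‖gradY (fun w => P.F w ξ) x y‖ ≤ M := by
  rw [gradY_eq (hP.differentiable_F ξ _)]
  exact (norm_snd_le' _).trans (hP.norm_gradient_F_le hM ξ _)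

/-! Measurability in the sample. -/

lemma measurable_gradX_F (x : Vec p) (y : Vec q) :
    Measurable fun ξ => gradX (fun w => P.F w ξ) x y :=
  measurable_gradient_of_measurable (φ := fun x' ξ => P.F (pair x' y) ξ)
    (fun _ => hP.measurable_F _)
    fun ξ => (hasGradientAt_fst (hP.differentiable_F ξ (pair x y))).differentiableAt

lemma measurable_gradY_F (x : Vec p) (y : Vec q) :
    Measurable fun ξ => gradY (fun w => P.F w ξ) x y :=
  measurable_gradient_of_measurable (φ := fun y' ξ => P.F (pair x y') ξ)
    (fun _ => hP.measurable_F _)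
    fun ξ => (hasGradientAt_snd (hP.differentiable_F ξ (pair x y))).differentiableAt

lemma measurable_gradY_G (x : Vec p) (y : Vec q) :
    Measurable fun ζ => gradY (fun w => P.G w ζ) x y :=
  measurable_gradient_of_measurable (φ := fun y' ζ => P.G (pair x y') ζ)
    (fun _ => hP.measurable_G _) fun ζ => hP.differentiable_G_right ζ x y

lemma measurable_hessY_G (x : Vec p) (y : Vec q) :
    Measurable fun ζ => hessY (fun w => P.G w ζ) x y :=
  measurable_fderiv_of_measurable (φ := fun y' ζ => gradY (fun w => P.G w ζ) x y')
    (fun _ => hP.measurable_gradY_G _ _) fun ζ => hP.differentiable_gradY_G_right ζ x y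

lemma measurable_jacXY_G (x : Vec p) (y : Vec q) :
    Measurable fun ζ => jacXY (fun w => P.G w ζ) x y :=
  (ContinuousLinearMap.adjoint (𝕜 := ℝ) (E := Vec p) (F := Vec q)).continuous.measurable.comp
    (measurable_fderiv_of_measurable (φ := fun x' ζ => gradY (fun w => P.G w ζ) x' y)
      (fun _ => hP.measurable_gradY_G _ _) fun ζ => hP.differentiable_gradY_G_left ζ y x)

-- Carathéodory functions: continuous in the position, measurable in the sample, hence jointly
-- measurable. Joint measurability is needed because the position is itself random.
omit hP in
lemma measurable_uncurry_of_lipschitz {A V : Type*} [MeasurableSpace A] [NormedAddCommGroup V]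
    [MeasurableSpace V] [BorelSpace V] {T : Vec p → Vec q → A → V} {c : ℝ}
    (hT : ∀ a (z z' : Joint p q), ‖T z.fst z.snd a - T z'.fst z'.snd a‖ ≤ c * ‖z - z'‖)
    (hm : ∀ x y, Measurable (T x y)) :
    Measurable fun s : (Vec p × Vec q) × A => T s.1.1 s.1.2 s.2 := by
  refine measurable_uncurry_of_continuous_of_measurable
    (u := fun (z : Vec p × Vec q) a => T z.1 z.2 a) (fun a => ?_) fun z => hm _ _
  have h1 : Continuous fun z : Joint p q => T z.fst z.snd a := by
    have : LipschitzWith (Real.toNNReal c) fun z : Joint p q => T z.fst z.snd a :=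
      LipschitzWith.of_dist_le_mul fun z z' => by
        rw [dist_eq_norm, dist_eq_norm]
        exact (hT a z z').trans (by gcongr; exact Real.le_coe_toNNReal c)
    exact this.continuous
  exact h1.comp continuous_pair

lemma measurable_gradX_F' :
    Measurable fun s : (Vec p × Vec q) × Ξ => gradX (fun w => P.F w s.2) s.1.1 s.1.2 :=
  measurable_uncurry_of_lipschitz (T := fun x y ξ => gradX (fun w => P.F w ξ) x y)
    (fun ξ => norm_gradX_sub_le (hP.differentiable_F ξ) (hP.lipschitz_grad_F ξ))
    hP.measurable_gradX_F

lemma measurable_gradY_F' :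
    Measurable fun s : (Vec p × Vec q) × Ξ => gradY (fun w => P.F w s.2) s.1.1 s.1.2 :=
  measurable_uncurry_of_lipschitz (T := fun x y ξ => gradY (fun w => P.F w ξ) x y)
    (fun ξ => norm_gradY_sub_le (hP.differentiable_F ξ) (hP.lipschitz_grad_F ξ))
    hP.measurable_gradY_F

lemma measurable_gradY_G' :
    Measurable fun s : (Vec p × Vec q) × Z => gradY (fun w => P.G w s.2) s.1.1 s.1.2 :=
  measurable_uncurry_of_lipschitz (T := fun x y ζ => gradY (fun w => P.G w ζ) x y)
    (fun ζ => norm_gradY_sub_le (hP.differentiable_G ζ) (hP.lipschitz_grad_G ζ))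
    hP.measurable_gradY_G

lemma measurable_hessY_G' :
    Measurable fun s : (Vec p × Vec q) × Z => hessY (fun w => P.G w s.2) s.1.1 s.1.2 :=
  measurable_uncurry_of_lipschitz (T := fun x y ζ => hessY (fun w => P.G w ζ) x y)
    hP.lipschitz_hess_G hP.measurable_hessY_G

lemma measurable_jacXY_G' :
    Measurable fun s : (Vec p × Vec q) × Z => jacXY (fun w => P.G w s.2) s.1.1 s.1.2 :=
  measurable_uncurry_of_lipschitz (T := fun x y ζ => jacXY (fun w => P.G w ζ) x y)
    hP.lipschitz_jac_G hP.measurable_jacXY_G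

/-! Integrability in the sample. -/

lemma integrable_gradX_F (hM : 0 ≤ M) (x : Vec p) (y : Vec q) :
    Integrable (fun ξ => gradX (fun w => P.F w ξ) x y) P.lawξ :=
  have := hP.prob_ξ
  .of_bound (hP.measurable_gradX_F x y).aestronglyMeasurable M
    (Eventually.of_forall fun ξ => hP.norm_gradX_F_le hM ξ x y)

lemma integrable_gradY_F (hM : 0 ≤ M) (x : Vec p) (y : Vec q) :
    Integrable (fun ξ => gradY (fun w => P.F w ξ) x y) P.lawξ :=
  have := hP.prob_ξ
  .of_bound (hP.measurable_gradY_F x y).aestronglyMeasurable M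
    (Eventually.of_forall fun ξ => hP.norm_gradY_F_le hM ξ x y)

lemma integrable_hessY_G (hL : 0 ≤ L) (x : Vec p) (y : Vec q) :
    Integrable (fun ζ => hessY (fun w => P.G w ζ) x y) P.lawζ :=
  have := hP.prob_ζ
  .of_bound (hP.measurable_hessY_G x y).aestronglyMeasurable L
    (Eventually.of_forall fun ζ => (hP.sampleRegular ζ).norm_hessY_le hL x y)

lemma integrable_jacXY_G (hL : 0 ≤ L) (x : Vec p) (y : Vec q) :
    Integrable (fun ζ => jacXY (fun w => P.G w ζ) x y) P.lawζ :=
  have := hP.prob_ζ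
  .of_bound (hP.measurable_jacXY_G x y).aestronglyMeasurable L
    (Eventually.of_forall fun ζ => (hP.sampleRegular ζ).norm_jacXY_le hL x y)

lemma lintegral_gradY_G_sub_le (x : Vec p) (y : Vec q) :
    ∫⁻ ζ, ‖gradY (fun w => P.G w ζ) x y - (gradient P.g (pair x y)).snd‖ₑ ^ 2 ∂P.lawζ
      ≤ ENNReal.ofReal (σ ^ 2) := by
  refine le_trans (lintegral_mono fun ζ => ?_) (hP.variance_grad_G (pair x y))
  gcongr
  rw [gradY_eq (hP.differentiable_G ζ _), enorm_le_iff_norm_le]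
  exact norm_snd_le' (gradient (fun w => P.G w ζ) (pair x y) - gradient P.g (pair x y))

lemma memLp_gradY_G (x : Vec p) (y : Vec q) :
    MemLp (fun ζ => gradY (fun w => P.G w ζ) x y) 2 P.lawζ := by
  have := hP.prob_ζ
  have h := memLp_two_of_lintegral_sq (ν := P.lawζ)
    (X := fun ζ => gradY (fun w => P.G w ζ) x y - (gradient P.g (pair x y)).snd)
    ((hP.measurable_gradY_G x y).sub_const _).aestronglyMeasurable
    (ne_top_of_le_ne_top ENNReal.ofReal_ne_top (hP.lintegral_gradY_G_sub_le x y))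
  exact (h.add (memLp_const (gradient P.g (pair x y)).snd)).ae_eq
    (Eventually.of_forall fun ζ => by simp)

lemma integrable_gradY_G (x : Vec p) (y : Vec q) :
    Integrable (fun ζ => gradY (fun w => P.G w ζ) x y) P.lawζ :=
  have := hP.prob_ζ
  (hP.memLp_gradY_G x y).integrable (by norm_num)

/-- The assumed variance is centred at `gradient P.g`. Since the mean minimizes the mean square
deviation, the bound passes to the centre `P.gy`, and the two centres need not be identified. -/
lemma variance_gradY_G (x : Vec p) (y : Vec q) :
    ∫⁻ ζ, ‖gradY (fun w => P.G w ζ) x y - P.gy x y‖ₑ ^ 2 ∂P.lawζ ≤ ENNReal.ofReal (σ ^ 2) :=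
  have := hP.prob_ζ
  (lintegral_enorm_sub_integral_sq_le (hP.measurable_gradY_G x y).aestronglyMeasurable _).trans
    (hP.lintegral_gradY_G_sub_le x y)

/-! Bounds and Lipschitz constants of the means. -/

omit hP in
lemma norm_integral_le_of_forall {A V : Type*} [MeasurableSpace A] [NormedAddCommGroup V]
    [NormedSpace ℝ V] {ν : Measure A} [IsProbabilityMeasure ν] {X : A → V} {c : ℝ}
    (h : ∀ a, ‖X a‖ ≤ c) : ‖∫ a, X a ∂ν‖ ≤ c := by
  simpa using norm_integral_le_of_norm_le_const (μ := ν) (Eventually.of_forall h)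

omit hP in
lemma norm_integral_sub_le_of_forall {A V : Type*} [MeasurableSpace A] [NormedAddCommGroup V]
    [NormedSpace ℝ V] {ν : Measure A} [IsProbabilityMeasure ν] {X Y : A → V} {c : ℝ}
    (hX : Integrable X ν) (hY : Integrable Y ν)
    (h : ∀ a, ‖X a - Y a‖ ≤ c) : ‖∫ a, X a ∂ν - ∫ a, Y a ∂ν‖ ≤ c := by
  rw [← integral_sub hX hY]
  exact norm_integral_le_of_forall h

lemma norm_fx_le (hM : 0 ≤ M) (x : Vec p) (y : Vec q) : ‖P.fx x y‖ ≤ M :=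
  have := hP.prob_ξ
  norm_integral_le_of_forall fun ξ => hP.norm_gradX_F_le hM ξ x y

lemma norm_fy_le (hM : 0 ≤ M) (x : Vec p) (y : Vec q) : ‖P.fy x y‖ ≤ M :=
  have := hP.prob_ξ
  norm_integral_le_of_forall fun ξ => hP.norm_gradY_F_le hM ξ x y

lemma norm_jac_le (hL : 0 ≤ L) (x : Vec p) (y : Vec q) : ‖P.jac x y‖ ≤ L :=
  have := hP.prob_ζ
  norm_integral_le_of_forall fun ζ => (hP.sampleRegular ζ).norm_jacXY_le hL x y

lemma fx_lipschitz (hM : 0 ≤ M) (x x' : Vec p) (y y' : Vec q) :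
    ‖P.fx x y - P.fx x' y'‖ ≤ L * ‖pair x y - pair x' y'‖ :=
  have := hP.prob_ξ
  norm_integral_sub_le_of_forall (hP.integrable_gradX_F hM x y) (hP.integrable_gradX_F hM x' y')
    fun ξ => norm_gradX_sub_le (hP.differentiable_F ξ) (hP.lipschitz_grad_F ξ)
      (pair x y) (pair x' y')

lemma fy_lipschitz (hM : 0 ≤ M) (x x' : Vec p) (y y' : Vec q) :
    ‖P.fy x y - P.fy x' y'‖ ≤ L * ‖pair x y - pair x' y'‖ :=
  have := hP.prob_ξ
  norm_integral_sub_le_of_forall (hP.integrable_gradY_F hM x y) (hP.integrable_gradY_F hM x' y')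
    fun ξ => norm_gradY_sub_le (hP.differentiable_F ξ) (hP.lipschitz_grad_F ξ)
      (pair x y) (pair x' y')

lemma gy_lipschitz (x x' : Vec p) (y y' : Vec q) :
    ‖P.gy x y - P.gy x' y'‖ ≤ L * ‖pair x y - pair x' y'‖ :=
  have := hP.prob_ζ
  norm_integral_sub_le_of_forall (hP.integrable_gradY_G x y) (hP.integrable_gradY_G x' y')
    fun ζ => norm_gradY_sub_le (hP.differentiable_G ζ) (hP.lipschitz_grad_G ζ)
      (pair x y) (pair x' y')

lemma hess_lipschitz (hL : 0 ≤ L) (x x' : Vec p) (y y' : Vec q) :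
    ‖P.hess x y - P.hess x' y'‖ ≤ ρ * ‖pair x y - pair x' y'‖ :=
  have := hP.prob_ζ
  norm_integral_sub_le_of_forall (hP.integrable_hessY_G hL x y) (hP.integrable_hessY_G hL x' y')
    fun ζ => hP.lipschitz_hess_G ζ (pair x y) (pair x' y')

lemma jac_lipschitz (hL : 0 ≤ L) (x x' : Vec p) (y y' : Vec q) :
    ‖P.jac x y - P.jac x' y'‖ ≤ τ * ‖pair x y - pair x' y'‖ :=
  have := hP.prob_ζ
  norm_integral_sub_le_of_forall (hP.integrable_jacXY_G hL x y) (hP.integrable_jacXY_G hL x' y')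
    fun ζ => hP.lipschitz_jac_G ζ (pair x y) (pair x' y')

lemma hess_apply (hL : 0 ≤ L) (x : Vec p) (y v : Vec q) :
    P.hess x y v = ∫ ζ, hessY (fun w => P.G w ζ) x y v ∂P.lawζ :=
  ContinuousLinearMap.integral_apply (hP.integrable_hessY_G hL x y) v

lemma jac_apply (hL : 0 ≤ L) (x : Vec p) (y v : Vec q) :
    P.jac x y v = ∫ ζ, jacXY (fun w => P.G w ζ) x y v ∂P.lawζ :=
  ContinuousLinearMap.integral_apply (hP.integrable_jacXY_G hL x y) v

lemma integrable_hessY_apply (hL : 0 ≤ L) (x : Vec p) (y v : Vec q) :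
    Integrable (fun ζ => hessY (fun w => P.G w ζ) x y v) P.lawζ :=
  (hP.integrable_hessY_G hL x y).apply_continuousLinearMap v

lemma integrable_jacXY_apply (hL : 0 ≤ L) (x : Vec p) (y v : Vec q) :
    Integrable (fun ζ => jacXY (fun w => P.G w ζ) x y v) P.lawζ :=
  (hP.integrable_jacXY_G hL x y).apply_continuousLinearMap v

lemma hess_symm (hL : 0 ≤ L) (x : Vec p) (y v w : Vec q) :
    inner ℝ (P.hess x y v) w = inner ℝ v (P.hess x y w) := by
  rw [hP.hess_apply hL, hP.hess_apply hL, real_inner_comm,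
    ← integral_inner (hP.integrable_hessY_apply hL x y v),
    ← integral_inner (hP.integrable_hessY_apply hL x y w)]
  refine integral_congr_ae (Eventually.of_forall fun ζ => ?_)
  simp only
  rw [← (hP.sampleRegular ζ).hessY_symm, real_inner_comm]

/-- The contraction passes from the samples to the mean by integration. The invertibility of the
mean Hessian is derived below from this estimate alone. -/
lemma norm_sub_smul_hess_le (hμL : μ ≤ L) (hμ : 0 ≤ μ) {c : ℝ} (hc : 0 ≤ c)
    (hcL : c * (L + μ) ≤ 2) (x : Vec p) (y v : Vec q) :
    ‖v - c • P.hess x y v‖ ≤ (1 - c * μ) * ‖v‖ := by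
  have := hP.prob_ζ
  have hL := hμ.trans hμL
  have e : v - c • P.hess x y v = ∫ ζ, (v - c • hessY (fun w => P.G w ζ) x y v) ∂P.lawζ := by
    have h1 : Integrable (fun ζ => c • hessY (fun w => P.G w ζ) x y v) P.lawζ :=
      (hP.integrable_hessY_apply hL x y v).smul c
    rw [hP.hess_apply hL, integral_sub (integrable_const _) h1, integral_smul]
    simp
  rw [e]
  exact norm_integral_le_of_forall fun ζ =>
    (hP.sampleRegular ζ).norm_sub_smul_hessY_le hμL hμ hc hcL x y v

lemma norm_gradStep_sub_le (hμL : μ ≤ L) (hμ : 0 ≤ μ) {c : ℝ} (hc : 0 ≤ c)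
    (hcL : c * (L + μ) ≤ 2) (x : Vec p) (y y' : Vec q) :
    ‖(y - c • P.gy x y) - (y' - c • P.gy x y')‖ ≤ (1 - c * μ) * ‖y - y'‖ := by
  have := hP.prob_ζ
  have e : ∀ y, y - c • P.gy x y = ∫ ζ, (y - c • gradY (fun w => P.G w ζ) x y) ∂P.lawζ := by
    intro y
    have h1 : Integrable (fun ζ => c • gradY (fun w => P.G w ζ) x y) P.lawζ :=
      (hP.integrable_gradY_G x y).smul c
    rw [integral_sub (integrable_const _) h1, integral_smul]
    simp [Problem.gy]
  rw [e, e]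
  exact norm_integral_sub_le_of_forall
    ((integrable_const _).sub ((hP.integrable_gradY_G x y).smul c))
    ((integrable_const _).sub ((hP.integrable_gradY_G x y').smul c)) fun ζ =>
    (hP.sampleRegular ζ).norm_gradStep_sub_le hμL hμ hc hcL x y y'

/-! Second moments of the centred oracles. -/

omit hP in
lemma lintegral_enorm_sq_le_of_norm_le {A V : Type*} [MeasurableSpace A] [NormedAddCommGroup V]
    {ν : Measure A} [IsProbabilityMeasure ν] {X : A → V} {c : ℝ}
    (h : ∀ a, ‖X a‖ ≤ c) : ∫⁻ a, ‖X a‖ₑ ^ 2 ∂ν ≤ ENNReal.ofReal (c ^ 2) := by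
  calc ∫⁻ a, ‖X a‖ₑ ^ 2 ∂ν ≤ ∫⁻ _, ENNReal.ofReal (c ^ 2) ∂ν := by
        refine lintegral_mono fun a => ?_
        rw [norm_sq_eq_enorm]
        exact ENNReal.ofReal_le_ofReal (by gcongr; exact h a)
    _ = _ := by simp

lemma variance_gradX_F (hM : 0 ≤ M) (x : Vec p) (y : Vec q) :
    ∫⁻ ξ, ‖gradX (fun w => P.F w ξ) x y - P.fx x y‖ₑ ^ 2 ∂P.lawξ ≤ ENNReal.ofReal (M ^ 2) := by
  have := hP.prob_ξ
  refine (lintegral_enorm_sub_integral_sq_le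
    (hP.measurable_gradX_F x y).aestronglyMeasurable 0).trans ?_
  exact lintegral_enorm_sq_le_of_norm_le fun ξ => by
    rw [sub_zero]; exact hP.norm_gradX_F_le hM ξ x y

lemma variance_gradY_F (hM : 0 ≤ M) (x : Vec p) (y : Vec q) :
    ∫⁻ ξ, ‖gradY (fun w => P.F w ξ) x y - P.fy x y‖ₑ ^ 2 ∂P.lawξ ≤ ENNReal.ofReal (M ^ 2) := by
  have := hP.prob_ξ
  refine (lintegral_enorm_sub_integral_sq_le
    (hP.measurable_gradY_F x y).aestronglyMeasurable 0).trans ?_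
  exact lintegral_enorm_sq_le_of_norm_le fun ξ => by
    rw [sub_zero]; exact hP.norm_gradY_F_le hM ξ x y

lemma variance_jacXY (hL : 0 ≤ L) (x : Vec p) (y v : Vec q) {c : ℝ} (hv : ‖v‖ ≤ c) :
    ∫⁻ ζ, ‖jacXY (fun w => P.G w ζ) x y v - P.jac x y v‖ₑ ^ 2 ∂P.lawζ
      ≤ ENNReal.ofReal ((L * c) ^ 2) := by
  have := hP.prob_ζ
  rw [hP.jac_apply hL]
  refine (lintegral_enorm_sub_integral_sq_le
    (hP.integrable_jacXY_apply hL x y v).aestronglyMeasurable 0).trans ?_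
  refine lintegral_enorm_sq_le_of_norm_le fun ζ => ?_
  rw [sub_zero]
  refine (ContinuousLinearMap.le_opNorm _ _).trans ?_
  gcongr
  exact (hP.sampleRegular ζ).norm_jacXY_le hL x y

/-- The variance of a sampled Hessian-vector product is controlled by the quadratic form. -/
lemma variance_hessY (hμ : 0 ≤ μ) (hL : 0 ≤ L) (x : Vec p) (y v : Vec q) :
    ∫⁻ ζ, ‖hessY (fun w => P.G w ζ) x y v - P.hess x y v‖ₑ ^ 2 ∂P.lawζ
      ≤ ENNReal.ofReal L
        * ∫⁻ ζ, ENNReal.ofReal (inner ℝ (hessY (fun w => P.G w ζ) x y v) v) ∂P.lawζ := by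
  have := hP.prob_ζ
  rw [hP.hess_apply hL]
  refine (lintegral_enorm_sub_integral_sq_le
    (hP.integrable_hessY_apply hL x y v).aestronglyMeasurable 0).trans ?_
  rw [← lintegral_const_mul' _ _ ENNReal.ofReal_ne_top]
  refine lintegral_mono fun ζ => ?_
  simp only [sub_zero]
  rw [norm_sq_eq_enorm, ← ENNReal.ofReal_mul hL]
  exact ENNReal.ofReal_le_ofReal ((hP.sampleRegular ζ).norm_sq_hessY_le hμ hL x y v)

/-! Derivatives of the means. -/

lemma hasGradientAt_f (hM : 0 ≤ M) (x : Vec p) (y : Vec q) :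
    HasGradientAt P.f (pair (P.fx x y) (P.fy x y)) (pair x y) := by
  have := hP.prob_ξ
  obtain ⟨hi, hd⟩ := hasFDerivAt_integral_of_dominated_loc_of_lip' (μ := P.lawξ) (𝕜 := ℝ)
    (F := P.F) (x₀ := pair x y) (s := Set.univ) (bound := fun _ => M)
    (F' := fun ξ => fderiv ℝ (fun w => P.F w ξ) (pair x y)) univ_mem
    (fun z _ => (hP.measurable_F z).aestronglyMeasurable) (hP.integrable_F _)
    (measurable_fderiv_of_measurable hP.measurable_F
      fun ξ => hP.differentiable_F ξ _).aestronglyMeasurable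
    (Eventually.of_forall fun ξ z _ => by rw [Real.norm_eq_abs]; exact hP.lipschitz_F ξ z _)
    (integrable_const _) (Eventually.of_forall fun ξ => (hP.differentiable_F ξ _).hasFDerivAt)
  rw [hasGradientAt_iff_hasFDerivAt]
  refine HasFDerivAt.congr_fderiv hd ?_
  ext w
  rw [ContinuousLinearMap.integral_apply hi, InnerProductSpace.toDual_apply_apply, inner_joint]
  simp only [fderiv_eq_partial (hP.differentiable_F _ _), pair_fst, pair_snd]
  have h1 := hP.integrable_gradX_F hM x y
  have h2 := hP.integrable_gradY_F hM x y
  rw [integral_add (h1.inner_const _) (h2.inner_const _)]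
  congr 1
  · rw [Problem.fx, real_inner_comm, ← integral_inner h1]
    simp only [real_inner_comm]
  · rw [Problem.fy, real_inner_comm, ← integral_inner h2]
    simp only [real_inner_comm]

/-- Differentiation under the integral. There is no bound on ∇_yG uniform in ζ, so the dominating
function is ‖∇_yG(x, y; ζ)‖ + L, valid on the unit ball around y. -/
lemma hasGradientAt_g (hL : 0 ≤ L) (x : Vec p) (y : Vec q) :
    HasGradientAt (fun y' => P.g (pair x y')) (P.gy x y) y := by
  have := hP.prob_ζ
  have hid := hP.integrable_gradY_G x y
  obtain ⟨hi, hd⟩ := hasFDerivAt_integral_of_dominated_loc_of_lip' (μ := P.lawζ) (𝕜 := ℝ)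
    (F := fun y' ζ => P.G (pair x y') ζ) (x₀ := y) (s := Metric.ball y 1)
    (bound := fun ζ => ‖gradY (fun w => P.G w ζ) x y‖ + L)
    (F' := fun ζ => InnerProductSpace.toDual ℝ (Vec q) (gradY (fun w => P.G w ζ) x y))
    (Metric.ball_mem_nhds y one_pos)
    (fun z _ => (hP.measurable_G _).aestronglyMeasurable) (hP.integrable_G _)
    ((InnerProductSpace.toDual ℝ (Vec q)).continuous.comp_aestronglyMeasurable
      (hP.measurable_gradY_G x y).aestronglyMeasurable)
    (Eventually.of_forall fun ζ y' hy' => by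
      refine (convex_ball y 1).norm_image_sub_le_of_norm_hasFDerivWithin_le (𝕜 := ℝ)
        (f := fun y' => P.G (pair x y') ζ)
        (f' := fun y' => InnerProductSpace.toDual ℝ (Vec q) (gradY (fun w => P.G w ζ) x y'))
        (fun y₁ _ => (hasGradientAt_gradY
          (hP.differentiable_G ζ (pair x y₁))).hasFDerivAt.hasFDerivWithinAt)
        (fun y₁ h₁ => ?_) (Metric.mem_ball_self one_pos) hy'
      rw [LinearIsometryEquiv.norm_map]
      have h2 := norm_gradY_sub_le (hP.differentiable_G ζ) (hP.lipschitz_grad_G ζ)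
        (pair x y₁) (pair x y)
      simp only [pair_fst, pair_snd, pair_sub, sub_self, norm_pair_zero_left] at h2
      rw [Metric.mem_ball, dist_eq_norm] at h₁
      have h3 := norm_le_norm_add_norm_sub' (gradY (fun w => P.G w ζ) x y₁)
        (gradY (fun w => P.G w ζ) x y)
      nlinarith)
    (hid.norm.add (integrable_const _))
    (Eventually.of_forall fun ζ => (hasGradientAt_gradY
      (hP.differentiable_G ζ (pair x y))).hasFDerivAt)
  rw [hasGradientAt_iff_hasFDerivAt]
  refine HasFDerivAt.congr_fderiv hd ?_
  ext w
  rw [ContinuousLinearMap.integral_apply hi]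
  simp only [InnerProductSpace.toDual_apply_apply]
  rw [Problem.gy, real_inner_comm, ← integral_inner hid]
  simp only [real_inner_comm]

/-- `E ∇_yG` is jointly differentiable, with partial derivatives `E ∇_y²G` and `(E ∇ₓ∇_yG)ᵀ`. -/
lemma exists_hasFDerivAt_gy (hL : 0 ≤ L) (x : Vec p) (y : Vec q) :
    ∃ A : Joint p q →L[ℝ] Vec q,
      HasFDerivAt (fun z : Joint p q => P.gy z.fst z.snd) A (pair x y) ∧
      (∀ v, A (pair 0 v) = P.hess x y v) ∧
      ∀ v w, inner ℝ v (A (pair w 0)) = inner ℝ (P.jac x y v) w := by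
  have := hP.prob_ζ
  obtain ⟨hi, hd⟩ := hasFDerivAt_integral_of_dominated_loc_of_lip' (μ := P.lawζ) (𝕜 := ℝ)
    (F := fun (z : Joint p q) ζ => gradY (fun w => P.G w ζ) z.fst z.snd) (x₀ := pair x y)
    (s := Set.univ) (bound := fun _ => L)
    (F' := fun ζ => fderiv ℝ (fun z : Joint p q => gradY (fun w => P.G w ζ) z.fst z.snd)
      (pair x y)) univ_mem
    (fun z _ => (hP.measurable_gradY_G _ _).aestronglyMeasurable) (hP.integrable_gradY_G _ _)
    (measurable_fderiv_of_measurable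
      (φ := fun (z : Joint p q) ζ => gradY (fun w => P.G w ζ) z.fst z.snd)
      (fun z => hP.measurable_gradY_G _ _)
      fun ζ => hP.differentiable_gradY_G ζ _).aestronglyMeasurable
    (Eventually.of_forall fun ζ z _ =>
      norm_gradY_sub_le (hP.differentiable_G ζ) (hP.lipschitz_grad_G ζ) _ _)
    (integrable_const _)
    (Eventually.of_forall fun ζ => (hP.differentiable_gradY_G ζ _).hasFDerivAt)
  refine ⟨_, hd, fun v => ?_, fun v w => ?_⟩
  · rw [ContinuousLinearMap.integral_apply hi, hP.hess_apply hL]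
    refine integral_congr_ae (Eventually.of_forall fun ζ => ?_)
    have := hessY_eq (hP.differentiable_gradY_G ζ (pair x y))
    simp only [pair_fst, pair_snd] at this
    simp only [this]
    rfl
  · rw [ContinuousLinearMap.integral_apply hi, hP.jac_apply hL,
      ← integral_inner (hi.apply_continuousLinearMap _), real_inner_comm,
      ← integral_inner (hP.integrable_jacXY_apply hL x y v)]
    refine integral_congr_ae (Eventually.of_forall fun ζ => ?_)
    have := jacXY_eq (hP.differentiable_gradY_G ζ (pair x y))
    simp only [pair_fst, pair_snd] at this
    simp only [this]
    rw [ContinuousLinearMap.adjoint_inner_right, real_inner_comm]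
    rfl

end Problem.Assumptions

end MeanOracles

/-! ### Lower-level solution and hypergradient -/

section Hypergradient

/-- Quadratic upper bound for a function with Lipschitz gradient. -/
lemma le_quadratic_of_lipschitz_gradient {E : Type*} [NormedAddCommGroup E]
    [InnerProductSpace ℝ E] [CompleteSpace E] {φ : E → ℝ} {φ' : E → E} {ℓ : ℝ}
    (hd : ∀ x, HasGradientAt φ (φ' x) x) (hl : ∀ x x', ‖φ' x - φ' x'‖ ≤ ℓ * ‖x - x'‖) (x d : E) :
    φ (x + d) ≤ φ x + inner ℝ (φ' x) d + ℓ / 2 * ‖d‖ ^ 2 := by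
  have hder : ∀ t : ℝ, HasDerivAt
      (fun t : ℝ => φ (x + t • d) - t * inner ℝ (φ' x) d - t ^ 2 * (ℓ / 2 * ‖d‖ ^ 2))
      (inner ℝ (φ' (x + t • d)) d - inner ℝ (φ' x) d - 2 * t * (ℓ / 2 * ‖d‖ ^ 2)) t := by
    intro t
    have hl : HasDerivAt (fun t : ℝ => x + t • d) d t := by
      simpa using ((hasDerivAt_id t).smul_const d).const_add x
    have h1 := (hd (x + t • d)).hasFDerivAt.comp_hasDerivAt t hl
    have h2 := (hasDerivAt_id t).mul_const (inner ℝ (φ' x) d)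
    have h3 := ((hasDerivAt_id t).pow 2).mul_const (ℓ / 2 * ‖d‖ ^ 2)
    refine ((h1.sub h2).sub h3).congr_deriv ?_
    simp
  have hanti : AntitoneOn
      (fun t : ℝ => φ (x + t • d) - t * inner ℝ (φ' x) d - t ^ 2 * (ℓ / 2 * ‖d‖ ^ 2))
      (Set.Icc 0 1) := by
    refine antitoneOn_of_deriv_nonpos (convex_Icc 0 1)
      (fun t _ => (hder t).continuousAt.continuousWithinAt)
      (fun t _ => (hder t).differentiableAt.differentiableWithinAt) fun t ht => ?_
    rw [interior_Icc] at ht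
    rw [(hder t).deriv, ← inner_sub_left]
    have h1 := real_inner_le_norm (φ' (x + t • d) - φ' x) d
    have h2 := hl (x + t • d) x
    rw [add_sub_cancel_left, norm_smul, Real.norm_of_nonneg ht.1.le] at h2
    nlinarith [norm_nonneg d]
  have := hanti (Set.left_mem_Icc.2 zero_le_one) (Set.right_mem_Icc.2 zero_le_one) zero_le_one
  simp at this
  linarith

variable {p q : ℕ} {Ξ Z : Type*} [MeasurableSpace Ξ] [MeasurableSpace Z]

/-- A solution `v` of `∇_y²g(x, y) v = ∇_yf(x, y)`. -/
def Problem.sol (P : Problem p q Ξ Z) (x : Vec p) (y : Vec q) : Vec q :=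
  Classical.epsilon fun v => P.hess x y v = P.fy x y

/-- The approximate hypergradient `∇ₓf - ∇ₓ∇_yg [∇_y²g]⁻¹ ∇_yf`. -/
def Problem.hyper (P : Problem p q Ξ Z) (x : Vec p) (y : Vec q) : Vec p :=
  P.fx x y - P.jac x y (P.sol x y)

namespace Problem.Assumptions

variable {P : Problem p q Ξ Z} {L M τ ρ μ σ : ℝ} (hP : P.Assumptions L M τ ρ μ σ)
include hP

omit hP in
lemma inv_mul_add_le_two (hμ : 0 < μ) (hμL : μ ≤ L) : L⁻¹ * (L + μ) ≤ 2 := by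
  have hL : 0 < L := hμ.trans_le hμL
  rw [inv_mul_le_iff₀ hL]
  linarith

/-- Triangle inequality in ‖v − L⁻¹Hv‖ ≤ (1 − μ/L)‖v‖. The next lemma is the nonlinear analogue,
from the gradient step of length 1/L. -/
lemma mul_norm_le_norm_hess (hμ : 0 < μ) (hμL : μ ≤ L) (x : Vec p) (y v : Vec q) :
    μ * ‖v‖ ≤ ‖P.hess x y v‖ := by
  have hL : 0 < L := hμ.trans_le hμL
  have h := hP.norm_sub_smul_hess_le hμL hμ.le (inv_nonneg.2 hL.le)
    (inv_mul_add_le_two hμ hμL) x y v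
  have h2 := norm_sub_norm_le v (L⁻¹ • P.hess x y v)
  rw [norm_smul, Real.norm_of_nonneg (inv_nonneg.2 hL.le)] at h2
  have h3 : L⁻¹ * (μ * ‖v‖) ≤ L⁻¹ * ‖P.hess x y v‖ := by linarith
  exact le_of_mul_le_mul_left h3 (inv_pos.2 hL)

lemma mul_norm_sub_le_norm_gy_sub (hμ : 0 < μ) (hμL : μ ≤ L) (x : Vec p) (y y' : Vec q) :
    μ * ‖y - y'‖ ≤ ‖P.gy x y - P.gy x y'‖ := by
  have hL : 0 < L := hμ.trans_le hμL
  have h := hP.norm_gradStep_sub_le hμL hμ.le (inv_nonneg.2 hL.le)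
    (inv_mul_add_le_two hμ hμL) x y y'
  have e : (y - L⁻¹ • P.gy x y) - (y' - L⁻¹ • P.gy x y')
      = (y - y') - L⁻¹ • (P.gy x y - P.gy x y') := by module
  rw [e] at h
  have h2 := norm_sub_norm_le (y - y') (L⁻¹ • (P.gy x y - P.gy x y'))
  rw [norm_smul, Real.norm_of_nonneg (inv_nonneg.2 hL.le)] at h2
  have h3 : L⁻¹ * (μ * ‖y - y'‖) ≤ L⁻¹ * ‖P.gy x y - P.gy x y'‖ := by linarith
  exact le_of_mul_le_mul_left h3 (inv_pos.2 hL)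

lemma inner_gy_sub_nonneg (hμ : 0 < μ) (hμL : μ ≤ L) (x : Vec p) (y y' : Vec q) :
    0 ≤ inner ℝ (P.gy x y - P.gy x y') (y - y') := by
  have hL : 0 < L := hμ.trans_le hμL
  have h := hP.norm_gradStep_sub_le hμL hμ.le (inv_nonneg.2 hL.le)
    (inv_mul_add_le_two hμ hμL) x y y'
  have e : (y - L⁻¹ • P.gy x y) - (y' - L⁻¹ • P.gy x y')
      = (y - y') - L⁻¹ • (P.gy x y - P.gy x y') := by module
  rw [e] at h
  have h2 := real_inner_le_norm ((y - y') - L⁻¹ • (P.gy x y - P.gy x y')) (y - y')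
  rw [inner_sub_left, real_inner_self_eq_norm_sq, real_inner_smul_left] at h2
  have h3 := mul_le_mul_of_nonneg_right h (norm_nonneg (y - y'))
  have h4 : 0 ≤ L⁻¹ * μ * ‖y - y'‖ ^ 2 := by positivity
  have h5 : 0 ≤ L⁻¹ * inner ℝ (P.gy x y - P.gy x y') (y - y') := by nlinarith
  exact nonneg_of_mul_nonneg_right h5 (inv_pos.2 hL)

/-- Banach's fixed point theorem for the gradient step of length 1/L. -/
lemma exists_gy_eq_zero (hμ : 0 < μ) (hμL : μ ≤ L) (x : Vec p) : ∃ y, P.gy x y = 0 := by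
  have hL : 0 < L := hμ.trans_le hμL
  have h0 : 0 ≤ 1 - L⁻¹ * μ := by
    rw [sub_nonneg, inv_mul_le_iff₀ hL]; linarith
  have hc : ContractingWith (1 - L⁻¹ * μ).toNNReal fun y => y - L⁻¹ • P.gy x y := by
    refine ⟨?_, LipschitzWith.of_dist_le_mul fun y y' => ?_⟩
    · rw [Real.toNNReal_lt_one]
      have : 0 < L⁻¹ * μ := by positivity
      linarith
    · rw [dist_eq_norm, dist_eq_norm, Real.coe_toNNReal _ h0]
      exact hP.norm_gradStep_sub_le hμL hμ.le (inv_nonneg.2 hL.le)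
        (inv_mul_add_le_two hμ hμL) x y y'
  refine ⟨ContractingWith.fixedPoint _ hc, ?_⟩
  have h := hc.fixedPoint_isFixedPt
  have h2 : L⁻¹ • P.gy x (ContractingWith.fixedPoint _ hc) = 0 := by
    have : ContractingWith.fixedPoint _ hc - L⁻¹ • P.gy x (ContractingWith.fixedPoint _ hc)
      = ContractingWith.fixedPoint _ hc := h
    simpa using this
  exact (smul_eq_zero.1 h2).resolve_left (inv_ne_zero hL.ne')

lemma isMin_of_gy_eq_zero (hμ : 0 < μ) (hμL : μ ≤ L) {x : Vec p} {y : Vec q} (h0 : P.gy x y = 0)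
    (y' : Vec q) : P.g (pair x y) ≤ P.g (pair x y') := by
  have hder : ∀ t : ℝ, HasDerivAt (fun t : ℝ => P.g (pair x (y + t • (y' - y))))
      (inner ℝ (P.gy x (y + t • (y' - y))) (y' - y)) t := by
    intro t
    have hl : HasDerivAt (fun t : ℝ => y + t • (y' - y)) (y' - y) t := by
      simpa using ((hasDerivAt_id t).smul_const (y' - y)).const_add y
    exact (hP.hasGradientAt_g (hμ.le.trans hμL) x
      (y + t • (y' - y))).hasFDerivAt.comp_hasDerivAt t hl
  have hmono : MonotoneOn (fun t : ℝ => P.g (pair x (y + t • (y' - y)))) (Set.Icc 0 1) := by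
    refine monotoneOn_of_deriv_nonneg (convex_Icc 0 1)
      (fun t _ => (hder t).continuousAt.continuousWithinAt)
      (fun t _ => (hder t).differentiableAt.differentiableWithinAt) fun t ht => ?_
    rw [interior_Icc] at ht
    rw [(hder t).deriv]
    have h1 := hP.inner_gy_sub_nonneg hμ hμL x (y + t • (y' - y)) y
    rw [h0, sub_zero, add_sub_cancel_left, real_inner_smul_right] at h1
    exact nonneg_of_mul_nonneg_right h1 ht.1
  have := hmono (Set.left_mem_Icc.2 zero_le_one) (Set.right_mem_Icc.2 zero_le_one) zero_le_one
  simpa using this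

/-- `yStar` comes from `Classical.epsilon`, so the existence of a minimizer has to be shown first: a
zero of the monotone map `gy` is one. Then `yStar` is a minimizer, hence a critical point. -/
lemma gy_yStar (hμ : 0 < μ) (hμL : μ ≤ L) (x : Vec p) : P.gy x (P.yStar x) = 0 := by
  obtain ⟨y, hy⟩ := hP.exists_gy_eq_zero hμ hμL x
  have hmin : ∀ y', P.g (pair x (P.yStar x)) ≤ P.g (pair x y') :=
    Classical.epsilon_spec (p := fun y => ∀ y' : Vec q, P.g (pair x y) ≤ P.g (pair x y'))
      ⟨y, hP.isMin_of_gy_eq_zero hμ hμL hy⟩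
  have h1 : IsLocalMin (fun y' => P.g (pair x y')) (P.yStar x) := Eventually.of_forall hmin
  have h2 := h1.hasFDerivAt_eq_zero
    (hP.hasGradientAt_g (hμ.le.trans hμL) x (P.yStar x)).hasFDerivAt
  simpa using h2

/-- `gy` vanishes at (x', y*(x')), so it has size at most L‖x − x'‖ at (x, y*(x')); strong
monotonicity at x converts this into a distance to y*(x). -/
lemma yStar_lipschitz (hμ : 0 < μ) (hμL : μ ≤ L) (x x' : Vec p) :
    ‖P.yStar x - P.yStar x'‖ ≤ L / μ * ‖x - x'‖ := by
  have h1 := hP.mul_norm_sub_le_norm_gy_sub hμ hμL x (P.yStar x) (P.yStar x')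
  have h2 := hP.gy_lipschitz x' x (P.yStar x') (P.yStar x')
  rw [hP.gy_yStar hμ hμL, zero_sub, norm_neg] at h1
  rw [hP.gy_yStar hμ hμL x', zero_sub, norm_neg, pair_sub, sub_self, norm_pair_zero_right,
    norm_sub_rev] at h2
  rw [div_mul_eq_mul_div, le_div_iff₀ hμ]
  linarith

lemma hess_injective (hμ : 0 < μ) (hμL : μ ≤ L) (x : Vec p) (y : Vec q) :
    Function.Injective (P.hess x y) := by
  rw [injective_iff_map_eq_zero]
  intro v hv
  have h := hP.mul_norm_le_norm_hess hμ hμL x y v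
  rw [hv, norm_zero] at h
  have : ‖v‖ ≤ 0 := by
    by_contra hn
    push Not at hn
    nlinarith
  simpa using this

lemma exists_equiv_hess (hμ : 0 < μ) (hμL : μ ≤ L) (x : Vec p) (y : Vec q) :
    ∃ e : Vec q ≃L[ℝ] Vec q, ∀ v, e v = P.hess x y v :=
  ⟨(LinearEquiv.ofInjectiveEndo (P.hess x y).toLinearMap
    (hP.hess_injective hμ hμL x y)).toContinuousLinearEquiv, fun _ => rfl⟩

lemma hess_sol (hμ : 0 < μ) (hμL : μ ≤ L) (x : Vec p) (y : Vec q) :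
    P.hess x y (P.sol x y) = P.fy x y := by
  obtain ⟨e, he⟩ := hP.exists_equiv_hess hμ hμL x y
  exact Classical.epsilon_spec (p := fun v => P.hess x y v = P.fy x y)
    ⟨e.symm (P.fy x y), by rw [← he, e.apply_symm_apply]⟩

lemma norm_sol_le (hM : 0 ≤ M) (hμ : 0 < μ) (hμL : μ ≤ L) (x : Vec p) (y : Vec q) :
    ‖P.sol x y‖ ≤ M / μ := by
  have h := hP.mul_norm_le_norm_hess hμ hμL x y (P.sol x y)
  rw [hP.hess_sol hμ hμL] at h
  rw [le_div_iff₀ hμ]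
  linarith [hP.norm_fy_le hM x y]

/-- The two solutions v, v' satisfy H(v − v') = (∇_yf − ∇_yf') − (H − H')v'. Now H ≥ μ and ‖v'‖ ≤
M/μ. -/
lemma sol_lipschitz (hM : 0 ≤ M) (hμ : 0 < μ) (hμL : μ ≤ L)
    (x x' : Vec p) (y y' : Vec q) :
    ‖P.sol x y - P.sol x' y'‖ ≤ (L / μ + ρ * M / μ ^ 2) * ‖pair x y - pair x' y'‖ := by
  have hL : 0 < L := hμ.trans_le hμL
  have h := hP.mul_norm_le_norm_hess hμ hμL x y (P.sol x y - P.sol x' y')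
  have e : P.hess x y (P.sol x y - P.sol x' y')
      = (P.fy x y - P.fy x' y') - (P.hess x y - P.hess x' y') (P.sol x' y') := by
    rw [map_sub, sub_apply, hP.hess_sol hμ hμL, hP.hess_sol hμ hμL]
    abel
  rw [e] at h
  have h1 := hP.fy_lipschitz hM x x' y y'
  have h2 : ‖(P.hess x y - P.hess x' y') (P.sol x' y')‖
      ≤ ρ * ‖pair x y - pair x' y'‖ * (M / μ) := by
    refine (ContinuousLinearMap.le_opNorm _ _).trans ?_
    have h3 := hP.hess_lipschitz hL.le x x' y y'
    exact mul_le_mul h3 (hP.norm_sol_le hM hμ hμL x' y') (norm_nonneg _)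
      ((norm_nonneg _).trans h3)
  have h4 := h.trans ((norm_sub_le _ _).trans (add_le_add h1 h2))
  rw [mul_comm, ← le_div_iff₀ hμ] at h4
  refine h4.trans (le_of_eq ?_)
  field_simp

/-- The product of Jacobian and solution is split as in the product rule. The estimate holds off the
graph of y* as well, and there it controls the bias caused by an inexact inner solution. -/
lemma hyper_lipschitz (hM : 0 ≤ M) (hμ : 0 < μ) (hμL : μ ≤ L)
    (x x' : Vec p) (y y' : Vec q) :
    ‖P.hyper x y - P.hyper x' y'‖ ≤ errConst L M τ ρ μ * ‖pair x y - pair x' y'‖ := by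
  have hL : 0 < L := hμ.trans_le hμL
  set r := ‖pair x y - pair x' y'‖ with hr
  have e : P.hyper x y - P.hyper x' y' = (P.fx x y - P.fx x' y')
      - (P.jac x y (P.sol x y - P.sol x' y') + (P.jac x y - P.jac x' y') (P.sol x' y')) := by
    rw [Problem.hyper, Problem.hyper, map_sub, sub_apply]
    abel
  have h1 := hP.fx_lipschitz hM x x' y y'
  have h2 : ‖P.jac x y (P.sol x y - P.sol x' y')‖ ≤ L * ((L / μ + ρ * M / μ ^ 2) * r) :=
    (ContinuousLinearMap.le_opNorm _ _).trans (mul_le_mul (hP.norm_jac_le hL.le x y)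
      (hP.sol_lipschitz hM hμ hμL x x' y y') (norm_nonneg _) hL.le)
  have h3 : ‖(P.jac x y - P.jac x' y') (P.sol x' y')‖ ≤ τ * r * (M / μ) := by
    have h4 := hP.jac_lipschitz hL.le x x' y y'
    exact (ContinuousLinearMap.le_opNorm _ _).trans (mul_le_mul h4
      (hP.norm_sol_le hM hμ hμL x' y') (norm_nonneg _) ((norm_nonneg _).trans h4))
  rw [e]
  refine (norm_sub_le _ _).trans ((add_le_add h1 ((norm_add_le _ _).trans
    (add_le_add h2 h3))).trans (le_of_eq ?_))
  rw [errConst]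
  ring

/-- Apart from integrability, this yields the second bound on the bias, the one that tames the
initial inner error. -/
lemma norm_hyper_le (hM : 0 ≤ M) (hμ : 0 < μ) (hμL : μ ≤ L) (x : Vec p) (y : Vec q) :
    ‖P.hyper x y‖ ≤ M + L * (M / μ) := by
  have hL : 0 < L := hμ.trans_le hμL
  refine (norm_sub_le _ _).trans (add_le_add (hP.norm_fx_le hM x y) ?_)
  exact (ContinuousLinearMap.le_opNorm _ _).trans (mul_le_mul (hP.norm_jac_le hL.le x y)
    (hP.norm_sol_le hM hμ hμL x y) (norm_nonneg _) hL.le)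

lemma norm_pair_yStar_sub_le (hμ : 0 < μ) (hμL : μ ≤ L) (x x' : Vec p) :
    ‖pair x (P.yStar x) - pair x' (P.yStar x')‖ ≤ (1 + L / μ) * ‖x - x'‖ := by
  rw [pair_sub]
  refine (norm_pair_le _ _).trans ?_
  linarith [hP.yStar_lipschitz hμ hμL x x']

/-- `y*` is differentiable, with `∇_y²g ∂y* = -(∇ₓ∇_yg)ᵀ`. -/
lemma exists_hasFDerivAt_yStar (hμ : 0 < μ) (hμL : μ ≤ L) (x : Vec p) :
    ∃ D : Vec p →L[ℝ] Vec q, HasFDerivAt P.yStar D x ∧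
      ∀ v w, inner ℝ v (P.hess x (P.yStar x) (D w))
        = - inner ℝ (P.jac x (P.yStar x) v) w := by
  have hL : 0 < L := hμ.trans_le hμL
  obtain ⟨A, hA, hA2, hA1⟩ := hP.exists_hasFDerivAt_gy hL.le x (P.yStar x)
  obtain ⟨e, he⟩ := hP.exists_equiv_hess hμ hμL x (P.yStar x)
  refine ⟨-(e.symm.toContinuousLinearMap.comp (A.comp (inlL p q))), ?_, fun v w => ?_⟩
  swap
  · rw [← hA1]
    rw [neg_apply, map_neg, inner_neg_right, ← he]
    simp [inlL_apply]
  -- Implicit differentiation by hand: `gy` vanishes along the graph of y*, so its first-order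
  -- expansion there, transported by the inverse Hessian, is the expansion of y*. The Lipschitz
  -- bound on y* makes the remainder o(‖x' − x‖).
  have hcont : Tendsto (fun x' => pair x' (P.yStar x')) (𝓝 x) (𝓝 (pair x (P.yStar x))) := by
    rw [tendsto_iff_norm_sub_tendsto_zero]
    refine squeeze_zero (fun _ => norm_nonneg _)
      (fun x' => hP.norm_pair_yStar_sub_le hμ hμL x' x) ?_
    have : Tendsto (fun x' : Vec p => (1 + L / μ) * ‖x' - x‖) (𝓝 x)
        (𝓝 ((1 + L / μ) * ‖x - x‖)) :=
      ((continuous_id.sub continuous_const).norm.const_mul _).tendsto x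
    simpa using this
  have h1 := hA.isLittleO.comp_tendsto hcont
  have hO : (fun x' => pair x' (P.yStar x') - pair x (P.yStar x)) =O[𝓝 x] fun x' => x' - x :=
    IsBigO.of_bound (1 + L / μ)
      (Eventually.of_forall fun x' => hP.norm_pair_yStar_sub_le hμ hμL x' x)
  have h2 := h1.trans_isBigO hO
  refine HasFDerivAt.of_isLittleO (IsBigO.trans_isLittleO ?_ h2)
  refine IsBigO.of_bound ‖(-e.symm.toContinuousLinearMap : Vec q →L[ℝ] Vec q)‖
    (Eventually.of_forall fun x' => ?_)
  have e1 : pair x' (P.yStar x') - pair x (P.yStar x)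
      = pair (x' - x) 0 + pair 0 (P.yStar x' - P.yStar x) := by
    rw [pair_sub, pair_eq, inlL_apply, inrL_apply]
  have e2 : P.yStar x' - P.yStar x
        - (-(e.symm.toContinuousLinearMap.comp (A.comp (inlL p q)))) (x' - x)
      = (-e.symm.toContinuousLinearMap) (((fun x'_1 : Joint p q => P.gy x'_1.fst x'_1.snd
        - P.gy (pair x (P.yStar x)).fst (pair x (P.yStar x)).snd
        - A (x'_1 - pair x (P.yStar x))) ∘ fun x' => pair x' (P.yStar x')) x') := by
    simp only [Function.comp_apply, pair_fst, pair_snd, hP.gy_yStar hμ hμL, sub_zero, zero_sub, e1,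
      map_add, hA2, ← he]
    simp [inlL_apply]
    abel
  rw [e2]
  exact ContinuousLinearMap.le_opNorm _ _

/-- The hypergradient formula. -/
lemma hasGradientAt_Phi (hM : 0 ≤ M) (hμ : 0 < μ) (hμL : μ ≤ L) (x : Vec p) :
    HasGradientAt P.Phi (P.hyper x (P.yStar x)) x := by
  have hL : 0 < L := hμ.trans_le hμL
  obtain ⟨D, hD, hD2⟩ := hP.exists_hasFDerivAt_yStar hμ hμL x
  have hpair : HasFDerivAt (fun x' => pair x' (P.yStar x'))
      (inlL p q + (inrL p q).comp D) x := by
    have : (fun x' => pair x' (P.yStar x')) = fun x' => inlL p q x' + inrL p q (P.yStar x') := by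
      funext x'; exact pair_eq _ _
    rw [this]
    exact (inlL p q).hasFDerivAt.add ((inrL p q).hasFDerivAt.comp x hD)
  have h := HasFDerivAt.comp x (hP.hasGradientAt_f hM x (P.yStar x)).hasFDerivAt hpair
  rw [hasGradientAt_iff_hasFDerivAt]
  refine HasFDerivAt.congr_fderiv h ?_
  ext w
  -- Adjoint identity: ⟨∇_yf, Dw⟩ = ⟨H sol, Dw⟩ = ⟨sol, H D w⟩ = −⟨jac sol, w⟩, with H the mean
  -- Hessian.
  have h3 := hD2 (P.sol x (P.yStar x)) w
  rw [← hP.hess_symm hL.le, hP.hess_sol hμ hμL] at h3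
  simp only [ContinuousLinearMap.comp_apply, add_apply,
    InnerProductSpace.toDual_apply_apply, inner_joint, inlL_apply, inrL_apply, Problem.hyper,
    inner_sub_left]
  simp [h3, sub_eq_add_neg]

lemma gradient_Phi (hM : 0 ≤ M) (hμ : 0 < μ) (hμL : μ ≤ L) (x : Vec p) :
    gradient P.Phi x = P.hyper x (P.yStar x) := (hP.hasGradientAt_Phi hM hμ hμL x).gradient

lemma hyper_yStar_lipschitz (hM : 0 ≤ M) (hτ : 0 ≤ τ) (hρ : 0 ≤ ρ) (hμ : 0 < μ) (hμL : μ ≤ L)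
    (x x' : Vec p) :
    ‖P.hyper x (P.yStar x) - P.hyper x' (P.yStar x')‖
      ≤ errConst L M τ ρ μ * (1 + L / μ) * ‖x - x'‖ := by
  have hL : 0 < L := hμ.trans_le hμL
  refine (hP.hyper_lipschitz hM hμ hμL _ _ _ _).trans ?_
  rw [mul_assoc]
  refine mul_le_mul_of_nonneg_left (hP.norm_pair_yStar_sub_le hμ hμL x x') ?_
  rw [errConst]; positivity

end Problem.Assumptions

end Hypergradient

/-! ### Resampling -/

section Resampling

variable {Ω A : Type*} [MeasurableSpace Ω] [MeasurableSpace A]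

/-- A sequence of samples `c i` with law `π` on a probability space, together with the maps `R i`
that replace the `i`-th sample by a fresh one without changing the law. -/
structure FreshBatch (ν : Measure Ω) (π : Measure A) where
  c : ℕ → Ω → A
  R : ℕ → Ω × A → Ω
  measurable_c : ∀ i, Measurable (c i)
  measurePreserving_R : ∀ i, MeasurePreserving (R i) (ν.prod π) ν
  c_self : ∀ i ω a, c i (R i (ω, a)) = a
  c_ne : ∀ i j ω a, j ≠ i → c j (R i (ω, a)) = c j ω

namespace FreshBatch

variable {ν : Measure Ω} {π : Measure A} [IsProbabilityMeasure π]
  (𝔅 : FreshBatch ν π)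

/-- A random variable that does not depend on the samples of the batch. -/
def Invariant {V : Type*} (X : Ω → V) : Prop := ∀ i ω a, X (𝔅.R i (ω, a)) = X ω

variable {𝔅}

-- Resampling preserves the law, and Tonelli then plays the role of conditioning on everything but
-- the i-th sample.
variable (𝔅) in
lemma lintegral_resample {T : Ω → ENNReal} (hT : Measurable T) (i : ℕ) :
    ∫⁻ ω, T ω ∂ν = ∫⁻ ω, ∫⁻ a, T (𝔅.R i (ω, a)) ∂π ∂ν := by
  rw [← (𝔅.measurePreserving_R i).lintegral_comp hT]
  exact lintegral_prod _ (hT.comp (𝔅.measurePreserving_R i).measurable).aemeasurable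

lemma lintegral_sample {φ : Ω → A → ENNReal} (hφ : Measurable (Function.uncurry φ))
    (hinv : 𝔅.Invariant φ) (i : ℕ) :
    ∫⁻ ω, φ ω (𝔅.c i ω) ∂ν = ∫⁻ ω, ∫⁻ a, φ ω a ∂π ∂ν := by
  have hm : Measurable fun ω => φ ω (𝔅.c i ω) :=
    hφ.comp (measurable_id.prodMk (𝔅.measurable_c i))
  rw [𝔅.lintegral_resample hm i]
  simp only [𝔅.c_self, hinv i]

variable {E : Type*} [NormedAddCommGroup E] [InnerProductSpace ℝ E] [CompleteSpace E]
  [MeasurableSpace E] [BorelSpace E] [SecondCountableTopology E]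

/-- A fresh mini-batch of size `n` of centred vectors adds at most `1/n` times their variance. -/
lemma lintegral_add_batchMean_le {X : Ω → E} {h : Ω → A → E} {V : Ω → ENNReal}
    (hX : Measurable X) (hXi : 𝔅.Invariant X) (hh : Measurable (Function.uncurry h))
    (hhi : 𝔅.Invariant h) (h0 : ∀ ω, ∫ a, h ω a ∂π = 0)
    (hV : ∀ ω, ∫⁻ a, ‖h ω a‖ₑ ^ 2 ∂π ≤ V ω) (hVtop : ∀ ω, V ω ≠ ⊤) {n : ℕ} (hn : 1 ≤ n) :
    ∫⁻ ω, ‖X ω + batchMean n (fun i => h ω (𝔅.c i ω))‖ₑ ^ 2 ∂ν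
      ≤ ∫⁻ ω, ‖X ω‖ₑ ^ 2 ∂ν + (n : ENNReal)⁻¹ * ∫⁻ ω, V ω ∂ν := by
  have hmem : ∀ ω, MemLp (h ω) 2 π := fun ω =>
    memLp_two_of_lintegral_sq (hh.comp measurable_prodMk_left).aestronglyMeasurable
      (ne_top_of_le_ne_top (hVtop ω) (hV ω))
  have hhc : ∀ i, Measurable fun ω => h ω (𝔅.c i ω) := fun i =>
    hh.comp (measurable_id.prodMk (𝔅.measurable_c i))
  set r : ℝ := 1 / n with hr
  -- Samples enter one at a time and the newest is resampled. Nothing else in the sum changes, so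
  -- the new term is centred given the rest and the cross term vanishes.
  have key : ∀ m : ℕ, ∫⁻ ω, ‖X ω + r • ∑ i ∈ Finset.range m, h ω (𝔅.c i ω)‖ₑ ^ 2 ∂ν
      ≤ ∫⁻ ω, ‖X ω‖ₑ ^ 2 ∂ν + m * ((n : ENNReal)⁻¹ ^ 2 * ∫⁻ ω, V ω ∂ν) := by
    intro m
    induction m with
    | zero => simp
    | succ m ih =>
      have hYm : Measurable fun ω => X ω + r • ∑ i ∈ Finset.range m, h ω (𝔅.c i ω) :=
        hX.add ((Finset.measurable_sum _ fun i _ => hhc i).const_smul r)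
      have hm : Measurable fun ω =>
          ‖X ω + r • ∑ i ∈ Finset.range (m + 1), h ω (𝔅.c i ω)‖ₑ ^ 2 :=
        (hX.add ((Finset.measurable_sum _ fun i _ => hhc i).const_smul r)).enorm.pow_const 2
      rw [𝔅.lintegral_resample hm m]
      have hinner : ∀ ω, ∫⁻ a, ‖X (𝔅.R m (ω, a)) + r • ∑ i ∈ Finset.range (m + 1),
            h (𝔅.R m (ω, a)) (𝔅.c i (𝔅.R m (ω, a)))‖ₑ ^ 2 ∂π
          ≤ ‖X ω + r • ∑ i ∈ Finset.range m, h ω (𝔅.c i ω)‖ₑ ^ 2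
            + (n : ENNReal)⁻¹ ^ 2 * V ω := by
        intro ω
        have e : ∀ a, X (𝔅.R m (ω, a)) + r • ∑ i ∈ Finset.range (m + 1),
            h (𝔅.R m (ω, a)) (𝔅.c i (𝔅.R m (ω, a)))
            = (X ω + r • ∑ i ∈ Finset.range m, h ω (𝔅.c i ω)) + r • h ω a := by
          intro a
          rw [Finset.sum_range_succ, 𝔅.c_self, hXi m, hhi m, smul_add, add_assoc]
          congr 3
          exact Finset.sum_congr rfl fun i hi => by
            rw [𝔅.c_ne m i ω a (Finset.mem_range.1 hi).ne]
        simp only [e]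
        rw [lintegral_enorm_add_sq (X := fun a => r • h ω a) ((hmem ω).const_smul r)
          (by rw [integral_smul, h0, smul_zero])]
        gcongr
        have e2 : ∀ a, ‖r • h ω a‖ₑ ^ 2 = (n : ENNReal)⁻¹ ^ 2 * ‖h ω a‖ₑ ^ 2 := by
          intro a
          rw [enorm_smul, mul_pow]
          congr 2
          rw [hr, one_div, enorm_inv (by positivity)]
          simp
        simp only [e2]
        rw [lintegral_const_mul' _ _ (by simp; omega)]
        gcongr
        exact hV ω
      calc _ ≤ ∫⁻ ω, (‖X ω + r • ∑ i ∈ Finset.range m, h ω (𝔅.c i ω)‖ₑ ^ 2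
            + (n : ENNReal)⁻¹ ^ 2 * V ω) ∂ν := lintegral_mono hinner
        _ ≤ _ := by
          rw [lintegral_add_left (hYm.enorm.pow_const 2),
            lintegral_const_mul' _ _ (by simp; omega)]
          calc _ ≤ (∫⁻ ω, ‖X ω‖ₑ ^ 2 ∂ν + m * ((n : ENNReal)⁻¹ ^ 2 * ∫⁻ ω, V ω ∂ν))
                + (n : ENNReal)⁻¹ ^ 2 * ∫⁻ ω, V ω ∂ν := by gcongr
            _ = _ := by push_cast; ring
  refine (key n).trans (le_of_eq ?_)
  congr 1
  rw [← mul_assoc, sq, ← mul_assoc, ENNReal.mul_inv_cancel (by simp; omega) (by simp), one_mul]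

end FreshBatch

/-- Replacing one coordinate of an i.i.d. family by a fresh sample. -/
lemma measurePreserving_update {ι : Type*} [DecidableEq ι] (π : Measure A)
    [IsProbabilityMeasure π] (d : ι) :
    MeasurePreserving (fun s : (ι → A) × A => Function.update s.1 d s.2)
      ((Measure.infinitePi fun _ : ι => π).prod π) (Measure.infinitePi fun _ : ι => π) := by
  have hm : Measurable fun s : (ι → A) × A => Function.update s.1 d s.2 := by
    refine measurable_pi_lambda _ fun i => ?_
    by_cases h : i = d
    · subst h; simpa using measurable_snd
    · simp only [Function.update_of_ne h]
      exact (measurable_pi_apply i).comp measurable_fst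
  -- It suffices to compare finite-dimensional boxes. If coordinate d is constrained, its factor
  -- comes from the fresh sample; otherwise the fresh sample is free.
  refine ⟨hm, Measure.eq_infinitePi _ fun s t ht => ?_⟩
  rw [Measure.map_apply hm (MeasurableSet.pi s.countable_toSet fun i _ => ht i)]
  by_cases hd : d ∈ s
  · have e : (fun s : (ι → A) × A => Function.update s.1 d s.2) ⁻¹' ((s : Set ι).pi t)
        = ((s.erase d : Finset ι) : Set ι).pi t ×ˢ t d := by
      ext ⟨w, a⟩
      simp only [Set.mem_preimage, Set.mem_pi, Set.mem_prod, Finset.mem_coe, Finset.mem_erase]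
      constructor
      · intro h
        refine ⟨fun i hi => ?_, ?_⟩
        · simpa [Function.update_of_ne hi.1] using h i hi.2
        · simpa using h d hd
      · rintro ⟨h1, h2⟩ i hi
        by_cases hid : i = d
        · subst hid; simpa using h2
        · simpa [Function.update_of_ne hid] using h1 i ⟨hid, hi⟩
    rw [e, Measure.prod_prod, Measure.infinitePi_pi _ (fun i _ => ht i), mul_comm,
      Finset.mul_prod_erase s (fun i => π (t i)) hd]
  · have e : (fun s : (ι → A) × A => Function.update s.1 d s.2) ⁻¹' ((s : Set ι).pi t)
        = (s : Set ι).pi t ×ˢ Set.univ := by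
      ext ⟨w, a⟩
      simp only [Set.mem_preimage, Set.mem_pi, Set.mem_prod, Finset.mem_coe, Set.mem_univ,
        and_true]
      refine forall₂_congr fun i hi => ?_
      rw [Function.update_of_ne (by rintro rfl; exact hd hi)]
    rw [e, Measure.prod_prod, Measure.infinitePi_pi _ (fun i _ => ht i)]
    simp

end Resampling

/-! ### The space of samples -/

section SampleSpace

variable {p q : ℕ} {Ξ Z : Type*} [MeasurableSpace Ξ] [MeasurableSpace Z]

/-- All samples used by the algorithm. -/
abbrev Samples (Ξ Z : Type*) := (ℕ × ℕ → Ξ) × (GDraw → Z)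

/-- The joint law of all samples. -/
def Problem.law (P : Problem p q Ξ Z) : Measure (Samples Ξ Z) :=
  (Measure.infinitePi fun _ => P.lawξ).prod (Measure.infinitePi fun _ => P.lawζ)

lemma Problem.Assumptions.isProbabilityMeasure_law {P : Problem p q Ξ Z} {L M τ ρ μ σ : ℝ}
    (hP : P.Assumptions L M τ ρ μ σ) : IsProbabilityMeasure P.law := by
  have := hP.prob_ξ
  have := hP.prob_ζ
  rw [Problem.law]
  infer_instance

/-- This moves every expectation to the product space, where samples are coordinates and can be
overwritten. -/
lemma IsSampling.map_eq_law {P : Problem p q Ξ Z} {L M τ ρ μ σ : ℝ}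
    (hP : P.Assumptions L M τ ρ μ σ) {Ω : Type*} [MeasurableSpace Ω] {Pr : Measure Ω}
    [IsProbabilityMeasure Pr] {ξ : ℕ × ℕ → Ω → Ξ} {ζ : GDraw → Ω → Z} (hs : IsSampling P Pr ξ ζ) :
    MeasurePreserving (fun ω => ((fun i => ξ i ω, fun d => ζ d ω) : Samples Ξ Z)) Pr P.law := by
  have := hP.prob_ξ
  have := hP.prob_ζ
  have hξ : Measurable fun ω i => ξ i ω := measurable_pi_lambda _ hs.measurable_ξ
  have hζ : Measurable fun ω d => ζ d ω := measurable_pi_lambda _ hs.measurable_ζ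
  refine ⟨hξ.prodMk hζ, ?_⟩
  rw [(indepFun_iff_map_prod_eq_prod_map_map hξ.aemeasurable hζ.aemeasurable).1 hs.indep,
    hs.indep_ξ.map_fun_eq_infinitePi_map hs.measurable_ξ,
    hs.indep_ζ.map_fun_eq_infinitePi_map hs.measurable_ζ]
  simp only [hs.law_ξ, hs.law_ζ]
  rfl

open scoped Classical in
/-- The samples `ζ (d 0), ζ (d 1), …` as a fresh batch. -/
def zetaBatch (P : Problem p q Ξ Z) [IsProbabilityMeasure P.lawξ] [IsProbabilityMeasure P.lawζ]
    (d : ℕ → GDraw) (hd : Function.Injective d) : FreshBatch P.law P.lawζ where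
  c i s := s.2 (d i)
  R i s := (s.1.1, Function.update s.1.2 (d i) s.2)
  measurable_c i := (measurable_pi_apply _).comp measurable_snd
  measurePreserving_R i :=
    ((MeasurePreserving.id _).prod (measurePreserving_update P.lawζ (d i))).comp
      (measurePreserving_prodAssoc _ _ _)
  c_self i s a := by simp
  c_ne i j s a h := by simp [Function.update_of_ne (hd.ne h)]

open scoped Classical in
/-- The samples `ξ (d 0), ξ (d 1), …` as a fresh batch. -/
def xiBatch (P : Problem p q Ξ Z) [IsProbabilityMeasure P.lawξ] [IsProbabilityMeasure P.lawζ]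
    (d : ℕ → ℕ × ℕ) (hd : Function.Injective d) : FreshBatch P.law P.lawξ where
  c i s := s.1 (d i)
  R i s := (Function.update s.1.1 (d i) s.2, s.1.2)
  measurable_c i := (measurable_pi_apply _).comp measurable_fst
  measurePreserving_R i :=
    (Measure.measurePreserving_swap.comp
      ((MeasurePreserving.id _).prod (measurePreserving_update P.lawξ (d i)))).comp
      ((measurePreserving_prodAssoc _ _ _).comp
        (Measure.measurePreserving_swap.prod (MeasurePreserving.id _)))
  c_self i s a := by simp
  c_ne i j s a h := by simp [Function.update_of_ne (hd.ne h)]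

section

variable {P : Problem p q Ξ Z} [IsProbabilityMeasure P.lawξ] [IsProbabilityMeasure P.lawζ]

open scoped Classical in
lemma zetaBatch_R_of_ne {d : ℕ → GDraw} (hd : Function.Injective d) {i : ℕ} {d' : GDraw}
    (h : d' ≠ d i) (s : Samples Ξ Z) (a : Z) : ((zetaBatch P d hd).R i (s, a)).2 d' = s.2 d' :=
  Function.update_of_ne h _ _

lemma xiBatch_R_of_ne {d : ℕ → ℕ × ℕ} (hd : Function.Injective d) {i : ℕ} {d' : ℕ × ℕ}
    (h : d' ≠ d i) (s : Samples Ξ Z) (a : Ξ) : ((xiBatch P d hd).R i (s, a)).1 d' = s.1 d' :=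
  Function.update_of_ne h _ _

end

end SampleSpace

/-! ### Batch averages -/

section BatchMean

variable {V : Type*} [NormedAddCommGroup V] [NormedSpace ℝ V]

lemma batchMean_smul_sub {n : ℕ} (hn : 1 ≤ n) (c : ℝ) (a : ℕ → V) (b : V) :
    batchMean n (fun i => c • (a i - b)) = c • (batchMean n a - b) := by
  have : (n : ℝ) ≠ 0 := by positivity
  simp only [batchMean, ← Finset.smul_sum, Finset.sum_sub_distrib, Finset.sum_const,
    Finset.card_range, ← Nat.cast_smul_eq_nsmul ℝ]
  rw [smul_sub, smul_sub, smul_sub, smul_comm, smul_comm (1 / (n : ℝ)) c ((n : ℝ) • b),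
    smul_smul (1 / (n : ℝ)), one_div_mul_cancel this, one_smul]

lemma batchMean_sub {n : ℕ} (hn : 1 ≤ n) (a : ℕ → V) (b : V) :
    batchMean n (fun i => a i - b) = batchMean n a - b := by
  simpa using batchMean_smul_sub hn 1 a b

lemma norm_batchMean_le {n : ℕ} (hn : 1 ≤ n) {a : ℕ → V} {c : ℝ} (h : ∀ i, ‖a i‖ ≤ c) :
    ‖batchMean n a‖ ≤ c := by
  have hn' : (0 : ℝ) < n := by positivity
  rw [batchMean, norm_smul, Real.norm_of_nonneg (by positivity), one_div, inv_mul_le_iff₀ hn']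
  refine (norm_sum_le_of_le _ fun i _ => h i).trans ?_
  simp

lemma batchMean_apply {W : Type*} [NormedAddCommGroup W] [NormedSpace ℝ W] (n : ℕ)
    (T : ℕ → V →L[ℝ] W) (v : V) : batchMean n T v = batchMean n fun i => T i v := by
  simp [batchMean]

lemma measurable_batchMean {Ω : Type*} [MeasurableSpace Ω] [MeasurableSpace V] [BorelSpace V]
    [SecondCountableTopology V] (n : ℕ) {a : ℕ → Ω → V} (h : ∀ i, Measurable (a i)) :
    Measurable fun ω => batchMean n fun i => a i ω :=
  (Finset.measurable_sum _ fun i _ => h i).const_smul _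

lemma measurable_smul_fun {Ω : Type*} [MeasurableSpace Ω] [MeasurableSpace V] [BorelSpace V]
    (c : ℝ) {f : Ω → V} (h : Measurable f) : Measurable fun ω => c • f ω :=
  h.const_smul c

lemma measurable_clm_apply {Ω V W : Type*} [MeasurableSpace Ω] [NormedAddCommGroup V]
    [NormedSpace ℝ V] [FiniteDimensional ℝ V] [MeasurableSpace V] [BorelSpace V]
    [NormedAddCommGroup W] [NormedSpace ℝ W]
    [FiniteDimensional ℝ W] [MeasurableSpace W] [BorelSpace W]
    {T : Ω → V →L[ℝ] W} {v : Ω → V} (hT : Measurable T) (hv : Measurable v) :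
    Measurable fun ω => T ω (v ω) := by
  have := FiniteDimensional.proper ℝ V
  have := FiniteDimensional.proper ℝ W
  exact isBoundedBilinearMap_apply.continuous.measurable.comp (hT.prodMk hv)

end BatchMean

/-! ### Operators with spectrum in [μ, L] -/

/-- Symmetric operators between `μ` and `L`. -/
structure IsHessian {E : Type*} [NormedAddCommGroup E] [InnerProductSpace ℝ E] (T : E →L[ℝ] E)
    (L μ : ℝ) : Prop where
  symm : ∀ v w, inner ℝ (T v) w = inner ℝ v (T w)
  ge : ∀ v, μ * ‖v‖ ^ 2 ≤ inner ℝ (T v) v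
  le : ∀ v, inner ℝ (T v) v ≤ L * ‖v‖ ^ 2

section IsHessian

variable {E : Type*} [NormedAddCommGroup E] [InnerProductSpace ℝ E] {L μ : ℝ}

lemma inner_batchMean (n : ℕ) (T : ℕ → E →L[ℝ] E) (v w : E) :
    inner ℝ (batchMean n T v) w = 1 / (n : ℝ) * ∑ i ∈ Finset.range n, inner ℝ (T i v) w := by
  rw [batchMean_apply, batchMean, real_inner_smul_left, sum_inner]

lemma IsHessian.batchMean {n : ℕ} (hn : 1 ≤ n) {T : ℕ → E →L[ℝ] E} (h : ∀ i, IsHessian (T i) L μ) :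
    IsHessian (batchMean n T) L μ := by
  have hn' : (0 : ℝ) < n := by positivity
  refine ⟨fun v w => ?_, fun v => ?_, fun v => ?_⟩
  · rw [inner_batchMean, real_inner_comm, inner_batchMean]
    congr 1
    exact Finset.sum_congr rfl fun i _ => by rw [(h i).symm, real_inner_comm]
  · rw [inner_batchMean, one_div, le_inv_mul_iff₀ hn']
    simpa using Finset.card_nsmul_le_sum (Finset.range n) _ _ fun i _ => (h i).ge v
  · rw [inner_batchMean, one_div, inv_mul_le_iff₀ hn']
    simpa using Finset.sum_le_card_nsmul (Finset.range n) _ _ fun i _ => (h i).le v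

lemma IsHessian.norm_sub_smul_le {T : E →L[ℝ] E} (h : IsHessian T L μ) (hμL : μ ≤ L) {c : ℝ}
    (hc : 0 ≤ c) (hcL : c * (L + μ) ≤ 2) (v : E) : ‖v - c • T v‖ ≤ (1 - c * μ) * ‖v‖ :=
  norm_sub_smul_apply_le hμL hc hcL h.symm h.ge h.le v

/-- Energy dissipation of a Richardson step. -/
lemma IsHessian.norm_sub_smul_sq_add_le {T : E →L[ℝ] E} (h : IsHessian T L μ) (hμ : 0 ≤ μ)
    (hL : 0 ≤ L) {c : ℝ} (hc : 0 ≤ c) (hcL : c * L ≤ 1) (v : E) :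
    ‖v - c • T v‖ ^ 2 + c * inner ℝ (T v) v ≤ ‖v‖ ^ 2 := by
  have hpos : 0 ≤ inner ℝ (T v) v := (by positivity : 0 ≤ μ * ‖v‖ ^ 2).trans (h.ge v)
  have h1 := norm_sq_apply_le_of_symm hL h.symm
    (fun w => (by positivity : 0 ≤ μ * ‖w‖ ^ 2).trans (h.ge w)) h.le v
  rw [norm_sub_sq_real, norm_smul, real_inner_smul_right, real_inner_comm, mul_pow,
    Real.norm_of_nonneg hc]
  -- c²‖Tv‖² ≤ c(cL)⟨Tv, v⟩ ≤ c⟨Tv, v⟩ consumes only half of the decrease 2c⟨Tv, v⟩.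
  have h2 : c ^ 2 * ‖T v‖ ^ 2 ≤ c ^ 2 * (L * inner ℝ (T v) v) := by gcongr
  have h3 : c * inner ℝ (T v) v * (c * L) ≤ c * inner ℝ (T v) v * 1 := by gcongr
  nlinarith

end IsHessian

/-! ### Dependence of the iterates on the samples -/

/-- The outer iteration in which a sample is drawn. -/
def GDraw.outer : GDraw → ℕ
  | inner k _ _ => k
  | jac k _ => k
  | hess k _ _ => k

section Dependence

variable {p q : ℕ} {Ξ Z : Type*} [MeasurableSpace Ξ] [MeasurableSpace Z]
  {P : Problem p q Ξ Z} {θ : Params} {μ : ℝ}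

lemma innerLoop_congr {smp smp' : ℕ → ℕ → Z} (x : Vec p) (y : Vec q) {t : ℕ}
    (h : ∀ t' < t, ∀ i, smp t' i = smp' t' i) :
    innerLoop P θ smp x y t = innerLoop P θ smp' x y t := by
  induction t with
  | zero => rfl
  | succ t ih =>
    simp only [innerLoop]
    rw [ih fun t' ht' => h t' (by omega)]
    simp only [h t (by omega)]

/-- Step s' applies only `H (Q - s')`, so the s-th vector does not see the batches still to come. -/
lemma neumann_congr {η : ℝ} {Q : ℕ} {H H' : ℕ → Vec q →L[ℝ] Vec q} (v : Vec q) {s : ℕ}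
    (h : ∀ s' < s, H (Q - s') = H' (Q - s')) :
    neumann η Q H v s = neumann η Q H' v s := by
  induction s with
  | zero => rfl
  | succ s ih =>
    simp only [neumann]
    rw [ih fun s' hs' => h s' (by omega), h s (by omega)]

/-- Adaptedness: the state at the start of iteration k depends on earlier iterations only. This and
the other `_congr` lemmas supply the invariance required by `FreshBatch`. -/
lemma stocBiO_congr {x₀ : Vec p} {y₀ : Vec q} {s s' : Samples Ξ Z} {k : ℕ}
    (hξ : ∀ j < k, ∀ i, s.1 (j, i) = s'.1 (j, i))
    (hζ : ∀ d : GDraw, d.outer < k → s.2 d = s'.2 d) :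
    stocBiO P θ μ x₀ y₀ s.1 s.2 k = stocBiO P θ μ x₀ y₀ s'.1 s'.2 k := by
  induction k with
  | zero => rfl
  | succ k ih =>
    simp only [stocBiO]
    rw [ih (fun j hj => hξ j (by omega)) fun d hd => hζ d (by omega)]
    have h1 : ∀ t i, s.2 (.inner k t i) = s'.2 (.inner k t i) := fun t i =>
      hζ _ (Nat.lt_succ_self k)
    have h2 : ∀ i, s.2 (.jac k i) = s'.2 (.jac k i) := fun i => hζ _ (Nat.lt_succ_self k)
    have h3 : ∀ j i, s.2 (.hess k j i) = s'.2 (.hess k j i) := fun j i =>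
      hζ _ (Nat.lt_succ_self k)
    simp only [h1, h2, h3, hξ k (Nat.lt_succ_self k)]

end Dependence

/-! ### The iterates as functions on the space of samples -/

section Iterates

variable {p q : ℕ} {Ξ Z : Type*} [MeasurableSpace Ξ] [MeasurableSpace Z]
  (P : Problem p q Ξ Z) (θ : Params) (μ : ℝ) (x₀ : Vec p) (y₀ : Vec q)

/-- `x_k`. -/
def outerX (k : ℕ) (s : Samples Ξ Z) : Vec p := (stocBiO P θ μ x₀ y₀ s.1 s.2 k).1

/-- `y_k^t`. -/
def innerY (k t : ℕ) (s : Samples Ξ Z) : Vec q :=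
  innerLoop P θ (fun t i => s.2 (.inner k t i)) (outerX P θ μ x₀ y₀ k s)
    (stocBiO P θ μ x₀ y₀ s.1 s.2 k).2 t

/-- `∇ₓF(x_k, y_k^D; D_F)`. -/
def batchFx (k : ℕ) (s : Samples Ξ Z) : Vec p :=
  batchMean θ.Df fun i => gradX (fun w => P.F w (s.1 (k, i))) (outerX P θ μ x₀ y₀ k s)
    (innerY P θ μ x₀ y₀ k θ.D s)

/-- `∇_yF(x_k, y_k^D; D_F)`. -/
def batchFy (k : ℕ) (s : Samples Ξ Z) : Vec q :=
  batchMean θ.Df fun i => gradY (fun w => P.F w (s.1 (k, i))) (outerX P θ μ x₀ y₀ k s)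
    (innerY P θ μ x₀ y₀ k θ.D s)

/-- `∇_y²G(x_k, y_k^D; B_j)`. -/
def batchH (k j : ℕ) (s : Samples Ξ Z) : Vec q →L[ℝ] Vec q :=
  batchMean (θ.hessBatch μ j) fun i => hessY (fun w => P.G w (s.2 (.hess k j i)))
    (outerX P θ μ x₀ y₀ k s) (innerY P θ μ x₀ y₀ k θ.D s)

/-- `∇ₓ∇_yG(x_k, y_k^D; D_G)`. -/
def batchJ (k : ℕ) (s : Samples Ξ Z) : Vec q →L[ℝ] Vec p :=
  batchMean θ.Dg fun i => jacXY (fun w => P.G w (s.2 (.jac k i)))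
    (outerX P θ μ x₀ y₀ k s) (innerY P θ μ x₀ y₀ k θ.D s)

/-- `r_{Q-j}` in iteration `k`. -/
def resid (k j : ℕ) (s : Samples Ξ Z) : Vec q :=
  neumann θ.η θ.Q (fun j => batchH P θ μ x₀ y₀ k j s) (batchFy P θ μ x₀ y₀ k s) j

/-- `v_Q` in iteration `k`. -/
def dirV (k : ℕ) (s : Samples Ξ Z) : Vec q :=
  θ.η • ∑ j ∈ Finset.range (θ.Q + 1), resid P θ μ x₀ y₀ k j s

/-- The hypergradient estimate of iteration `k`. -/
def estim (k : ℕ) (s : Samples Ξ Z) : Vec p :=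
  batchFx P θ μ x₀ y₀ k s - batchJ P θ μ x₀ y₀ k s (dirV P θ μ x₀ y₀ k s)

lemma outerX_succ (k : ℕ) (s : Samples Ξ Z) : outerX P θ μ x₀ y₀ (k + 1) s
    = outerX P θ μ x₀ y₀ k s - θ.β • estim P θ μ x₀ y₀ k s := rfl

lemma innerY_succ_zero (k : ℕ) (s : Samples Ξ Z) :
    innerY P θ μ x₀ y₀ (k + 1) 0 s = innerY P θ μ x₀ y₀ k θ.D s := rfl

lemma innerY_succ (k t : ℕ) (s : Samples Ξ Z) :
    innerY P θ μ x₀ y₀ k (t + 1) s = innerY P θ μ x₀ y₀ k t s - θ.α • batchMean θ.S fun i =>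
      gradY (fun w => P.G w (s.2 (.inner k t i))) (outerX P θ μ x₀ y₀ k s)
        (innerY P θ μ x₀ y₀ k t s) := rfl

lemma resid_succ (k j : ℕ) (s : Samples Ξ Z) : resid P θ μ x₀ y₀ k (j + 1) s
    = resid P θ μ x₀ y₀ k j s
      - θ.η • batchH P θ μ x₀ y₀ k (θ.Q - j) s (resid P θ μ x₀ y₀ k j s) := rfl

variable {P θ μ x₀ y₀}

/-! Dependence on the samples. -/

variable {s s' : Samples Ξ Z} {k : ℕ}

lemma outerX_congr (hξ : ∀ j < k, ∀ i, s.1 (j, i) = s'.1 (j, i))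
    (hζ : ∀ d : GDraw, d.outer < k → s.2 d = s'.2 d) :
    outerX P θ μ x₀ y₀ k s = outerX P θ μ x₀ y₀ k s' := by
  rw [outerX, outerX, stocBiO_congr hξ hζ]

lemma innerY_congr {t : ℕ} (hξ : ∀ j < k, ∀ i, s.1 (j, i) = s'.1 (j, i))
    (hζ : ∀ d : GDraw, d.outer < k → s.2 d = s'.2 d)
    (hin : ∀ t' < t, ∀ i, s.2 (.inner k t' i) = s'.2 (.inner k t' i)) :
    innerY P θ μ x₀ y₀ k t s = innerY P θ μ x₀ y₀ k t s' := by
  rw [innerY, innerY, outerX_congr hξ hζ, stocBiO_congr hξ hζ]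
  exact innerLoop_congr _ _ hin

lemma batchFy_congr (hξ : ∀ j < k + 1, ∀ i, s.1 (j, i) = s'.1 (j, i))
    (hζ : ∀ d : GDraw, d.outer < k → s.2 d = s'.2 d)
    (hin : ∀ t i, s.2 (.inner k t i) = s'.2 (.inner k t i)) :
    batchFy P θ μ x₀ y₀ k s = batchFy P θ μ x₀ y₀ k s' := by
  rw [batchFy, batchFy, outerX_congr (fun j hj => hξ j (by omega)) hζ,
    innerY_congr (fun j hj => hξ j (by omega)) hζ fun t _ => hin t]
  simp only [hξ k (Nat.lt_succ_self k)]

lemma resid_congr (hξ : ∀ j < k + 1, ∀ i, s.1 (j, i) = s'.1 (j, i))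
    (hζ : ∀ d : GDraw, d.outer < k → s.2 d = s'.2 d)
    (hin : ∀ t i, s.2 (.inner k t i) = s'.2 (.inner k t i)) {j : ℕ}
    (hh : ∀ j' < j, ∀ i, s.2 (.hess k (θ.Q - j') i) = s'.2 (.hess k (θ.Q - j') i)) :
    resid P θ μ x₀ y₀ k j s = resid P θ μ x₀ y₀ k j s' := by
  rw [resid, resid, batchFy_congr hξ hζ hin]
  refine neumann_congr _ fun j' hj' => ?_
  rw [batchH, batchH, outerX_congr (fun j hj => hξ j (by omega)) hζ,
    innerY_congr (fun j hj => hξ j (by omega)) hζ fun t _ => hin t]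
  simp only [hh j' hj']

lemma dirV_congr (hξ : ∀ j < k + 1, ∀ i, s.1 (j, i) = s'.1 (j, i))
    (hζ : ∀ d : GDraw, d.outer < k → s.2 d = s'.2 d)
    (hin : ∀ t i, s.2 (.inner k t i) = s'.2 (.inner k t i))
    (hh : ∀ j i, s.2 (.hess k j i) = s'.2 (.hess k j i)) :
    dirV P θ μ x₀ y₀ k s = dirV P θ μ x₀ y₀ k s' := by
  rw [dirV, dirV]
  congr 1
  exact Finset.sum_congr rfl fun j _ => resid_congr hξ hζ hin fun j' _ => hh _

/-! Measurability. -/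

variable {L M τ ρ σ : ℝ} (hP : P.Assumptions L M τ ρ μ σ)
include hP

lemma measurable_jac_comp {Ω : Type*} [MeasurableSpace Ω] {x : Ω → Vec p} {y : Ω → Vec q}
    {a : Ω → Z} (hx : Measurable x) (hy : Measurable y) (ha : Measurable a) :
    Measurable fun ω => jacXY (fun w => P.G w (a ω)) (x ω) (y ω) :=
  Measurable.comp (f := fun ω => ((x ω, y ω), a ω))
    (g := fun s : (Vec p × Vec q) × Z => jacXY (fun w => P.G w s.2) s.1.1 s.1.2)
    hP.measurable_jacXY_G' ((hx.prodMk hy).prodMk ha)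

lemma measurable_innerLoop {Ω : Type*} [MeasurableSpace Ω] {smp : ℕ → ℕ → Ω → Z}
    (hs : ∀ t i, Measurable (smp t i)) {x : Ω → Vec p} {y : Ω → Vec q} (hx : Measurable x)
    (hy : Measurable y) (t : ℕ) :
    Measurable fun ω => innerLoop P θ (fun t i => smp t i ω) (x ω) (y ω) t := by
  induction t with
  | zero => exact hy
  | succ t ih =>
    have h : ∀ i, Measurable fun ω => gradY (fun w => P.G w (smp t i ω)) (x ω)
        (innerLoop P θ (fun t i => smp t i ω) (x ω) (y ω) t) := fun i =>
      hP.measurable_gradY_G'.comp ((hx.prodMk ih).prodMk (hs t i))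
    exact ih.sub (measurable_smul_fun _ (measurable_batchMean _ h))

lemma measurable_hyperGrad {Ω : Type*} [MeasurableSpace Ω] {smpF : ℕ → Ω → Ξ} {smpG : ℕ → Ω → Z}
    {smpH : ℕ → ℕ → Ω → Z} (hF : ∀ i, Measurable (smpF i)) (hG : ∀ i, Measurable (smpG i))
    (hH : ∀ j i, Measurable (smpH j i)) {x : Ω → Vec p} {y : Ω → Vec q} (hx : Measurable x)
    (hy : Measurable y) :
    Measurable fun ω => hyperGrad P θ μ (fun i => smpF i ω) (fun i => smpG i ω)
      (fun j i => smpH j i ω) (x ω) (y ω) := by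
  have h0 : Measurable fun ω =>
      batchMean θ.Df fun i => gradY (fun w => P.F w (smpF i ω)) (x ω) (y ω) :=
    measurable_batchMean _ fun i => hP.measurable_gradY_F'.comp ((hx.prodMk hy).prodMk (hF i))
  have hn : ∀ j, Measurable fun ω => neumann θ.η θ.Q
      (fun j => batchMean (θ.hessBatch μ j) fun i =>
        hessY (fun w => P.G w (smpH j i ω)) (x ω) (y ω))
      (batchMean θ.Df fun i => gradY (fun w => P.F w (smpF i ω)) (x ω) (y ω)) j := by
    intro j
    induction j with
    | zero => exact h0
    | succ j ih =>
      have h1 : Measurable fun ω => batchMean (θ.hessBatch μ (θ.Q - j)) fun i =>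
          hessY (fun w => P.G w (smpH (θ.Q - j) i ω)) (x ω) (y ω) :=
        measurable_batchMean _ fun i =>
          hP.measurable_hessY_G'.comp ((hx.prodMk hy).prodMk (hH (θ.Q - j) i))
      exact ih.sub (measurable_smul_fun _ (measurable_clm_apply h1 ih))
  refine Measurable.sub ?_ ?_
  · exact measurable_batchMean _ fun i =>
      hP.measurable_gradX_F'.comp ((hx.prodMk hy).prodMk (hF i))
  · have hJ : ∀ i, Measurable fun ω => jacXY (fun w => P.G w (smpG i ω)) (x ω) (y ω) := fun i =>
      measurable_jac_comp hP hx hy (hG i)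
    have h1 : Measurable fun ω => batchMean θ.Dg fun i =>
        jacXY (fun w => P.G w (smpG i ω)) (x ω) (y ω) :=
      measurable_batchMean (V := Vec q →L[ℝ] Vec p) _ (hJ)
    exact measurable_clm_apply h1
      (measurable_smul_fun _ (Finset.measurable_sum _ fun j _ => hn j))

lemma measurable_stocBiO (k : ℕ) :
    Measurable fun s : Samples Ξ Z => stocBiO P θ μ x₀ y₀ s.1 s.2 k := by
  have hξ : ∀ i, Measurable fun s : Samples Ξ Z => s.1 i := fun i =>
    (measurable_pi_apply i).comp measurable_fst
  have hζ : ∀ d, Measurable fun s : Samples Ξ Z => s.2 d := fun d =>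
    (measurable_pi_apply d).comp measurable_snd
  induction k with
  | zero => exact measurable_const
  | succ k ih =>
    have hx : Measurable fun s : Samples Ξ Z => (stocBiO P θ μ x₀ y₀ s.1 s.2 k).1 := ih.fst
    have hy : Measurable fun s : Samples Ξ Z => innerLoop P θ (fun t i => s.2 (.inner k t i))
        (stocBiO P θ μ x₀ y₀ s.1 s.2 k).1 (stocBiO P θ μ x₀ y₀ s.1 s.2 k).2 θ.D :=
      measurable_innerLoop hP (smp := fun t i (s : Samples Ξ Z) => s.2 (.inner k t i))
        (fun _ _ => hζ _) hx ih.snd θ.D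
    have hg := measurable_hyperGrad (θ := θ) hP (smpF := fun i (s : Samples Ξ Z) => s.1 (k, i))
      (smpG := fun i s => s.2 (.jac k i)) (smpH := fun j i s => s.2 (.hess k j i))
      (fun _ => hξ _) (fun _ => hζ _) (fun _ _ => hζ _) hx hy
    exact (hx.sub (measurable_smul_fun _ hg)).prodMk hy

lemma measurable_outerX (k : ℕ) : Measurable (outerX P θ μ x₀ y₀ k) :=
  (measurable_stocBiO hP k).fst

lemma measurable_innerY (k t : ℕ) : Measurable (innerY P θ μ x₀ y₀ k t) :=
  measurable_innerLoop hP (smp := fun t i (s : Samples Ξ Z) => s.2 (.inner k t i))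
    (fun _ _ => (measurable_pi_apply _).comp measurable_snd)
    (measurable_outerX (θ := θ) (x₀ := x₀) (y₀ := y₀) hP k)
    (measurable_stocBiO (θ := θ) (x₀ := x₀) (y₀ := y₀) hP k).snd t

lemma measurable_position (k : ℕ) : Measurable fun s =>
    (outerX P θ μ x₀ y₀ k s, innerY P θ μ x₀ y₀ k θ.D s) :=
  (measurable_outerX hP k).prodMk (measurable_innerY hP k θ.D)

lemma measurable_batchFy (k : ℕ) : Measurable (batchFy P θ μ x₀ y₀ k) :=
  measurable_batchMean _ fun i => hP.measurable_gradY_F'.comp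
    ((measurable_position hP k).prodMk ((measurable_pi_apply (k, i)).comp measurable_fst))

lemma measurable_batchFx (k : ℕ) : Measurable (batchFx P θ μ x₀ y₀ k) :=
  measurable_batchMean _ fun i => hP.measurable_gradX_F'.comp
    ((measurable_position hP k).prodMk ((measurable_pi_apply (k, i)).comp measurable_fst))

lemma measurable_batchH (k j : ℕ) : Measurable (batchH P θ μ x₀ y₀ k j) :=
  measurable_batchMean _ fun i => hP.measurable_hessY_G'.comp
    ((measurable_position hP k).prodMk
      ((measurable_pi_apply (GDraw.hess k j i)).comp measurable_snd))

lemma measurable_batchJ (k : ℕ) : Measurable (batchJ P θ μ x₀ y₀ k) := by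
  have h : ∀ i, Measurable fun s : Samples Ξ Z => jacXY (fun w => P.G w (s.2 (.jac k i)))
      (outerX P θ μ x₀ y₀ k s) (innerY P θ μ x₀ y₀ k θ.D s) := fun i =>
    measurable_jac_comp hP (measurable_outerX hP k) (measurable_innerY hP k θ.D)
      ((measurable_pi_apply (GDraw.jac k i)).comp measurable_snd)
  exact measurable_batchMean _ h

lemma measurable_resid (k j : ℕ) : Measurable (resid P θ μ x₀ y₀ k j) := by
  induction j with
  | zero => exact measurable_batchFy hP k
  | succ j ih =>
    exact ih.sub (measurable_smul_fun _ (measurable_clm_apply (measurable_batchH hP k (θ.Q - j)) ih))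

lemma measurable_dirV (k : ℕ) : Measurable (dirV P θ μ x₀ y₀ k) :=
  measurable_smul_fun _ (Finset.measurable_sum _ fun j _ => measurable_resid hP k j)

lemma measurable_estim (k : ℕ) : Measurable (estim P θ μ x₀ y₀ k) :=
  (measurable_batchFx hP k).sub (measurable_clm_apply (measurable_batchJ hP k)
    (measurable_dirV hP k))

end Iterates

/-! ### Consequences of the parameter choices -/

section Tuned

variable {θ : Params} {L M τ ρ μ : ℝ}

lemma Params.IsTuned.eta_mul_L_lt (hθ : θ.IsTuned L M τ ρ μ) (hL : 0 < L) : θ.η * L < 1 := by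
  have := hθ.η_lt
  rwa [lt_div_iff₀ hL] at this

lemma Params.IsTuned.eta_mul_mu_lt (hθ : θ.IsTuned L M τ ρ μ) (hμ : 0 < μ) (hμL : μ ≤ L) :
    θ.η * μ < 1 :=
  (mul_le_mul_of_nonneg_left hμL hθ.η_pos.le).trans_lt (hθ.eta_mul_L_lt (hμ.trans_le hμL))

lemma Params.IsTuned.eta_mul_add_le (hθ : θ.IsTuned L M τ ρ μ) (hμ : 0 < μ) (hμL : μ ≤ L) :
    θ.η * (L + μ) ≤ 2 := by
  have h1 := hθ.eta_mul_L_lt (hμ.trans_le hμL)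
  have h2 := hθ.eta_mul_mu_lt hμ hμL
  rw [mul_add]; linarith

lemma Params.IsTuned.contr_pos (hθ : θ.IsTuned L M τ ρ μ) (hμ : 0 < μ) (hμL : μ ≤ L) :
    0 < 1 - θ.η * μ := by linarith [hθ.eta_mul_mu_lt hμ hμL]

lemma Params.IsTuned.contr_lt_one (hθ : θ.IsTuned L M τ ρ μ) (hμ : 0 < μ) :
    1 - θ.η * μ < 1 := by
  have : 0 < θ.η * μ := mul_pos hθ.η_pos hμ
  linarith

lemma Params.IsTuned.B_pos (hθ : θ.IsTuned L M τ ρ μ) (hμ : 0 < μ) (hμL : μ ≤ L) : 0 < θ.B := by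
  refine lt_of_lt_of_le ?_ hθ.B_ge
  have h1 := hθ.contr_pos hμ hμL
  have h2 : (0 : ℝ) < θ.Q := by exact_mod_cast hθ.Q_pos
  positivity

lemma Params.IsTuned.one_le_hessBatch (hθ : θ.IsTuned L M τ ρ μ) (hμ : 0 < μ) (hμL : μ ≤ L)
    (j : ℕ) : 1 ≤ θ.hessBatch μ j := by
  have h1 := hθ.contr_pos hμ hμL
  have h2 : (0 : ℝ) < θ.Q := by exact_mod_cast hθ.Q_pos
  have h3 := hθ.B_pos hμ hμL
  exact Nat.ceil_pos.2 (by positivity)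

lemma Params.le_hessBatch {s : ℕ} (hs : s ≤ θ.Q) :
    θ.B * θ.Q * (1 - θ.η * μ) ^ s ≤ θ.hessBatch μ (θ.Q - s) := by
  refine le_trans (le_of_eq ?_) (Nat.le_ceil _)
  rw [Nat.sub_sub_self hs]

end Tuned

/-- Weighted sum of the energies dissipated along the Neumann iteration. -/
lemma weighted_dissipation_le {a M η c : ℝ} {m w A : ℕ → ℝ} {Q : ℕ} (ha : 0 < a) (ha1 : a ≤ 1)
    (hc : 0 ≤ c) (hη : 0 ≤ η) (hm : ∀ s, m s ≤ a ^ (2 * s) * M ^ 2)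
    (hw : ∀ s < Q, m (s + 1) + η * w s ≤ m s) (hA0 : A 0 = 0)
    (hA : ∀ s < Q, A (s + 1) ≤ A s + c * (w s / a ^ s)) {s : ℕ} (hs : s ≤ Q) :
    η * A s + c * (m s / a ^ s) ≤ c * (M ^ 2 * (2 - a ^ s)) := by
  -- With the weight frozen, the potential η A_s + c m_s/a^s does not grow: the dissipation of m
  -- pays for the growth of A. Changing the weight from a^{−s} to a^{−(s+1)} costs at most c M²(a^s
  -- − a^{s+1}), because m_{s+1} ≤ a^{2(s+1)} M², and these costs telescope.
  induction s with
  | zero =>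
    have := hm 0
    simp only [hA0, pow_zero, mul_zero, zero_add, one_mul, div_one] at this ⊢
    gcongr
    linarith
  | succ s ih =>
    have h1 := ih (by omega)
    have h2 := mul_le_mul_of_nonneg_left (hA s (by omega)) hη
    have hp : 0 < a ^ s := pow_pos ha s
    have h3 : (m (s + 1) + η * w s) / a ^ s ≤ m s / a ^ s := by
      gcongr; exact hw s (by omega)
    have h4 : m (s + 1) / a ^ (s + 1) - m (s + 1) / a ^ s ≤ M ^ 2 * (a ^ s - a ^ (s + 1)) := by
      have e : m (s + 1) / a ^ (s + 1) - m (s + 1) / a ^ s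
          = m (s + 1) * ((1 - a) / a ^ (s + 1)) := by
        rw [pow_succ]; field_simp
      have h5 : m (s + 1) * ((1 - a) / a ^ (s + 1))
          ≤ a ^ (2 * (s + 1)) * M ^ 2 * ((1 - a) / a ^ (s + 1)) :=
        mul_le_mul_of_nonneg_right (hm _) (div_nonneg (by linarith) (by positivity))
      have e2 : a ^ (2 * (s + 1)) * M ^ 2 * ((1 - a) / a ^ (s + 1))
          = M ^ 2 * (1 - a) * a ^ (s + 1) := by
        rw [two_mul, pow_add]; field_simp
      have h6 : a ^ (s + 1) ≤ a ^ s := pow_le_pow_of_le_one ha.le ha1 (Nat.le_succ s)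
      have h7 : M ^ 2 * (1 - a) * a ^ (s + 1) ≤ M ^ 2 * (1 - a) * a ^ s :=
        mul_le_mul_of_nonneg_left h6 (mul_nonneg (sq_nonneg M) (by linarith))
      rw [e]
      calc _ ≤ M ^ 2 * (1 - a) * a ^ s := h5.trans (e2.le.trans h7)
        _ = _ := by rw [pow_succ]; ring
    have e3 : (m (s + 1) + η * w s) / a ^ s = m (s + 1) / a ^ s + η * (w s / a ^ s) := by
      rw [add_div, mul_div_assoc]
    have h8 := mul_le_mul_of_nonneg_left h3 hc
    have h9 := mul_le_mul_of_nonneg_left h4 hc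
    rw [e3] at h8
    nlinarith

lemma ENNReal_inv_natCast {n : ℕ} (hn : 1 ≤ n) : (n : ENNReal)⁻¹ = ENNReal.ofReal (1 / n) := by
  rw [one_div, ENNReal.ofReal_inv_of_pos (by positivity), ENNReal.ofReal_natCast]

/-! ### One outer iteration: inner SGD, deterministic bounds, noise of D_F and D_G -/

section Bounds

variable {p q : ℕ} {Ξ Z : Type*} [MeasurableSpace Ξ] [MeasurableSpace Z]
  {P : Problem p q Ξ Z} {θ : Params} {L M τ ρ μ σ : ℝ} {x₀ : Vec p} {y₀ : Vec q}
  (hP : P.Assumptions L M τ ρ μ σ) (hθ : θ.IsTuned L M τ ρ μ)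
include hP

lemma measurable_yStar (hμ : 0 < μ) (hμL : μ ≤ L) : Measurable P.yStar := by
  have : LipschitzWith (Real.toNNReal (L / μ)) P.yStar :=
    LipschitzWith.of_dist_le_mul fun x x' => by
      rw [dist_eq_norm, dist_eq_norm]
      exact (hP.yStar_lipschitz hμ hμL x x').trans (by gcongr; exact Real.le_coe_toNNReal _)
  exact this.continuous.measurable

omit hP in
lemma measurable_of_lipschitz_pair {V : Type*} [NormedAddCommGroup V] [MeasurableSpace V]
    [BorelSpace V] {T : Vec p → Vec q → V} {c : ℝ}
    (hT : ∀ x x' y y', ‖T x y - T x' y'‖ ≤ c * ‖pair x y - pair x' y'‖) :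
    Measurable fun z : Vec p × Vec q => T z.1 z.2 := by
  have h : LipschitzWith (Real.toNNReal c) fun z : Joint p q => T z.fst z.snd :=
    LipschitzWith.of_dist_le_mul fun z z' => by
      rw [dist_eq_norm, dist_eq_norm]
      exact (hT z.fst z'.fst z.snd z'.snd).trans
        (mul_le_mul_of_nonneg_right (Real.le_coe_toNNReal c) (norm_nonneg _))
  exact (h.continuous.comp continuous_pair).measurable

lemma measurable_gy : Measurable fun z : Vec p × Vec q => P.gy z.1 z.2 :=
  measurable_of_lipschitz_pair hP.gy_lipschitz

lemma measurable_fx (hM : 0 ≤ M) : Measurable fun z : Vec p × Vec q => P.fx z.1 z.2 :=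
  measurable_of_lipschitz_pair (hP.fx_lipschitz hM)

lemma measurable_fy (hM : 0 ≤ M) : Measurable fun z : Vec p × Vec q => P.fy z.1 z.2 :=
  measurable_of_lipschitz_pair (hP.fy_lipschitz hM)

lemma measurable_hess (hL : 0 ≤ L) : Measurable fun z : Vec p × Vec q => P.hess z.1 z.2 :=
  measurable_of_lipschitz_pair (hP.hess_lipschitz hL)

lemma measurable_jac (hL : 0 ≤ L) : Measurable fun z : Vec p × Vec q => P.jac z.1 z.2 :=
  measurable_of_lipschitz_pair (V := Vec q →L[ℝ] Vec p) (T := P.jac) (hP.jac_lipschitz hL)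

include hθ

/-! The inner loop. -/

/-- The exact gradient step fixes y*(x_k) and contracts towards it; the fresh batch adds a variance
of at most α²σ²/S. -/
lemma lintegral_innerY_succ_le (hμ : 0 < μ) (hμL : μ ≤ L) (k t : ℕ) :
    ∫⁻ s, ‖innerY P θ μ x₀ y₀ k (t + 1) s - P.yStar (outerX P θ μ x₀ y₀ k s)‖ₑ ^ 2 ∂P.law
      ≤ ENNReal.ofReal ((1 - θ.α * μ) ^ 2)
          * ∫⁻ s, ‖innerY P θ μ x₀ y₀ k t s - P.yStar (outerX P θ μ x₀ y₀ k s)‖ₑ ^ 2 ∂P.law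
        + ENNReal.ofReal (1 / θ.S * (θ.α ^ 2 * σ ^ 2)) := by
  have := hP.prob_ξ
  have := hP.prob_ζ
  have := hP.isProbabilityMeasure_law
  have hL : 0 < L := hμ.trans_le hμL
  have hα : 0 < θ.α := by rw [hθ.α_eq]; positivity
  have hαL : θ.α * (L + μ) ≤ 2 := by
    rw [hθ.α_eq, div_mul_cancel₀]; positivity
  let 𝔅 := zetaBatch P (fun i => .inner k t i) fun i j h => by simpa using h
  let X : Samples Ξ Z → Vec p := outerX P θ μ x₀ y₀ k
  let Y : Samples Ξ Z → Vec q := innerY P θ μ x₀ y₀ k t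
  have hXm : Measurable X := measurable_outerX hP k
  have hYm : Measurable Y := measurable_innerY hP k t
  have hXi : ∀ i s a, X (𝔅.R i (s, a)) = X s := fun i s a =>
    outerX_congr (fun _ _ _ => rfl) fun d hd =>
      zetaBatch_R_of_ne _ (by rintro rfl; simp [GDraw.outer] at hd) _ _
  have hYi : ∀ i s a, Y (𝔅.R i (s, a)) = Y s := fun i s a =>
    innerY_congr (fun _ _ _ => rfl) (fun d hd =>
      zetaBatch_R_of_ne _ (by rintro rfl; simp [GDraw.outer] at hd) _ _)
      fun t' ht' i' => zetaBatch_R_of_ne _ (by simp; omega) _ _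
  have hgym : Measurable fun s => P.gy (X s) (Y s) := (measurable_gy hP).comp (hXm.prodMk hYm)
  have hsm : Measurable fun s => P.yStar (X s) := (measurable_yStar hP hμ hμL).comp hXm
  have key := FreshBatch.lintegral_add_batchMean_le (𝔅 := 𝔅)
    (X := fun s => Y s - θ.α • P.gy (X s) (Y s) - P.yStar (X s))
    (h := fun s a => (-θ.α) • (gradY (fun w => P.G w a) (X s) (Y s) - P.gy (X s) (Y s)))
    (V := fun _ => ENNReal.ofReal (θ.α ^ 2 * σ ^ 2))
    ((hYm.sub (measurable_smul_fun _ hgym)).sub hsm)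
    (fun i s a => by simp only [hXi, hYi])
    (measurable_smul_fun _ (Measurable.sub
      (hP.measurable_gradY_G'.comp
        (((hXm.comp measurable_fst).prodMk (hYm.comp measurable_fst)).prodMk measurable_snd))
      (hgym.comp measurable_fst)))
    (fun i s a => by simp only [hXi, hYi])
    (fun s => by
      rw [integral_smul, integral_sub (hP.integrable_gradY_G _ _) (integrable_const _)]
      simp [Problem.gy])
    (fun s => by
      have e : ∀ a, ‖(-θ.α) • (gradY (fun w => P.G w a) (X s) (Y s) - P.gy (X s) (Y s))‖ₑ ^ 2
          = ENNReal.ofReal (θ.α ^ 2)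
            * ‖gradY (fun w => P.G w a) (X s) (Y s) - P.gy (X s) (Y s)‖ₑ ^ 2 := by
        intro a
        rw [norm_sq_eq_enorm, norm_sq_eq_enorm, norm_smul, mul_pow, norm_neg,
          Real.norm_of_nonneg hα.le, ENNReal.ofReal_mul (by positivity)]
      simp only [e]
      rw [lintegral_const_mul' _ _ ENNReal.ofReal_ne_top, ENNReal.ofReal_mul (by positivity)]
      gcongr
      exact hP.variance_gradY_G _ _)
    (fun _ => ENNReal.ofReal_ne_top) hθ.S_pos
  refine le_trans (le_of_eq ?_) (key.trans (add_le_add ?_ (le_of_eq ?_)))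
  · refine lintegral_congr fun s => ?_
    rw [batchMean_smul_sub hθ.S_pos, innerY_succ]
    congr 2
    change Y s - θ.α • batchMean θ.S (fun i => gradY (fun w => P.G w (s.2 (.inner k t i))) (X s) (Y s))
      - P.yStar (X s) = Y s - θ.α • P.gy (X s) (Y s) - P.yStar (X s)
        + (-θ.α) • (batchMean θ.S (fun i => gradY (fun w => P.G w (s.2 (.inner k t i))) (X s) (Y s))
          - P.gy (X s) (Y s))
    module
  · rw [← lintegral_const_mul' _ _ ENNReal.ofReal_ne_top]
    refine lintegral_mono fun s => ?_
    simp only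
    rw [norm_sq_eq_enorm, norm_sq_eq_enorm, ← ENNReal.ofReal_mul (by positivity), ← mul_pow]
    refine ENNReal.ofReal_le_ofReal (pow_le_pow_left₀ (norm_nonneg _) ?_ 2)
    have h := hP.norm_gradStep_sub_le hμL hμ.le hα.le hαL (X s) (Y s) (P.yStar (X s))
    rwa [hP.gy_yStar hμ hμL, smul_zero, sub_zero] at h
  · rw [lintegral_const, measure_univ, mul_one, ENNReal_inv_natCast hθ.S_pos,
      ← ENNReal.ofReal_mul (by positivity)]

/-- For α = 2/(L + μ) the number σ²/(LμS) is the fixed point of the one-step recursion, so the same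
noise term serves for every t. -/
lemma lintegral_innerY_le (hμ : 0 < μ) (hμL : μ ≤ L) (k : ℕ) :
    ∫⁻ s, ‖innerY P θ μ x₀ y₀ k θ.D s - P.yStar (outerX P θ μ x₀ y₀ k s)‖ₑ ^ 2 ∂P.law
      ≤ ENNReal.ofReal ((1 - θ.α * μ) ^ (2 * θ.D))
          * ∫⁻ s, ‖innerY P θ μ x₀ y₀ k 0 s - P.yStar (outerX P θ μ x₀ y₀ k s)‖ₑ ^ 2 ∂P.law
        + ENNReal.ofReal (σ ^ 2 / (L * μ * θ.S)) := by
  have hL : 0 < L := hμ.trans_le hμL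
  have hS : (0 : ℝ) < θ.S := by exact_mod_cast hθ.S_pos
  have key : ∀ t : ℕ,
      ∫⁻ s, ‖innerY P θ μ x₀ y₀ k t s - P.yStar (outerX P θ μ x₀ y₀ k s)‖ₑ ^ 2 ∂P.law
      ≤ ENNReal.ofReal ((1 - θ.α * μ) ^ (2 * t))
          * ∫⁻ s, ‖innerY P θ μ x₀ y₀ k 0 s - P.yStar (outerX P θ μ x₀ y₀ k s)‖ₑ ^ 2 ∂P.law
        + ENNReal.ofReal (σ ^ 2 / (L * μ * θ.S)) := by
    intro t
    induction t with
    | zero => simp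
    | succ t ih =>
      refine (lintegral_innerY_succ_le hP hθ hμ hμL k t).trans ?_
      refine (add_le_add (mul_le_mul' le_rfl ih) le_rfl).trans (le_of_eq ?_)
      have hr : (1 - θ.α * μ) ^ 2 * (σ ^ 2 / (L * μ * θ.S)) + 1 / θ.S * (θ.α ^ 2 * σ ^ 2)
          = σ ^ 2 / (L * μ * θ.S) := by
        rw [hθ.α_eq]
        have : L + μ ≠ 0 := by positivity
        field_simp
        ring
      rw [mul_add, ← mul_assoc, ← ENNReal.ofReal_mul (by positivity),
        ← ENNReal.ofReal_mul (by positivity), add_assoc,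
        ← ENNReal.ofReal_add (by positivity) (by positivity), hr, ← pow_add]
      congr 4
      ring
  exact key θ.D

/-! Deterministic bounds on the hypergradient estimate. -/

lemma isHessian_batchH (hμ : 0 < μ) (hμL : μ ≤ L) (k j : ℕ) (s : Samples Ξ Z) :
    IsHessian (batchH P θ μ x₀ y₀ k j s) L μ :=
  IsHessian.batchMean (hθ.one_le_hessBatch hμ hμL j) fun _ =>
    ⟨(hP.sampleRegular _).hessY_symm _ _, (hP.sampleRegular _).le_inner_hessY _ _,
      (hP.sampleRegular _).inner_hessY_le (hμ.le.trans hμL) _ _⟩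

lemma norm_batchFy_le (hM : 0 ≤ M) (k : ℕ) (s : Samples Ξ Z) :
    ‖batchFy P θ μ x₀ y₀ k s‖ ≤ M :=
  norm_batchMean_le hθ.Df_pos fun _ => hP.norm_gradY_F_le hM _ _ _

lemma norm_batchFx_le (hM : 0 ≤ M) (k : ℕ) (s : Samples Ξ Z) :
    ‖batchFx P θ μ x₀ y₀ k s‖ ≤ M :=
  norm_batchMean_le hθ.Df_pos fun _ => hP.norm_gradX_F_le hM _ _ _

lemma norm_batchJ_le (hL : 0 ≤ L) (k : ℕ) (s : Samples Ξ Z) :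
    ‖batchJ P θ μ x₀ y₀ k s‖ ≤ L :=
  norm_batchMean_le hθ.Dg_pos fun _ => (hP.sampleRegular _).norm_jacXY_le hL _ _

/-- Every batch Hessian lies between μ and L, so the decay holds for each realization of the
samples, not only in the mean. -/
lemma norm_resid_le (hM : 0 ≤ M) (hμ : 0 < μ) (hμL : μ ≤ L) (k j : ℕ) (s : Samples Ξ Z) :
    ‖resid P θ μ x₀ y₀ k j s‖ ≤ (1 - θ.η * μ) ^ j * M := by
  have ha := hθ.contr_pos hμ hμL
  induction j with
  | zero => simpa [resid, neumann] using norm_batchFy_le hP hθ hM k s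
  | succ j ih =>
    rw [resid_succ, pow_succ']
    refine ((isHessian_batchH hP hθ hμ hμL k (θ.Q - j) s).norm_sub_smul_le hμL hθ.η_pos.le
      (hθ.eta_mul_add_le hμ hμL) _).trans ?_
    rw [mul_assoc]
    gcongr

/-- Geometric sum: η ∑ (1 − ημ)^j ≤ 1/μ. -/
lemma norm_dirV_le (hM : 0 ≤ M) (hμ : 0 < μ) (hμL : μ ≤ L) (k : ℕ) (s : Samples Ξ Z) :
    ‖dirV P θ μ x₀ y₀ k s‖ ≤ M / μ := by
  have ha := hθ.contr_pos hμ hμL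
  have ha1 := hθ.contr_lt_one hμ
  have hη := hθ.η_pos
  rw [dirV, norm_smul, Real.norm_of_nonneg hη.le]
  have h1 : ‖∑ j ∈ Finset.range (θ.Q + 1), resid P θ μ x₀ y₀ k j s‖
      ≤ ∑ j ∈ Finset.range (θ.Q + 1), (1 - θ.η * μ) ^ j * M :=
    norm_sum_le_of_le _ fun j _ => norm_resid_le hP hθ hM hμ hμL k j s
  rw [← Finset.sum_mul] at h1
  have h2 : ∑ j ∈ Finset.range (θ.Q + 1), (1 - θ.η * μ) ^ j ≤ 1 / (θ.η * μ) := by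
    rw [le_div_iff₀ (by positivity)]
    have := geom_sum_mul_neg (1 - θ.η * μ) (θ.Q + 1)
    rw [sub_sub_cancel] at this
    rw [this]
    have : 0 < (1 - θ.η * μ) ^ (θ.Q + 1) := pow_pos ha _
    linarith
  calc _ ≤ θ.η * (1 / (θ.η * μ) * M) := by
        gcongr; exact h1.trans (by gcongr)
    _ = M / μ := by field_simp

lemma norm_estim_le (hM : 0 ≤ M) (hμ : 0 < μ) (hμL : μ ≤ L) (k : ℕ) (s : Samples Ξ Z) :
    ‖estim P θ μ x₀ y₀ k s‖ ≤ M + L * (M / μ) := by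
  have hL : 0 < L := hμ.trans_le hμL
  refine (norm_sub_le _ _).trans (add_le_add (norm_batchFx_le hP hθ hM k s) ?_)
  exact (ContinuousLinearMap.le_opNorm _ _).trans (mul_le_mul (norm_batchJ_le hP hθ hL.le k s)
    (norm_dirV_le hP hθ hM hμ hμL k s) (norm_nonneg _) hL.le)

/-! Noise of the batches `D_F` and `D_G`. -/

/-- Neither x_k nor y_k^D involves D_F, so this is the variance of a mean of D_f fresh samples of
norm at most M. -/
lemma lintegral_batchFx_sub_le (hM : 0 ≤ M) (k : ℕ) :
    ∫⁻ s, ‖batchFx P θ μ x₀ y₀ k s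
        - P.fx (outerX P θ μ x₀ y₀ k s) (innerY P θ μ x₀ y₀ k θ.D s)‖ₑ ^ 2 ∂P.law
      ≤ ENNReal.ofReal (M ^ 2 / θ.Df) := by
  have := hP.prob_ξ
  have := hP.prob_ζ
  have := hP.isProbabilityMeasure_law
  let 𝔅 := xiBatch P (fun i => (k, i)) fun i j h => by simpa using h
  let X : Samples Ξ Z → Vec p := outerX P θ μ x₀ y₀ k
  let Y : Samples Ξ Z → Vec q := innerY P θ μ x₀ y₀ k θ.D
  have hXm : Measurable X := measurable_outerX hP k
  have hYm : Measurable Y := measurable_innerY hP k θ.D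
  have hXi : ∀ i s a, X (𝔅.R i (s, a)) = X s := fun i s a =>
    outerX_congr (fun j hj _ => xiBatch_R_of_ne _ (by simp; omega) _ _) fun _ _ => rfl
  have hYi : ∀ i s a, Y (𝔅.R i (s, a)) = Y s := fun i s a =>
    innerY_congr (fun j hj _ => xiBatch_R_of_ne _ (by simp; omega) _ _) (fun _ _ => rfl)
      fun _ _ _ => rfl
  have key := FreshBatch.lintegral_add_batchMean_le (𝔅 := 𝔅) (X := fun _ => (0 : Vec p))
    (h := fun s a => gradX (fun w => P.F w a) (X s) (Y s) - P.fx (X s) (Y s))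
    (V := fun _ => ENNReal.ofReal (M ^ 2)) measurable_const (fun i s a => rfl)
    (Measurable.sub (hP.measurable_gradX_F'.comp
        (((hXm.comp measurable_fst).prodMk (hYm.comp measurable_fst)).prodMk measurable_snd))
      ((measurable_fx hP hM).comp ((hXm.prodMk hYm).comp measurable_fst)))
    (fun i s a => by simp only [hXi, hYi])
    (fun s => by
      rw [integral_sub (hP.integrable_gradX_F hM _ _) (integrable_const _)]
      simp [Problem.fx])
    (fun s => hP.variance_gradX_F hM _ _) (fun _ => ENNReal.ofReal_ne_top) hθ.Df_pos
  refine le_trans (le_of_eq ?_) (key.trans (le_of_eq ?_))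
  · refine lintegral_congr fun s => ?_
    rw [batchMean_sub hθ.Df_pos, zero_add]
    rfl
  · rw [show ∫⁻ _ : Samples Ξ Z, ‖(0 : Vec p)‖ₑ ^ 2 ∂P.law = 0 by simp, zero_add,
      lintegral_const, measure_univ, mul_one, ENNReal_inv_natCast hθ.Df_pos,
      ← ENNReal.ofReal_mul (by positivity)]
    rw [one_div, div_eq_inv_mul]

lemma lintegral_batchFy_sub_le (hM : 0 ≤ M) (k : ℕ) :
    ∫⁻ s, ‖batchFy P θ μ x₀ y₀ k s
        - P.fy (outerX P θ μ x₀ y₀ k s) (innerY P θ μ x₀ y₀ k θ.D s)‖ₑ ^ 2 ∂P.law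
      ≤ ENNReal.ofReal (M ^ 2 / θ.Df) := by
  have := hP.prob_ξ
  have := hP.prob_ζ
  have := hP.isProbabilityMeasure_law
  let 𝔅 := xiBatch P (fun i => (k, i)) fun i j h => by simpa using h
  let X : Samples Ξ Z → Vec p := outerX P θ μ x₀ y₀ k
  let Y : Samples Ξ Z → Vec q := innerY P θ μ x₀ y₀ k θ.D
  have hXm : Measurable X := measurable_outerX hP k
  have hYm : Measurable Y := measurable_innerY hP k θ.D
  have hXi : ∀ i s a, X (𝔅.R i (s, a)) = X s := fun i s a =>
    outerX_congr (fun j hj _ => xiBatch_R_of_ne _ (by simp; omega) _ _) fun _ _ => rfl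
  have hYi : ∀ i s a, Y (𝔅.R i (s, a)) = Y s := fun i s a =>
    innerY_congr (fun j hj _ => xiBatch_R_of_ne _ (by simp; omega) _ _) (fun _ _ => rfl)
      fun _ _ _ => rfl
  have key := FreshBatch.lintegral_add_batchMean_le (𝔅 := 𝔅) (X := fun _ => (0 : Vec q))
    (h := fun s a => gradY (fun w => P.F w a) (X s) (Y s) - P.fy (X s) (Y s))
    (V := fun _ => ENNReal.ofReal (M ^ 2)) measurable_const (fun i s a => rfl)
    (Measurable.sub (hP.measurable_gradY_F'.comp
        (((hXm.comp measurable_fst).prodMk (hYm.comp measurable_fst)).prodMk measurable_snd))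
      ((measurable_fy hP hM).comp ((hXm.prodMk hYm).comp measurable_fst)))
    (fun i s a => by simp only [hXi, hYi])
    (fun s => by
      rw [integral_sub (hP.integrable_gradY_F hM _ _) (integrable_const _)]
      simp [Problem.fy])
    (fun s => hP.variance_gradY_F hM _ _) (fun _ => ENNReal.ofReal_ne_top) hθ.Df_pos
  refine le_trans (le_of_eq ?_) (key.trans (le_of_eq ?_))
  · refine lintegral_congr fun s => ?_
    rw [batchMean_sub hθ.Df_pos, zero_add]
    rfl
  · rw [show ∫⁻ _ : Samples Ξ Z, ‖(0 : Vec q)‖ₑ ^ 2 ∂P.law = 0 by simp, zero_add,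
      lintegral_const, measure_univ, mul_one, ENNReal_inv_natCast hθ.Df_pos,
      ← ENNReal.ofReal_mul (by positivity)]
    rw [one_div, div_eq_inv_mul]

end Bounds

section Bounds

variable {p q : ℕ} {Ξ Z : Type*} [MeasurableSpace Ξ] [MeasurableSpace Z]
  {P : Problem p q Ξ Z} {θ : Params} {L M τ ρ μ σ : ℝ} {x₀ : Vec p} {y₀ : Vec q}
  (hP : P.Assumptions L M τ ρ μ σ) (hθ : θ.IsTuned L M τ ρ μ)
include hP hθ

/-- v_Q depends on D_F and on the Hessian batches but not on D_G, and its norm is at most M/μ. -/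
lemma lintegral_batchJ_sub_le (hM : 0 ≤ M) (hμ : 0 < μ) (hμL : μ ≤ L) (k : ℕ) :
    ∫⁻ s, ‖batchJ P θ μ x₀ y₀ k s (dirV P θ μ x₀ y₀ k s)
        - P.jac (outerX P θ μ x₀ y₀ k s) (innerY P θ μ x₀ y₀ k θ.D s)
          (dirV P θ μ x₀ y₀ k s)‖ₑ ^ 2 ∂P.law
      ≤ ENNReal.ofReal ((L * (M / μ)) ^ 2 / θ.Dg) := by
  have := hP.prob_ξ
  have := hP.prob_ζ
  have := hP.isProbabilityMeasure_law
  have hL : 0 < L := hμ.trans_le hμL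
  let 𝔅 := zetaBatch P (fun i => .jac k i) fun i j h => by simpa using h
  let X : Samples Ξ Z → Vec p := outerX P θ μ x₀ y₀ k
  let Y : Samples Ξ Z → Vec q := innerY P θ μ x₀ y₀ k θ.D
  let W : Samples Ξ Z → Vec q := dirV P θ μ x₀ y₀ k
  have hXm : Measurable X := measurable_outerX hP k
  have hYm : Measurable Y := measurable_innerY hP k θ.D
  have hWm : Measurable W := measurable_dirV hP k
  have hout : ∀ i a (s : Samples Ξ Z) (d : GDraw), d.outer < k →
      (𝔅.R i (s, a)).2 d = s.2 d := fun i a s d hd =>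
    zetaBatch_R_of_ne _ (by rintro rfl; simp [GDraw.outer] at hd) _ _
  have hin : ∀ i a (s : Samples Ξ Z) (t j : ℕ),
      (𝔅.R i (s, a)).2 (.inner k t j) = s.2 (.inner k t j) := fun i a s t j =>
    zetaBatch_R_of_ne _ (by simp) _ _
  have hXi : ∀ i s a, X (𝔅.R i (s, a)) = X s := fun i s a =>
    outerX_congr (fun _ _ _ => rfl) (hout i a s)
  have hYi : ∀ i s a, Y (𝔅.R i (s, a)) = Y s := fun i s a =>
    innerY_congr (fun _ _ _ => rfl) (hout i a s) fun t _ j => hin i a s t j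
  have hWi : ∀ i s a, W (𝔅.R i (s, a)) = W s := fun i s a =>
    dirV_congr (fun _ _ _ => rfl) (hout i a s) (hin i a s)
      fun j i' => zetaBatch_R_of_ne _ (by simp) _ _
  have hJ1 : Measurable fun z : Samples Ξ Z × Z =>
      jacXY (fun w => P.G w z.2) (X z.1) (Y z.1) (W z.1) :=
    measurable_clm_apply (T := fun z : Samples Ξ Z × Z => jacXY (fun w => P.G w z.2) (X z.1) (Y z.1))
      (v := fun z => W z.1)
      (measurable_jac_comp hP (hXm.comp measurable_fst) (hYm.comp measurable_fst) measurable_snd)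
      (hWm.comp measurable_fst)
  have hJ2 : Measurable fun s => P.jac (X s) (Y s) (W s) :=
    measurable_clm_apply (T := fun s => P.jac (X s) (Y s)) (v := W)
      (Measurable.comp (g := fun z : Vec p × Vec q => P.jac z.1 z.2) (f := fun s => (X s, Y s))
        (measurable_jac hP hL.le) (hXm.prodMk hYm)) hWm
  have key := FreshBatch.lintegral_add_batchMean_le (𝔅 := 𝔅) (X := fun _ => (0 : Vec p))
    (h := fun s a => jacXY (fun w => P.G w a) (X s) (Y s) (W s) - P.jac (X s) (Y s) (W s))
    (V := fun _ => ENNReal.ofReal ((L * (M / μ)) ^ 2)) measurable_const (fun i s a => rfl)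
    (hJ1.sub (hJ2.comp measurable_fst))
    (fun i s a => by simp only [hXi, hYi, hWi])
    (fun s => by
      rw [integral_sub (hP.integrable_jacXY_apply hL.le _ _ _) (integrable_const _),
        hP.jac_apply hL.le]
      simp)
    (fun s => hP.variance_jacXY hL.le _ _ _ (norm_dirV_le hP hθ hM hμ hμL k s))
    (fun _ => ENNReal.ofReal_ne_top) hθ.Dg_pos
  refine le_trans (le_of_eq ?_) (key.trans (le_of_eq ?_))
  · refine lintegral_congr fun s => ?_
    rw [batchMean_sub hθ.Dg_pos, zero_add, batchJ, batchMean_apply]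
    rfl
  · rw [show ∫⁻ _ : Samples Ξ Z, ‖(0 : Vec p)‖ₑ ^ 2 ∂P.law = 0 by simp, zero_add,
      lintegral_const, measure_univ, mul_one, ENNReal_inv_natCast hθ.Dg_pos,
      ← ENNReal.ofReal_mul (by positivity)]
    congr 1
    ring

end Bounds

/-! ### Accumulated sampling error of the Hessian batches -/

section HessianNoise

variable {p q : ℕ} {Ξ Z : Type*} [MeasurableSpace Ξ] [MeasurableSpace Z]

section Defs

variable (P : Problem p q Ξ Z) (θ : Params) (μ : ℝ) (x₀ : Vec p) (y₀ : Vec q)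

/-- Accumulated error `∑_{j<i} (∇_y²g - ∇_y²G(·; B_{Q-j})) r_{Q-j}` of the Hessian batches. -/
def hessErr (k i : ℕ) (s : Samples Ξ Z) : Vec q :=
  ∑ j ∈ Finset.range i,
    (P.hess (outerX P θ μ x₀ y₀ k s) (innerY P θ μ x₀ y₀ k θ.D s) (resid P θ μ x₀ y₀ k j s)
      - batchH P θ μ x₀ y₀ k (θ.Q - j) s (resid P θ μ x₀ y₀ k j s))

/-- `∇_y²G(x_k, y_k^D; ζ) r_{Q-j}`. -/
def hessResid (k j : ℕ) (s : Samples Ξ Z) (a : Z) : Vec q :=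
  hessY (fun w => P.G w a) (outerX P θ μ x₀ y₀ k s) (innerY P θ μ x₀ y₀ k θ.D s)
    (resid P θ μ x₀ y₀ k j s)

/-- `E ⟨∇_y²G(x_k, y_k^D; ζ) r_{Q-j}, r_{Q-j}⟩`. -/
def energy (k j : ℕ) : ENNReal :=
  ∫⁻ s, ∫⁻ a, ENNReal.ofReal (inner ℝ (hessResid P θ μ x₀ y₀ k j s a) (resid P θ μ x₀ y₀ k j s))
    ∂P.lawζ ∂P.law

end Defs

variable {P : Problem p q Ξ Z} {θ : Params} {L M τ ρ μ σ : ℝ} {x₀ : Vec p} {y₀ : Vec q}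
  (hP : P.Assumptions L M τ ρ μ σ) (hθ : θ.IsTuned L M τ ρ μ)
include hP

lemma measurable_hessResid (k j : ℕ) :
    Measurable (Function.uncurry (hessResid P θ μ x₀ y₀ k j)) := by
  have h : Measurable fun z : Samples Ξ Z × Z => hessY (fun w => P.G w z.2)
      (outerX P θ μ x₀ y₀ k z.1) (innerY P θ μ x₀ y₀ k θ.D z.1) :=
    hP.measurable_hessY_G'.comp
      ((((measurable_outerX hP k).comp measurable_fst).prodMk
        ((measurable_innerY hP k θ.D).comp measurable_fst)).prodMk measurable_snd)
  exact measurable_clm_apply h ((measurable_resid hP k j).comp measurable_fst)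

lemma measurable_hess_resid (hL : 0 ≤ L) (k j : ℕ) : Measurable fun s =>
    P.hess (outerX P θ μ x₀ y₀ k s) (innerY P θ μ x₀ y₀ k θ.D s) (resid P θ μ x₀ y₀ k j s) :=
  measurable_clm_apply ((measurable_hess hP hL).comp (measurable_position hP k))
    (measurable_resid hP k j)

lemma measurable_hessErr (hL : 0 ≤ L) (k i : ℕ) : Measurable (hessErr P θ μ x₀ y₀ k i) :=
  Finset.measurable_sum _ fun j _ => (measurable_hess_resid hP hL k j).sub
    (measurable_clm_apply (measurable_batchH hP k (θ.Q - j)) (measurable_resid hP k j))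

include hθ

/-- The batch B_{Q−j} is fresh with respect to both the accumulated error and r_{Q−j}, so second
moments add. The variance is measured by the energy, which the iteration dissipates, rather than by
L²‖r‖²; the weight is the reciprocal of the batch size. -/
lemma lintegral_hessErr_succ_le (hμ : 0 < μ) (hμL : μ ≤ L) (k : ℕ) {j : ℕ}
    (hj : j < θ.Q) :
    ∫⁻ s, ‖hessErr P θ μ x₀ y₀ k (j + 1) s‖ₑ ^ 2 ∂P.law
      ≤ ∫⁻ s, ‖hessErr P θ μ x₀ y₀ k j s‖ₑ ^ 2 ∂P.law
        + ENNReal.ofReal (L / (θ.B * θ.Q) / (1 - θ.η * μ) ^ j) * energy P θ μ x₀ y₀ k j := by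
  have := hP.prob_ξ
  have := hP.prob_ζ
  have := hP.isProbabilityMeasure_law
  have hL : 0 < L := hμ.trans_le hμL
  have ha := hθ.contr_pos hμ hμL
  have hQ : (0 : ℝ) < θ.Q := by exact_mod_cast hθ.Q_pos
  have hB := hθ.B_pos hμ hμL
  let 𝔅 := zetaBatch P (fun i => .hess k (θ.Q - j) i) fun i j h => by simpa using h
  have hout : ∀ i a (s : Samples Ξ Z) (d : GDraw), d.outer < k →
      (𝔅.R i (s, a)).2 d = s.2 d := fun i a s d hd =>
    zetaBatch_R_of_ne _ (by rintro rfl; simp [GDraw.outer] at hd) _ _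
  have hin : ∀ i a (s : Samples Ξ Z) (t j : ℕ),
      (𝔅.R i (s, a)).2 (.inner k t j) = s.2 (.inner k t j) := fun i a s t j =>
    zetaBatch_R_of_ne _ (by simp) _ _
  -- Since j < Q, the truncated subtraction gives Q − j' ≠ Q − j for j' < j: earlier steps used
  -- other batches.
  have hh : ∀ i a (s : Samples Ξ Z), ∀ j' < j, ∀ i',
      (𝔅.R i (s, a)).2 (.hess k (θ.Q - j') i') = s.2 (.hess k (θ.Q - j') i') :=
    fun i a s j' hj' i' => zetaBatch_R_of_ne _ (by simp; omega) _ _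
  have hXi : ∀ i s a, outerX P θ μ x₀ y₀ k (𝔅.R i (s, a)) = outerX P θ μ x₀ y₀ k s :=
    fun i s a => outerX_congr (fun _ _ _ => rfl) (hout i a s)
  have hYi : ∀ i s a, innerY P θ μ x₀ y₀ k θ.D (𝔅.R i (s, a)) = innerY P θ μ x₀ y₀ k θ.D s :=
    fun i s a => innerY_congr (fun _ _ _ => rfl) (hout i a s) fun t _ j => hin i a s t j
  have hri : ∀ i s a, ∀ j' ≤ j,
      resid P θ μ x₀ y₀ k j' (𝔅.R i (s, a)) = resid P θ μ x₀ y₀ k j' s :=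
    fun i s a j' hj' => resid_congr (s := 𝔅.R i (s, a)) (s' := s) (fun _ _ _ => rfl)
      (hout i a s) (hin i a s) fun j'' hj'' => hh i a s j'' (by omega)
  have hEi : ∀ i s a, hessErr P θ μ x₀ y₀ k j (𝔅.R i (s, a)) = hessErr P θ μ x₀ y₀ k j s := by
    intro i s a
    refine Finset.sum_congr rfl fun j' hj' => ?_
    have hj' := Finset.mem_range.1 hj'
    rw [batchH, batchH]
    simp only [hXi, hYi, hri i s a j' hj'.le, hh i a s j' hj']
  have hHi : ∀ i s a, hessResid P θ μ x₀ y₀ k j (𝔅.R i (s, a)) = hessResid P θ μ x₀ y₀ k j s := by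
    intro i s a
    funext b
    simp only [hessResid, hXi, hYi, hri i s a j le_rfl]
  have key := FreshBatch.lintegral_add_batchMean_le (𝔅 := 𝔅) (X := hessErr P θ μ x₀ y₀ k j)
    (h := fun s a => (-1 : ℝ) • (hessResid P θ μ x₀ y₀ k j s a
      - P.hess (outerX P θ μ x₀ y₀ k s) (innerY P θ μ x₀ y₀ k θ.D s) (resid P θ μ x₀ y₀ k j s)))
    (V := fun s => ENNReal.ofReal L * ∫⁻ a, ENNReal.ofReal
      (inner ℝ (hessResid P θ μ x₀ y₀ k j s a) (resid P θ μ x₀ y₀ k j s)) ∂P.lawζ)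
    (measurable_hessErr hP hL.le k j) hEi
    (measurable_smul_fun _ ((measurable_hessResid hP k j).sub
      ((measurable_hess_resid hP hL.le k j).comp measurable_fst)))
    (fun i s a => by simp only [hHi, hXi, hYi, hri i s a j le_rfl])
    (fun s => by
      simp only [hessResid]
      rw [integral_smul, integral_sub (hP.integrable_hessY_apply hL.le _ _ _)
        (integrable_const _), hP.hess_apply hL.le]
      simp)
    (fun s => by
      simp only [enorm_smul, enorm_neg, enorm_one, one_mul]
      exact hP.variance_hessY hμ.le hL.le _ _ _)
    (fun s => by
      refine ENNReal.mul_ne_top ENNReal.ofReal_ne_top (ne_top_of_le_ne_top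
        (b := ∫⁻ _, ENNReal.ofReal (L * ‖resid P θ μ x₀ y₀ k j s‖ ^ 2) ∂P.lawζ) (by simp)
        (lintegral_mono fun a => ENNReal.ofReal_le_ofReal ?_))
      exact (hP.sampleRegular a).inner_hessY_le hL.le _ _ _)
    (hθ.one_le_hessBatch hμ hμL (θ.Q - j))
  refine le_trans (le_of_eq ?_) (key.trans ?_)
  · refine lintegral_congr fun s => ?_
    rw [batchMean_smul_sub (hθ.one_le_hessBatch hμ hμL (θ.Q - j)), hessErr,
      Finset.sum_range_succ]
    congr 2
    rw [neg_one_smul, neg_sub, batchH, batchMean_apply]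
    rfl
  · refine add_le_add le_rfl ?_
    rw [lintegral_const_mul' _ _ ENNReal.ofReal_ne_top, ← mul_assoc,
      ENNReal_inv_natCast (hθ.one_le_hessBatch hμ hμL (θ.Q - j)),
      ← ENNReal.ofReal_mul (by positivity)]
    refine mul_le_mul' (ENNReal.ofReal_le_ofReal ?_) le_rfl
    have h1 := Params.le_hessBatch (θ := θ) (μ := μ) hj.le
    have h2 : (0 : ℝ) < θ.B * θ.Q * (1 - θ.η * μ) ^ j := by positivity
    calc _ ≤ 1 / (θ.B * θ.Q * (1 - θ.η * μ) ^ j) * L := by gcongr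
      _ = _ := by field_simp

/-- Dissipation for the batch Hessian, in the mean. As r_{Q−j} does not depend on B_{Q−j}, every
sample of the batch has the same expected energy. -/
lemma lintegral_resid_succ_add_le (hμ : 0 < μ) (hμL : μ ≤ L) (k : ℕ) {j : ℕ} (hj : j < θ.Q) :
    ∫⁻ s, ‖resid P θ μ x₀ y₀ k (j + 1) s‖ₑ ^ 2 ∂P.law
        + ENNReal.ofReal θ.η * energy P θ μ x₀ y₀ k j
      ≤ ∫⁻ s, ‖resid P θ μ x₀ y₀ k j s‖ₑ ^ 2 ∂P.law := by
  have := hP.prob_ξ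
  have := hP.prob_ζ
  have := hP.isProbabilityMeasure_law
  have hL : 0 < L := hμ.trans_le hμL
  have hn := hθ.one_le_hessBatch hμ hμL (θ.Q - j)
  let 𝔅 := zetaBatch P (fun i => .hess k (θ.Q - j) i) fun i j h => by simpa using h
  have hout : ∀ i a (s : Samples Ξ Z) (d : GDraw), d.outer < k →
      (𝔅.R i (s, a)).2 d = s.2 d := fun i a s d hd =>
    zetaBatch_R_of_ne _ (by rintro rfl; simp [GDraw.outer] at hd) _ _
  have hin : ∀ i a (s : Samples Ξ Z) (t j : ℕ),
      (𝔅.R i (s, a)).2 (.inner k t j) = s.2 (.inner k t j) := fun i a s t j =>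
    zetaBatch_R_of_ne _ (by simp) _ _
  have hinv : 𝔅.Invariant fun s a => ENNReal.ofReal
      (inner ℝ (hessResid P θ μ x₀ y₀ k j s a) (resid P θ μ x₀ y₀ k j s)) := by
    intro i s a
    have hr : resid P θ μ x₀ y₀ k j (𝔅.R i (s, a)) = resid P θ μ x₀ y₀ k j s :=
      resid_congr (s := 𝔅.R i (s, a)) (s' := s) (fun _ _ _ => rfl) (hout i a s) (hin i a s)
        fun j' hj' i' => zetaBatch_R_of_ne _ (by simp; omega) _ _
    have hX : outerX P θ μ x₀ y₀ k (𝔅.R i (s, a)) = outerX P θ μ x₀ y₀ k s :=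
      outerX_congr (fun _ _ _ => rfl) (hout i a s)
    have hY : innerY P θ μ x₀ y₀ k θ.D (𝔅.R i (s, a)) = innerY P θ μ x₀ y₀ k θ.D s :=
      innerY_congr (fun _ _ _ => rfl) (hout i a s) fun t _ j => hin i a s t j
    simp only [hessResid, hr, hX, hY]
  have hmeas : Measurable (Function.uncurry fun s a => ENNReal.ofReal
      (inner ℝ (hessResid P θ μ x₀ y₀ k j s a) (resid P θ μ x₀ y₀ k j s))) :=
    ((measurable_hessResid hP k j).inner
      ((measurable_resid hP k j).comp measurable_fst)).ennreal_ofReal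
  have hpos : ∀ s a, 0 ≤ inner ℝ (hessResid P θ μ x₀ y₀ k j s a) (resid P θ μ x₀ y₀ k j s) :=
    fun s a => (by positivity : 0 ≤ μ * ‖resid P θ μ x₀ y₀ k j s‖ ^ 2).trans
      ((hP.sampleRegular a).le_inner_hessY _ _ _)
  have hE : ∫⁻ s, ENNReal.ofReal (inner ℝ (batchH P θ μ x₀ y₀ k (θ.Q - j) s
      (resid P θ μ x₀ y₀ k j s)) (resid P θ μ x₀ y₀ k j s)) ∂P.law = energy P θ μ x₀ y₀ k j := by
    have e : ∀ s, ENNReal.ofReal (inner ℝ (batchH P θ μ x₀ y₀ k (θ.Q - j) s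
        (resid P θ μ x₀ y₀ k j s)) (resid P θ μ x₀ y₀ k j s))
        = (θ.hessBatch μ (θ.Q - j) : ENNReal)⁻¹ * ∑ i ∈ Finset.range (θ.hessBatch μ (θ.Q - j)),
          ENNReal.ofReal (inner ℝ (hessResid P θ μ x₀ y₀ k j s (𝔅.c i s))
            (resid P θ μ x₀ y₀ k j s)) := by
      intro s
      rw [ENNReal_inv_natCast hn, ← ENNReal.ofReal_sum_of_nonneg fun i _ => hpos _ _,
        ← ENNReal.ofReal_mul (by positivity), batchH, inner_batchMean]
      rfl
    have hmc : ∀ i ∈ Finset.range (θ.hessBatch μ (θ.Q - j)), Measurable fun s => ENNReal.ofReal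
        (inner ℝ (hessResid P θ μ x₀ y₀ k j s (𝔅.c i s)) (resid P θ μ x₀ y₀ k j s)) :=
      fun i _ => Measurable.comp (f := fun s => (s, 𝔅.c i s)) hmeas
        (measurable_id.prodMk (𝔅.measurable_c i))
    simp only [e]
    rw [lintegral_const_mul' _ _ (by simp; omega), lintegral_finsetSum _ hmc]
    have e2 : ∀ i ∈ Finset.range (θ.hessBatch μ (θ.Q - j)),
        ∫⁻ s, ENNReal.ofReal (inner ℝ (hessResid P θ μ x₀ y₀ k j s (𝔅.c i s))
            (resid P θ μ x₀ y₀ k j s)) ∂P.law = energy P θ μ x₀ y₀ k j := fun i _ =>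
      FreshBatch.lintegral_sample (𝔅 := 𝔅) hmeas hinv i
    rw [Finset.sum_congr rfl e2, Finset.sum_const, Finset.card_range, nsmul_eq_mul, ← mul_assoc,
      ENNReal.inv_mul_cancel (by simp; omega) (by simp), one_mul]
  rw [← hE, ← lintegral_const_mul' _ _ ENNReal.ofReal_ne_top, ← lintegral_add_left
    ((measurable_resid hP k (j + 1)).enorm.pow_const 2)]
  refine lintegral_mono fun s => ?_
  simp only
  have hT := isHessian_batchH (x₀ := x₀) (y₀ := y₀) hP hθ hμ hμL k (θ.Q - j) s
  have h := hT.norm_sub_smul_sq_add_le hμ.le hL.le hθ.η_pos.le (hθ.eta_mul_L_lt hL).le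
    (resid P θ μ x₀ y₀ k j s)
  rw [norm_sq_eq_enorm, norm_sq_eq_enorm, ← ENNReal.ofReal_mul hθ.η_pos.le,
    ← ENNReal.ofReal_add (by positivity) (mul_nonneg hθ.η_pos.le
      ((by positivity : 0 ≤ μ * ‖resid P θ μ x₀ y₀ k j s‖ ^ 2).trans (hT.ge _))), resid_succ]
  exact ENNReal.ofReal_le_ofReal h

/-- The two recursions are combined by `weighted_dissipation_le` with c = L/(BQ), after all moments
are seen to be finite. The remaining factor ηL is below 1. -/
lemma lintegral_hessErr_le (hM : 0 ≤ M) (hμ : 0 < μ) (hμL : μ ≤ L) (k : ℕ) :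
    ∫⁻ s, ‖θ.η • hessErr P θ μ x₀ y₀ k θ.Q s‖ₑ ^ 2 ∂P.law
      ≤ ENNReal.ofReal (2 * M ^ 2 / (θ.B * θ.Q)) := by
  have := hP.isProbabilityMeasure_law
  have hL : 0 < L := hμ.trans_le hμL
  have ha := hθ.contr_pos hμ hμL
  have hQ : (0 : ℝ) < θ.Q := by exact_mod_cast hθ.Q_pos
  have hB := hθ.B_pos hμ hμL
  have hη := hθ.η_pos
  set m : ℕ → ENNReal := fun j => ∫⁻ s, ‖resid P θ μ x₀ y₀ k j s‖ₑ ^ 2 ∂P.law with hm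
  set A : ℕ → ENNReal := fun j => ∫⁻ s, ‖hessErr P θ μ x₀ y₀ k j s‖ₑ ^ 2 ∂P.law with hA
  have hmle : ∀ j, m j ≤ ENNReal.ofReal ((1 - θ.η * μ) ^ (2 * j) * M ^ 2) := fun j => by
    refine (Problem.Assumptions.lintegral_enorm_sq_le_of_norm_le (norm_resid_le hP hθ hM hμ hμL k j)).trans ?_
    rw [mul_pow, ← pow_mul, mul_comm j 2]
  have hmt : ∀ j, m j ≠ ⊤ := fun j => ne_top_of_le_ne_top ENNReal.ofReal_ne_top (hmle j)
  have hstep : ∀ j < θ.Q, m (j + 1) + ENNReal.ofReal θ.η * energy P θ μ x₀ y₀ k j ≤ m j :=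
    fun j hj => lintegral_resid_succ_add_le hP hθ hμ hμL k hj
  have hEt : ∀ j < θ.Q, energy P θ μ x₀ y₀ k j ≠ ⊤ := by
    intro j hj h
    have := hstep j hj
    rw [h, ENNReal.mul_top (by simpa using hη), add_top] at this
    exact hmt j (top_le_iff.1 this)
  have hAstep : ∀ j < θ.Q, A (j + 1) ≤ A j
      + ENNReal.ofReal (L / (θ.B * θ.Q) / (1 - θ.η * μ) ^ j) * energy P θ μ x₀ y₀ k j :=
    fun j hj => lintegral_hessErr_succ_le hP hθ hμ hμL k hj
  have hA0 : A 0 = 0 := by simp [hA, hessErr]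
  have hAt : ∀ j ≤ θ.Q, A j ≠ ⊤ := by
    intro j
    induction j with
    | zero => simp [hA0]
    | succ j ih =>
      intro hj
      exact ne_top_of_le_ne_top (ENNReal.add_ne_top.2 ⟨ih (by omega),
        ENNReal.mul_ne_top ENNReal.ofReal_ne_top (hEt j (by omega))⟩) (hAstep j (by omega))
  have key := weighted_dissipation_le (a := 1 - θ.η * μ) (M := M) (η := θ.η)
    (c := L / (θ.B * θ.Q)) (m := fun j => (m j).toReal)
    (w := fun j => (energy P θ μ x₀ y₀ k j).toReal) (A := fun j => (A j).toReal) (Q := θ.Q)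
    ha (hθ.contr_lt_one hμ).le (by positivity) hη.le
    (fun j => ENNReal.toReal_le_of_le_ofReal (by positivity) (hmle j))
    (fun j hj => by
      have h := ENNReal.toReal_mono (hmt j) (hstep j hj)
      rwa [ENNReal.toReal_add (hmt _) (ENNReal.mul_ne_top ENNReal.ofReal_ne_top (hEt j hj)),
        ENNReal.toReal_mul, ENNReal.toReal_ofReal hη.le] at h)
    (by simp [hA0])
    (fun j hj => by
      have ht := ENNReal.mul_ne_top (a := ENNReal.ofReal (L / (θ.B * θ.Q) / (1 - θ.η * μ) ^ j))
        ENNReal.ofReal_ne_top (hEt j hj)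
      have h := ENNReal.toReal_mono (ENNReal.add_ne_top.2 ⟨hAt j hj.le, ht⟩) (hAstep j hj)
      rw [ENNReal.toReal_add (hAt j hj.le) ht, ENNReal.toReal_mul,
        ENNReal.toReal_ofReal (by positivity)] at h
      refine h.trans (le_of_eq ?_)
      ring)
    le_rfl
  have e : ∀ s, ‖θ.η • hessErr P θ μ x₀ y₀ k θ.Q s‖ₑ ^ 2
      = ENNReal.ofReal (θ.η ^ 2) * ‖hessErr P θ μ x₀ y₀ k θ.Q s‖ₑ ^ 2 := fun s => by
    rw [norm_sq_eq_enorm, norm_sq_eq_enorm, norm_smul, mul_pow, Real.norm_of_nonneg hη.le,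
      ENNReal.ofReal_mul (by positivity)]
  simp only [e]
  rw [lintegral_const_mul' _ _ ENNReal.ofReal_ne_top]
  change _ * A θ.Q ≤ _
  rw [← ENNReal.ofReal_toReal (hAt θ.Q le_rfl), ← ENNReal.ofReal_mul (by positivity)]
  refine ENNReal.ofReal_le_ofReal ?_
  have h1 : 0 ≤ L / (θ.B * θ.Q) * ((m θ.Q).toReal / (1 - θ.η * μ) ^ θ.Q) := by positivity
  have h2 : θ.η * (A θ.Q).toReal ≤ L / (θ.B * θ.Q) * (M ^ 2 * 2) := by
    have h3 : L / (θ.B * θ.Q) * (M ^ 2 * (2 - (1 - θ.η * μ) ^ θ.Q))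
        ≤ L / (θ.B * θ.Q) * (M ^ 2 * 2) := by
      gcongr
      linarith [pow_pos ha θ.Q]
    linarith
  calc θ.η ^ 2 * (A θ.Q).toReal = θ.η * (θ.η * (A θ.Q).toReal) := by ring
    _ ≤ θ.η * (L / (θ.B * θ.Q) * (M ^ 2 * 2)) := by gcongr
    _ = (θ.η * L) * (2 * M ^ 2 / (θ.B * θ.Q)) := by ring
    _ ≤ 1 * (2 * M ^ 2 / (θ.B * θ.Q)) := by
      gcongr
      exact (hθ.eta_mul_L_lt hL).le
    _ = _ := one_mul _

end HessianNoise

/-! ### Mean square error of the hypergradient estimate -/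

/-- Bound for the mean square error of the hypergradient estimate at the point where it is
computed. -/
def Params.noise (θ : Params) (L M μ : ℝ) : ℝ :=
  10 * M ^ 2 * (L / μ) ^ 2
    * (1 / θ.Df + 1 / θ.Dg + (1 - θ.η * μ) ^ (2 * θ.Q) + 1 / (θ.B * θ.Q))

section Noise

variable {p q : ℕ} {Ξ Z : Type*} [MeasurableSpace Ξ] [MeasurableSpace Z]
  {P : Problem p q Ξ Z} {θ : Params} {L M τ ρ μ σ : ℝ} {x₀ : Vec p} {y₀ : Vec q}
  (hP : P.Assumptions L M τ ρ μ σ) (hθ : θ.IsTuned L M τ ρ μ)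

/-- From r_{i−1} = r_i − ηH_i r_i one gets ηH r_i = r_i − r_{i−1} + η(H − H_i) r_i, which
telescopes. The sum in v_Q has one term more than there are batches, which leaves (I − ηH) r_0. -/
lemma hess_dirV (k : ℕ) (s : Samples Ξ Z) :
    P.hess (outerX P θ μ x₀ y₀ k s) (innerY P θ μ x₀ y₀ k θ.D s) (dirV P θ μ x₀ y₀ k s)
      = batchFy P θ μ x₀ y₀ k s + θ.η • hessErr P θ μ x₀ y₀ k θ.Q s
        - (resid P θ μ x₀ y₀ k θ.Q s - θ.η • P.hess (outerX P θ μ x₀ y₀ k s)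
          (innerY P θ μ x₀ y₀ k θ.D s) (resid P θ μ x₀ y₀ k θ.Q s)) := by
  set H := P.hess (outerX P θ μ x₀ y₀ k s) (innerY P θ μ x₀ y₀ k θ.D s) with hH
  have h : ∀ n, θ.η • ∑ j ∈ Finset.range n, H (resid P θ μ x₀ y₀ k j s)
      = batchFy P θ μ x₀ y₀ k s + θ.η • hessErr P θ μ x₀ y₀ k n s
        - resid P θ μ x₀ y₀ k n s := by
    intro n
    induction n with
    | zero => simp [hessErr, resid, neumann]
    | succ n ih =>
      rw [Finset.sum_range_succ, smul_add, ih, resid_succ, hessErr, hessErr,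
        Finset.sum_range_succ, ← hH]
      module
  rw [dirV, map_smul, map_sum, Finset.sum_range_succ, smul_add, h]
  abel

include hP hθ

/-- Comparison of residuals: `sol` solves the system exactly, v_Q up to the errors in `hess_dirV`,
and the operator is bounded below by μ. -/
lemma mul_norm_dirV_sub_sol_le (hM : 0 ≤ M) (hμ : 0 < μ) (hμL : μ ≤ L) (k : ℕ)
    (s : Samples Ξ Z) :
    μ * ‖dirV P θ μ x₀ y₀ k s
        - P.sol (outerX P θ μ x₀ y₀ k s) (innerY P θ μ x₀ y₀ k θ.D s)‖
      ≤ ‖batchFy P θ μ x₀ y₀ k s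
          - P.fy (outerX P θ μ x₀ y₀ k s) (innerY P θ μ x₀ y₀ k θ.D s)‖
        + (1 - θ.η * μ) ^ θ.Q * M + ‖θ.η • hessErr P θ μ x₀ y₀ k θ.Q s‖ := by
  have ha := hθ.contr_pos hμ hμL
  have h := hP.mul_norm_le_norm_hess hμ hμL (outerX P θ μ x₀ y₀ k s)
    (innerY P θ μ x₀ y₀ k θ.D s) (dirV P θ μ x₀ y₀ k s
      - P.sol (outerX P θ μ x₀ y₀ k s) (innerY P θ μ x₀ y₀ k θ.D s))
  rw [map_sub, hP.hess_sol hμ hμL, hess_dirV] at h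
  refine h.trans ?_
  have h2 := hP.norm_sub_smul_hess_le hμL hμ.le hθ.η_pos.le (hθ.eta_mul_add_le hμ hμL)
    (outerX P θ μ x₀ y₀ k s) (innerY P θ μ x₀ y₀ k θ.D s) (resid P θ μ x₀ y₀ k θ.Q s)
  have h3 : (1 - θ.η * μ) * ‖resid P θ μ x₀ y₀ k θ.Q s‖ ≤ 1 * ((1 - θ.η * μ) ^ θ.Q * M) :=
    mul_le_mul (hθ.contr_lt_one hμ).le (norm_resid_le hP hθ hM hμ hμL k θ.Q s) (norm_nonneg _)
      zero_le_one
  rw [sub_right_comm, add_sub_right_comm]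
  have h4 := (norm_sub_le (batchFy P θ μ x₀ y₀ k s
    - P.fy (outerX P θ μ x₀ y₀ k s) (innerY P θ μ x₀ y₀ k θ.D s)
    + θ.η • hessErr P θ μ x₀ y₀ k θ.Q s) _).trans (add_le_add (norm_add_le _ _) h2)
  linarith

lemma norm_estim_sub_hyper_sq_le (hM : 0 ≤ M) (hμ : 0 < μ) (hμL : μ ≤ L) (k : ℕ)
    (s : Samples Ξ Z) :
    ‖estim P θ μ x₀ y₀ k s
        - P.hyper (outerX P θ μ x₀ y₀ k s) (innerY P θ μ x₀ y₀ k θ.D s)‖ ^ 2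
      ≤ 5 * ‖batchFx P θ μ x₀ y₀ k s
            - P.fx (outerX P θ μ x₀ y₀ k s) (innerY P θ μ x₀ y₀ k θ.D s)‖ ^ 2
        + 5 * ‖batchJ P θ μ x₀ y₀ k s (dirV P θ μ x₀ y₀ k s)
            - P.jac (outerX P θ μ x₀ y₀ k s) (innerY P θ μ x₀ y₀ k θ.D s)
              (dirV P θ μ x₀ y₀ k s)‖ ^ 2
        + 5 * (L / μ) ^ 2 * ‖batchFy P θ μ x₀ y₀ k s
            - P.fy (outerX P θ μ x₀ y₀ k s) (innerY P θ μ x₀ y₀ k θ.D s)‖ ^ 2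
        + 5 * (L / μ) ^ 2 * ((1 - θ.η * μ) ^ (2 * θ.Q) * M ^ 2)
        + 5 * (L / μ) ^ 2 * ‖θ.η • hessErr P θ μ x₀ y₀ k θ.Q s‖ ^ 2 := by
  have hL : 0 < L := hμ.trans_le hμL
  have ha := hθ.contr_pos hμ hμL
  have h0 := mul_norm_dirV_sub_sol_le (x₀ := x₀) (y₀ := y₀) hP hθ hM hμ hμL k s
  set X := outerX P θ μ x₀ y₀ k s
  set Y := innerY P θ μ x₀ y₀ k θ.D s
  set v := dirV P θ μ x₀ y₀ k s
  set e1 := ‖batchFx P θ μ x₀ y₀ k s - P.fx X Y‖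
  set e2 := ‖batchJ P θ μ x₀ y₀ k s v - P.jac X Y v‖
  set e3 := ‖batchFy P θ μ x₀ y₀ k s - P.fy X Y‖
  set e4 := ‖θ.η • hessErr P θ μ x₀ y₀ k θ.Q s‖
  have e : estim P θ μ x₀ y₀ k s - P.hyper X Y
      = (batchFx P θ μ x₀ y₀ k s - P.fx X Y) - (batchJ P θ μ x₀ y₀ k s v - P.jac X Y v)
        - P.jac X Y (v - P.sol X Y) := by
    rw [estim, Problem.hyper, map_sub]
    abel
  have h1 : ‖P.jac X Y (v - P.sol X Y)‖
      ≤ L / μ * (e3 + (1 - θ.η * μ) ^ θ.Q * M + e4) := by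
    refine ((ContinuousLinearMap.le_opNorm _ _).trans (mul_le_mul_of_nonneg_right
      (hP.norm_jac_le hL.le X Y) (norm_nonneg _))).trans ?_
    rw [div_mul_eq_mul_div, mul_div_assoc]
    gcongr
    rw [le_div_iff₀ hμ, mul_comm]
    exact h0
  have h2 : ‖estim P θ μ x₀ y₀ k s - P.hyper X Y‖
      ≤ e1 + e2 + L / μ * (e3 + (1 - θ.η * μ) ^ θ.Q * M + e4) := by
    rw [e]
    exact (norm_sub_le _ _).trans (add_le_add (norm_sub_le _ _) h1)
  have h5 : ∀ a b c d e : ℝ, (a + b + c + d + e) ^ 2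
      ≤ 5 * (a ^ 2 + b ^ 2 + c ^ 2 + d ^ 2 + e ^ 2) := fun a b c d e => by
    nlinarith [sq_nonneg (a - b), sq_nonneg (a - c), sq_nonneg (a - d), sq_nonneg (a - e),
      sq_nonneg (b - c), sq_nonneg (b - d), sq_nonneg (b - e), sq_nonneg (c - d),
      sq_nonneg (c - e), sq_nonneg (d - e)]
  calc _ ≤ (e1 + e2 + L / μ * (e3 + (1 - θ.η * μ) ^ θ.Q * M + e4)) ^ 2 := by
        gcongr
    _ = (e1 + e2 + L / μ * e3 + L / μ * ((1 - θ.η * μ) ^ θ.Q * M) + L / μ * e4) ^ 2 := by ring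
    _ ≤ _ := h5 _ _ _ _ _
    _ = _ := by ring

lemma lintegral_estim_sub_hyper_le (hM : 0 ≤ M) (hμ : 0 < μ) (hμL : μ ≤ L) (k : ℕ) :
    ∫⁻ s, ‖estim P θ μ x₀ y₀ k s
        - P.hyper (outerX P θ μ x₀ y₀ k s) (innerY P θ μ x₀ y₀ k θ.D s)‖ₑ ^ 2 ∂P.law
      ≤ ENNReal.ofReal (θ.noise L M μ) := by
  have := hP.isProbabilityMeasure_law
  have hL : 0 < L := hμ.trans_le hμL
  have ha := hθ.contr_pos hμ hμL
  have hQ : (0 : ℝ) < θ.Q := by exact_mod_cast hθ.Q_pos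
  have hB := hθ.B_pos hμ hμL
  have hDf : (0 : ℝ) < θ.Df := by exact_mod_cast hθ.Df_pos
  have hDg : (0 : ℝ) < θ.Dg := by exact_mod_cast hθ.Dg_pos
  have hκ : 1 ≤ L / μ := (one_le_div hμ).2 hμL
  have b1 := lintegral_batchFx_sub_le (x₀ := x₀) (y₀ := y₀) hP hθ hM k
  have b2 := lintegral_batchJ_sub_le (x₀ := x₀) (y₀ := y₀) hP hθ hM hμ hμL k
  have b3 := lintegral_batchFy_sub_le (x₀ := x₀) (y₀ := y₀) hP hθ hM k
  have b4 := lintegral_hessErr_le (x₀ := x₀) (y₀ := y₀) hP hθ hM hμ hμL k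
  have m1 : Measurable fun s => ‖batchFx P θ μ x₀ y₀ k s
      - P.fx (outerX P θ μ x₀ y₀ k s) (innerY P θ μ x₀ y₀ k θ.D s)‖ₑ ^ 2 :=
    ((measurable_batchFx hP k).sub
      ((measurable_fx hP hM).comp (measurable_position hP k))).enorm.pow_const 2
  have m3 : Measurable fun s => ‖batchFy P θ μ x₀ y₀ k s
      - P.fy (outerX P θ μ x₀ y₀ k s) (innerY P θ μ x₀ y₀ k θ.D s)‖ₑ ^ 2 :=
    ((measurable_batchFy hP k).sub
      ((measurable_fy hP hM).comp (measurable_position hP k))).enorm.pow_const 2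
  have m4 : Measurable fun s => ‖θ.η • hessErr P θ μ x₀ y₀ k θ.Q s‖ₑ ^ 2 :=
    (measurable_smul_fun _ (measurable_hessErr hP hL.le k θ.Q)).enorm.pow_const 2
  have hpt : ∀ s, ‖estim P θ μ x₀ y₀ k s
        - P.hyper (outerX P θ μ x₀ y₀ k s) (innerY P θ μ x₀ y₀ k θ.D s)‖ₑ ^ 2
      ≤ ENNReal.ofReal 5 * ‖batchFx P θ μ x₀ y₀ k s
            - P.fx (outerX P θ μ x₀ y₀ k s) (innerY P θ μ x₀ y₀ k θ.D s)‖ₑ ^ 2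
        + (ENNReal.ofReal (5 * (L / μ) ^ 2) * ‖batchFy P θ μ x₀ y₀ k s
            - P.fy (outerX P θ μ x₀ y₀ k s) (innerY P θ μ x₀ y₀ k θ.D s)‖ₑ ^ 2
        + (ENNReal.ofReal (5 * (L / μ) ^ 2 * ((1 - θ.η * μ) ^ (2 * θ.Q) * M ^ 2))
        + (ENNReal.ofReal (5 * (L / μ) ^ 2) * ‖θ.η • hessErr P θ μ x₀ y₀ k θ.Q s‖ₑ ^ 2
        + ENNReal.ofReal 5 * ‖batchJ P θ μ x₀ y₀ k s (dirV P θ μ x₀ y₀ k s)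
            - P.jac (outerX P θ μ x₀ y₀ k s) (innerY P θ μ x₀ y₀ k θ.D s)
              (dirV P θ μ x₀ y₀ k s)‖ₑ ^ 2))) := by
    intro s
    simp only [norm_sq_eq_enorm]
    rw [← ENNReal.ofReal_mul (by positivity), ← ENNReal.ofReal_mul (by positivity),
      ← ENNReal.ofReal_mul (by positivity), ← ENNReal.ofReal_mul (by positivity),
      ← ENNReal.ofReal_add (by positivity) (by positivity),
      ← ENNReal.ofReal_add (by positivity) (by positivity),
      ← ENNReal.ofReal_add (by positivity) (by positivity),
      ← ENNReal.ofReal_add (by positivity) (by positivity)]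
    refine ENNReal.ofReal_le_ofReal
      ((norm_estim_sub_hyper_sq_le hP hθ hM hμ hμL k s).trans (le_of_eq ?_))
    ring
  refine (lintegral_mono hpt).trans ?_
  rw [lintegral_add_left (m1.const_mul _), lintegral_add_left (m3.const_mul _),
    lintegral_add_left measurable_const, lintegral_add_left (m4.const_mul _),
    lintegral_const_mul' _ _ ENNReal.ofReal_ne_top, lintegral_const_mul' _ _ ENNReal.ofReal_ne_top,
    lintegral_const_mul' _ _ ENNReal.ofReal_ne_top, lintegral_const_mul' _ _ ENNReal.ofReal_ne_top,
    lintegral_const, measure_univ, mul_one]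
  refine (add_le_add (mul_le_mul' le_rfl b1) (add_le_add (mul_le_mul' le_rfl b3)
    (add_le_add le_rfl (add_le_add (mul_le_mul' le_rfl b4) (mul_le_mul' le_rfl b2))))).trans ?_
  rw [← ENNReal.ofReal_mul (by positivity), ← ENNReal.ofReal_mul (by positivity),
      ← ENNReal.ofReal_mul (by positivity), ← ENNReal.ofReal_mul (by positivity),
      ← ENNReal.ofReal_add (by positivity) (by positivity),
      ← ENNReal.ofReal_add (by positivity) (by positivity),
      ← ENNReal.ofReal_add (by positivity) (by positivity),
      ← ENNReal.ofReal_add (by positivity) (by positivity)]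
  refine ENNReal.ofReal_le_ofReal ?_
  -- κ ≥ 1 lets the noise of ∇ₓF share the coefficient of the noise of ∇_yF.
  have h1 : 5 * (M ^ 2 / θ.Df) ≤ 5 * (L / μ) ^ 2 * (M ^ 2 / θ.Df) := by
    have : (1 : ℝ) ≤ (L / μ) ^ 2 := one_le_pow₀ hκ
    have h : 0 ≤ M ^ 2 / (θ.Df : ℝ) := by positivity
    nlinarith
  have h2 : 0 ≤ 5 * (L / μ) ^ 2 * ((1 - θ.η * μ) ^ (2 * θ.Q) * M ^ 2) := by positivity
  have h3 : 0 ≤ 5 * (L / μ) ^ 2 * (M ^ 2 / θ.Dg) := by positivity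
  have e1 : 5 * ((L * (M / μ)) ^ 2 / (θ.Dg : ℝ)) = 5 * (L / μ) ^ 2 * (M ^ 2 / θ.Dg) := by
    ring
  rw [e1, Params.noise]
  have e2 : 10 * M ^ 2 * (L / μ) ^ 2
      * (1 / (θ.Df : ℝ) + 1 / θ.Dg + (1 - θ.η * μ) ^ (2 * θ.Q) + 1 / (θ.B * θ.Q))
      = 2 * (5 * (L / μ) ^ 2 * (M ^ 2 / θ.Df)) + 2 * (5 * (L / μ) ^ 2 * (M ^ 2 / θ.Dg))
        + 2 * (5 * (L / μ) ^ 2 * ((1 - θ.η * μ) ^ (2 * θ.Q) * M ^ 2))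
        + 5 * (L / μ) ^ 2 * (2 * M ^ 2 / (θ.B * θ.Q)) := by
    ring
  rw [e2]
  linarith

end Noise

/-! ### The potential argument -/

/-- Sum of a perturbed contraction. -/
lemma sum_le_of_contraction {u g : ℕ → ℝ} {s : ℝ} (hu : ∀ k, 0 ≤ u k) (h0 : u 0 ≤ s)
    (h : ∀ k, u (k + 1) ≤ 1 / 6 * u k + g k + s) (n : ℕ) :
    ∑ k ∈ Finset.range n, u k ≤ 6 / 5 * ((n + 1) * s + ∑ k ∈ Finset.range n, g k) := by
  -- 6/5 = 1/(1 − 1/6), and the extra term 6/5 u_n closes the induction.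
  have key : ∑ k ∈ Finset.range n, u k + 6 / 5 * u n
      ≤ 6 / 5 * ((n + 1) * s + ∑ k ∈ Finset.range n, g k) := by
    induction n with
    | zero => simpa using h0
    | succ n ih =>
      rw [Finset.sum_range_succ, Finset.sum_range_succ]
      push_cast
      linarith [h n]
  linarith [hu n]

/-- Minimum of two error bounds, the first of which splits. -/
lemma le_add_mul_of_le_sq {e A t w u H : ℝ} (h1 : e ≤ A ^ 2 * t) (h2 : e ≤ H ^ 2)
    (ht : t ≤ w ^ 2 + u) (hA : 0 ≤ A) (hw : 0 ≤ w) (hu : 0 ≤ u) (hH : 0 ≤ H) :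
    e ≤ A ^ 2 * u + A * w * H := by
  have hAw : 0 ≤ A * w := mul_nonneg hA hw
  -- If Aw ≤ H then A²w² ≤ AwH; otherwise H² ≤ AwH.
  rcases le_total (A * w) H with h | h
  · have h3 : A ^ 2 * t ≤ A ^ 2 * (w ^ 2 + u) := by gcongr
    have h4 : A * w * (A * w) ≤ A * w * H := by gcongr
    nlinarith
  · have h3 : H * H ≤ A * w * H := by gcongr
    have h4 : 0 ≤ A ^ 2 * u := by positivity
    nlinarith

/-- The real-number core of the rate. In the application δ and t are the mean square inner errors
before and after the inner loop, G = E‖d_k‖², φ = EΦ(x_k), γ = E‖∇Φ(x_k)‖², ε is the mean square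
error of the direction, e its part due to the inexact inner solution, and N bounds the estimator
noise. The initial inner error is split off, so that it enters as A H R, linearly in A, and not as
A²R². -/
lemma sum_grad_le {lam s c A H R β Δ N : ℝ} {t δ G φ γ ε e : ℕ → ℝ} (hlam : 0 ≤ lam)
    (hlam' : lam ≤ 1 / 12) (hs : 0 ≤ s) (hc : 0 ≤ c) (hA : 0 ≤ A) (hH : 0 ≤ H) (hR : 0 ≤ R)
    (hβ : 0 < β) (ht : ∀ k, 0 ≤ t k) (hG : ∀ k, 0 ≤ G k) (hδ : δ 0 ≤ R ^ 2)
    (h1 : ∀ k, t k ≤ lam * δ k + s) (h2 : ∀ k, δ (k + 1) ≤ 2 * t k + c * G k)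
    (h3 : ∀ k, ε k ≤ 2 * N + 2 * e k) (h4 : ∀ k, e k ≤ A ^ 2 * t k) (h5 : ∀ k, e k ≤ H ^ 2)
    (h6 : ∀ k, φ (k + 1) ≤ φ k - β / 2 * γ k - β / 4 * G k + β / 2 * ε k)
    (hAc : A ^ 2 * c ≤ 1 / 8) (hφ : ∀ k, φ 0 - φ k ≤ Δ) {K : ℕ} (hK : 1 ≤ K) :
    ∑ k ∈ Finset.range K, γ k
      ≤ 2 * Δ / β + 2 * K * N + 24 / 5 * K * (A ^ 2 * s) + 4 / 3 * (A * H * R) := by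
  -- w carries the initial error: w² shrinks by 1/4 per iteration, more slowly than the contraction
  -- factor 1/6, and w_0² = R²/9 dominates R²/12. The excess u then starts below s and is driven
  -- only by G and s.
  set w : ℕ → ℝ := fun k => R / 3 * (1 / 2) ^ k with hw
  set u : ℕ → ℝ := fun k => max (t k - w k ^ 2) 0 with hu
  have hw0 : ∀ k, 0 ≤ w k := fun k => by positivity
  have hu0 : ∀ k, 0 ≤ u k := fun k => le_max_right _ _
  have htu : ∀ k, t k ≤ w k ^ 2 + u k := fun k => by
    have := le_max_left (t k - w k ^ 2) 0
    simp only [hu]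
    linarith
  have hus : u 0 ≤ s := by
    refine max_le ?_ hs
    have h := h1 0
    have h' : lam * δ 0 ≤ 1 / 12 * R ^ 2 :=
      (mul_le_mul_of_nonneg_left hδ hlam).trans (by gcongr)
    have : w 0 ^ 2 = R ^ 2 / 9 := by simp [hw]; ring
    nlinarith [sq_nonneg R]
  have hustep : ∀ k, u (k + 1) ≤ 1 / 6 * u k + 1 / 12 * (c * G k) + s := by
    intro k
    have hcG := mul_nonneg hc (hG k)
    refine max_le ?_ (by have := hu0 k; positivity)
    have h := h1 (k + 1)
    have h' : lam * δ (k + 1) ≤ 1 / 12 * (2 * t k + c * G k) :=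
      (mul_le_mul_of_nonneg_left (h2 k) hlam).trans
        (mul_le_mul_of_nonneg_right hlam' (by linarith [ht k]))
    have hwk : w (k + 1) ^ 2 = w k ^ 2 / 4 := by simp only [hw]; ring
    have := htu k
    nlinarith [sq_nonneg (w k)]
  have hsumu := sum_le_of_contraction hu0 hus hustep K
  have hK' : (1 : ℝ) ≤ K := by exact_mod_cast hK
  rw [← Finset.mul_sum, ← Finset.mul_sum] at hsumu
  set SG := ∑ k ∈ Finset.range K, G k with hSG
  have hSG0 : 0 ≤ SG := Finset.sum_nonneg fun k _ => hG k
  have hsumw : ∑ k ∈ Finset.range K, w k ≤ R / 3 * 2 := by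
    rw [← Finset.mul_sum]
    gcongr
    exact sum_geometric_two_le K
  have hsume : ∑ k ∈ Finset.range K, e k
      ≤ A ^ 2 * (∑ k ∈ Finset.range K, u k) + A * H * (R / 3 * 2) := by
    calc _ ≤ ∑ k ∈ Finset.range K, (A ^ 2 * u k + A * w k * H) :=
          Finset.sum_le_sum fun k _ =>
            le_add_mul_of_le_sq (h4 k) (h5 k) (htu k) hA (hw0 k) (hu0 k) hH
      _ = A ^ 2 * (∑ k ∈ Finset.range K, u k) + A * H * ∑ k ∈ Finset.range K, w k := by
          rw [Finset.sum_add_distrib, Finset.mul_sum, Finset.mul_sum]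
          congr 1
          exact Finset.sum_congr rfl fun k _ => by ring
      _ ≤ _ := by gcongr
  have hsumε : ∑ k ∈ Finset.range K, ε k
      ≤ K * (2 * N) + 2 * ∑ k ∈ Finset.range K, e k := by
    refine (Finset.sum_le_sum fun k _ => h3 k).trans (le_of_eq ?_)
    rw [Finset.sum_add_distrib, Finset.sum_const, Finset.card_range, nsmul_eq_mul,
      Finset.mul_sum]
  have htel : ∀ n : ℕ, φ n ≤ φ 0 - β / 2 * ∑ k ∈ Finset.range n, γ k
      - β / 4 * ∑ k ∈ Finset.range n, G k + β / 2 * ∑ k ∈ Finset.range n, ε k := by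
    intro n
    induction n with
    | zero => simp
    | succ n ih =>
      simp only [Finset.sum_range_succ]
      linarith [h6 n]
  -- By A²c ≤ 1/8 the forcing returns only 1/80 of ∑ G. Doubled, it is still absorbed by the 1/2 in
  -- `hfin`; K + 1 ≤ 2K gives 12/5.
  have hA2u : A ^ 2 * ∑ k ∈ Finset.range K, u k
      ≤ 12 / 5 * K * (A ^ 2 * s) + 1 / 80 * SG := by
    have h := mul_le_mul_of_nonneg_left hsumu (sq_nonneg A)
    have h' := mul_le_mul_of_nonneg_right hAc hSG0
    have h'' : 0 ≤ (K - 1 : ℝ) * (A ^ 2 * s) :=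
      mul_nonneg (by linarith) (by positivity)
    nlinarith
  have hfin : ∑ k ∈ Finset.range K, γ k + 1 / 2 * SG ≤ 2 * Δ / β + ∑ k ∈ Finset.range K, ε k := by
    rw [← sub_le_iff_le_add, le_div_iff₀ hβ]
    nlinarith [htel K, hφ K]
  linarith

/-! ### Comparison of the constants -/

section Constants

variable {L M τ ρ μ : ℝ} (hM : 0 ≤ M) (hτ : 0 ≤ τ) (hρ : 0 ≤ ρ) (hμ : 0 < μ) (hμL : μ ≤ L)
include hM hτ hρ hμ hμL

lemma errConst_pos : 0 < errConst L M τ ρ μ := by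
  have hL : 0 < L := hμ.trans_le hμL
  rw [errConst]
  positivity

/-- κP ≤ L_Φ controls at once the smoothness of Φ, the drift of y* relative to the descent, and the
cost of the initial inner error. -/
lemma mul_errConst_le_LPhi : L / μ * errConst L M τ ρ μ ≤ LPhi L M τ ρ μ := by
  have hL : 0 < L := hμ.trans_le hμL
  have e : LPhi L M τ ρ μ = L / μ * errConst L M τ ρ μ
      + (L + L ^ 2 / μ + τ * M ^ 2 / μ + ρ * L * M / μ ^ 2) := by
    rw [LPhi, errConst]
    field_simp
    ring
  rw [e]
  exact le_add_of_nonneg_right (by positivity)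

/-- The left side is the Lipschitz constant of ∇Φ obtained in `hyper_yStar_lipschitz`. -/
lemma errConst_mul_le_LPhi : errConst L M τ ρ μ * (1 + L / μ) ≤ 2 * LPhi L M τ ρ μ := by
  have h := mul_errConst_le_LPhi hM hτ hρ hμ hμL
  have h0 := errConst_pos hM hτ hρ hμ hμL
  have hκ : 1 ≤ L / μ := (one_le_div hμ).2 hμL
  nlinarith

lemma LPhi_pos : 0 < LPhi L M τ ρ μ := by
  have hL : 0 < L := hμ.trans_le hμL
  rw [LPhi]
  positivity

lemma errConst_le : errConst L M τ ρ μ ≤ (2 * L + M * τ / L + M * ρ / L) * (L / μ) ^ 2 := by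
  have hL : 0 < L := hμ.trans_le hμL
  have hκ : 1 ≤ L / μ := (one_le_div hμ).2 hμL
  have hκ2 : L / μ ≤ (L / μ) ^ 2 := by nlinarith
  have e : errConst L M τ ρ μ = L + L * (L / μ) + M * τ / L * (L / μ)
      + M * ρ / L * (L / μ) ^ 2 := by
    rw [errConst]
    field_simp
  have h1 : L ≤ L * (L / μ) ^ 2 := by nlinarith
  have h2 : L * (L / μ) ≤ L * (L / μ) ^ 2 := by gcongr
  have h3 : M * τ / L * (L / μ) ≤ M * τ / L * (L / μ) ^ 2 := by gcongr
  rw [e]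
  linarith

end Constants

/-! ### Moments along the iteration and the sum of squared gradients -/

section Rate

variable {p q : ℕ} {Ξ Z : Type*} [MeasurableSpace Ξ] [MeasurableSpace Z]
  {P : Problem p q Ξ Z} {θ : Params} {L M τ ρ μ σ : ℝ} {x₀ : Vec p} {y₀ : Vec q}

lemma integrable_sq_of_norm_le {Ω V : Type*} [MeasurableSpace Ω] {ν : Measure Ω}
    [IsFiniteMeasure ν] [NormedAddCommGroup V] {X : Ω → V} (hX : AEStronglyMeasurable X ν) {c : ℝ}
    (h : ∀ ω, ‖X ω‖ ≤ c) : Integrable (fun ω => ‖X ω‖ ^ 2) ν :=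
  .of_bound (hX.norm.pow 2) (c ^ 2) (Eventually.of_forall fun ω => by
    rw [norm_pow, norm_norm]
    gcongr
    exact h ω)

lemma lintegral_sq_eq_ofReal_integral {Ω V : Type*} [MeasurableSpace Ω] {ν : Measure Ω}
    [IsFiniteMeasure ν] [NormedAddCommGroup V] {X : Ω → V} (hX : AEStronglyMeasurable X ν) {c : ℝ}
    (h : ∀ ω, ‖X ω‖ ≤ c) : ∫⁻ ω, ‖X ω‖ₑ ^ 2 ∂ν = ENNReal.ofReal (∫ ω, ‖X ω‖ ^ 2 ∂ν) := by
  rw [ofReal_integral_eq_lintegral_ofReal (integrable_sq_of_norm_le hX h)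
    (Eventually.of_forall fun _ => by positivity)]
  exact lintegral_congr fun ω => norm_sq_eq_enorm _

lemma integral_sq_eq_toReal_lintegral {Ω V : Type*} [MeasurableSpace Ω] {ν : Measure Ω}
    [IsFiniteMeasure ν] [NormedAddCommGroup V] {X : Ω → V} (hX : AEStronglyMeasurable X ν) {c : ℝ}
    (h : ∀ ω, ‖X ω‖ ≤ c) : ∫ ω, ‖X ω‖ ^ 2 ∂ν = (∫⁻ ω, ‖X ω‖ₑ ^ 2 ∂ν).toReal := by
  rw [lintegral_sq_eq_ofReal_integral hX h,
    ENNReal.toReal_ofReal (integral_nonneg fun _ => by positivity)]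

lemma integral_sq_le_of_norm_le {Ω V : Type*} [MeasurableSpace Ω] {ν : Measure Ω}
    [IsProbabilityMeasure ν] [NormedAddCommGroup V] {X : Ω → V} (hX : AEStronglyMeasurable X ν)
    {c : ℝ} (h : ∀ ω, ‖X ω‖ ≤ c) : ∫ ω, ‖X ω‖ ^ 2 ∂ν ≤ c ^ 2 := by
  have := integral_mono (integrable_sq_of_norm_le hX h) (integrable_const (c ^ 2))
    fun ω => by
      simp only
      gcongr
      exact h ω
  simpa using this

variable (hP : P.Assumptions L M τ ρ μ σ)
include hP

lemma measurable_hyper (hM : 0 ≤ M) (hμ : 0 < μ) (hμL : μ ≤ L) :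
    Measurable fun z : Vec p × Vec q => P.hyper z.1 z.2 :=
  measurable_of_lipschitz_pair (hP.hyper_lipschitz hM hμ hμL)

/-- Quadratic upper bound with ⟨∇Φ, d⟩ polarized. The smoothness constant times β is at most 1/2, so
half of −β/2 ‖d‖² survives; it later pays for the motion of y*. -/
lemma Phi_sub_smul_le (hM : 0 ≤ M) (hτ : 0 ≤ τ) (hρ : 0 ≤ ρ) (hμ : 0 < μ) (hμL : μ ≤ L)
    {β : ℝ} (hβ : β = 1 / (4 * LPhi L M τ ρ μ)) (x d : Vec p) :
    P.Phi (x - β • d) ≤ P.Phi x - β / 2 * ‖P.hyper x (P.yStar x)‖ ^ 2 - β / 4 * ‖d‖ ^ 2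
      + β / 2 * ‖d - P.hyper x (P.yStar x)‖ ^ 2 := by
  have h := le_quadratic_of_lipschitz_gradient (φ := P.Phi) (hP.hasGradientAt_Phi hM hμ hμL)
    (hP.hyper_yStar_lipschitz hM hτ hρ hμ hμL) x (-(β • d))
  have hLP := LPhi_pos hM hτ hρ hμ hμL
  have hβ0 : 0 < β := by rw [hβ]; positivity
  have hsm : errConst L M τ ρ μ * (1 + L / μ) * β ≤ 1 / 2 := by
    have h1 := errConst_mul_le_LPhi hM hτ hρ hμ hμL
    calc _ ≤ 2 * LPhi L M τ ρ μ * β := by gcongr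
      _ = 1 / 2 := by rw [hβ]; field_simp; norm_num
  rw [← sub_eq_add_neg, norm_neg, norm_smul, inner_neg_right, real_inner_smul_right, mul_pow,
    Real.norm_of_nonneg hβ0.le] at h
  have h2 : errConst L M τ ρ μ * (1 + L / μ) / 2 * (β ^ 2 * ‖d‖ ^ 2) ≤ β / 4 * ‖d‖ ^ 2 := by
    have : 0 ≤ β * ‖d‖ ^ 2 := by positivity
    nlinarith
  have h3 := norm_sub_sq_real d (P.hyper x (P.yStar x))
  rw [real_inner_comm] at h3
  rw [h3]
  linarith

/-- Warm start: the inner variable is kept, while y* moves by at most κ|β|‖d_k‖. -/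
lemma lintegral_innerY_succ_zero_le (hμ : 0 < μ) (hμL : μ ≤ L) (k : ℕ) :
    ∫⁻ s, ‖innerY P θ μ x₀ y₀ (k + 1) 0 s - P.yStar (outerX P θ μ x₀ y₀ (k + 1) s)‖ₑ ^ 2 ∂P.law
      ≤ ENNReal.ofReal 2 * ∫⁻ s, ‖innerY P θ μ x₀ y₀ k θ.D s
          - P.yStar (outerX P θ μ x₀ y₀ k s)‖ₑ ^ 2 ∂P.law
        + ENNReal.ofReal (2 * (L / μ) ^ 2 * θ.β ^ 2)
          * ∫⁻ s, ‖estim P θ μ x₀ y₀ k s‖ₑ ^ 2 ∂P.law := by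
  rw [← lintegral_const_mul' _ _ ENNReal.ofReal_ne_top,
    ← lintegral_const_mul' _ _ ENNReal.ofReal_ne_top, ← lintegral_add_right _
      (((measurable_estim hP k).enorm.pow_const 2).const_mul _)]
  refine lintegral_mono fun s => ?_
  simp only
  rw [norm_sq_eq_enorm, norm_sq_eq_enorm, norm_sq_eq_enorm, ← ENNReal.ofReal_mul (by positivity),
    ← ENNReal.ofReal_mul (by positivity), ← ENNReal.ofReal_add (by positivity) (by positivity)]
  refine ENNReal.ofReal_le_ofReal ?_
  rw [innerY_succ_zero]
  set a := innerY P θ μ x₀ y₀ k θ.D s - P.yStar (outerX P θ μ x₀ y₀ k s)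
  set b := P.yStar (outerX P θ μ x₀ y₀ k s) - P.yStar (outerX P θ μ x₀ y₀ (k + 1) s)
  have e : innerY P θ μ x₀ y₀ k θ.D s - P.yStar (outerX P θ μ x₀ y₀ (k + 1) s) = a + b := by
    simp [a, b]
  have hb : ‖b‖ ≤ L / μ * (|θ.β| * ‖estim P θ μ x₀ y₀ k s‖) := by
    refine (hP.yStar_lipschitz hμ hμL _ _).trans (le_of_eq ?_)
    rw [outerX_succ, sub_sub_cancel, norm_smul, Real.norm_eq_abs]
  have hb2 : ‖b‖ ^ 2 ≤ (L / μ * (|θ.β| * ‖estim P θ μ x₀ y₀ k s‖)) ^ 2 := by gcongr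
  rw [mul_pow, mul_pow, sq_abs] at hb2
  have hab : ‖a + b‖ ^ 2 ≤ (‖a‖ + ‖b‖) ^ 2 := by
    gcongr
    exact norm_add_le _ _
  rw [e]
  nlinarith [sq_nonneg (‖a‖ - ‖b‖)]

variable (hθ : θ.IsTuned L M τ ρ μ)
include hθ

/-- The estimates are bounded, so x_k stays in a fixed ball, on which the continuous function Φ is
bounded. This serves only for the integrability of Φ(x_k). -/
lemma exists_abs_Phi_outerX_le (hM : 0 ≤ M) (hτ : 0 ≤ τ) (hρ : 0 ≤ ρ) (hμ : 0 < μ)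
    (hμL : μ ≤ L) (k : ℕ) :
    ∃ c, ∀ s : Samples Ξ Z, ‖P.Phi (outerX P θ μ x₀ y₀ k s)‖ ≤ c := by
  have hβ0 : 0 ≤ θ.β := by
    have := LPhi_pos hM hτ hρ hμ hμL
    rw [hθ.β_eq]; positivity
  have hx : ∀ s : Samples Ξ Z, ‖outerX P θ μ x₀ y₀ k s - x₀‖ ≤ k * (θ.β * (M + L * (M / μ))) := by
    intro s
    induction k with
    | zero => simp [outerX, stocBiO]
    | succ k ih =>
      rw [outerX_succ, sub_right_comm]
      refine (norm_sub_le _ _).trans ?_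
      rw [norm_smul, Real.norm_of_nonneg hβ0]
      have := mul_le_mul_of_nonneg_left
        (norm_estim_le (x₀ := x₀) (y₀ := y₀) hP hθ hM hμ hμL k s) hβ0
      push_cast
      linarith
  obtain ⟨c, hc⟩ := (isCompact_closedBall x₀ (k * (θ.β * (M + L * (M / μ))))).exists_bound_of_continuousOn
    (f := P.Phi) (continuous_iff_continuousAt.2 fun x =>
      (hP.hasGradientAt_Phi hM hμ hμL x).continuousAt).continuousOn
  exact ⟨c, fun s => hc _ (by rw [Metric.mem_closedBall, dist_eq_norm]; exact hx s)⟩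

/-- `sum_grad_le` with A = `errConst` and H = 2(M + LM/μ), a bound for the difference of two values
of `hyper`. -/
lemma sum_integral_hyper_le (hM : 0 ≤ M) (hτ : 0 ≤ τ) (hρ : 0 ≤ ρ) (hμ : 0 < μ) (hμL : μ ≤ L)
    (hD : (1 - θ.α * μ) ^ (2 * θ.D) ≤ 1 / 12) {Δ R : ℝ} (hΔ : P.Phi x₀ - (⨅ x, P.Phi x) ≤ Δ)
    (hR : ‖y₀ - P.yStar x₀‖ ≤ R) :
    ∑ k ∈ Finset.range θ.K, ∫ s, ‖P.hyper (outerX P θ μ x₀ y₀ k s)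
        (P.yStar (outerX P θ μ x₀ y₀ k s))‖ ^ 2 ∂P.law
      ≤ (8 * Δ + 6 * M * R) * LPhi L M τ ρ μ + 2 * θ.K * θ.noise L M μ
        + 5 * θ.K * (errConst L M τ ρ μ ^ 2 * (σ ^ 2 / (L * μ * θ.S))) := by
  have := hP.prob_ξ
  have := hP.prob_ζ
  have := hP.isProbabilityMeasure_law
  have hL : 0 < L := hμ.trans_le hμL
  have hLP := LPhi_pos hM hτ hρ hμ hμL
  have hA := errConst_pos hM hτ hρ hμ hμL
  have hκ : 1 ≤ L / μ := (one_le_div hμ).2 hμL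
  have hR0 : 0 ≤ R := (norm_nonneg _).trans hR
  have hβ0 : 0 < θ.β := by rw [hθ.β_eq]; positivity
  have hS : (0 : ℝ) < θ.S := by exact_mod_cast hθ.S_pos
  set X := outerX P θ μ x₀ y₀ with hX
  set Y := innerY P θ μ x₀ y₀ with hY
  set E := estim P θ μ x₀ y₀ with hE
  set g : ℕ → Samples Ξ Z → Vec p := fun k s => P.hyper (X k s) (P.yStar (X k s)) with hg
  set g' : ℕ → Samples Ξ Z → Vec p := fun k s => P.hyper (X k s) (Y k θ.D s) with hg'
  set B := M + L * (M / μ) with hB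
  have hXm : ∀ k, Measurable (X k) := measurable_outerX hP
  have hEm : ∀ k, Measurable (E k) := measurable_estim hP
  have hgm : ∀ k, Measurable (g k) := fun k =>
    Measurable.comp (g := fun z : Vec p × Vec q => P.hyper z.1 z.2)
      (f := fun s => (X k s, P.yStar (X k s))) (measurable_hyper hP hM hμ hμL)
      ((hXm k).prodMk ((measurable_yStar hP hμ hμL).comp (hXm k)))
  have hgm' : ∀ k, Measurable (g' k) := fun k =>
    Measurable.comp (g := fun z : Vec p × Vec q => P.hyper z.1 z.2)
      (f := fun s => (X k s, Y k θ.D s)) (measurable_hyper hP hM hμ hμL)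
      (measurable_position hP k)
  have hEb : ∀ k s, ‖E k s‖ ≤ B := norm_estim_le hP hθ hM hμ hμL
  have hgb : ∀ k s, ‖g k s‖ ≤ B := fun k s => hP.norm_hyper_le hM hμ hμL _ _
  have hgb' : ∀ k s, ‖g' k s‖ ≤ B := fun k s => hP.norm_hyper_le hM hμ hμL _ _
  have hsub : ∀ {u v : Samples Ξ Z → Vec p}, (∀ s, ‖u s‖ ≤ B) → (∀ s, ‖v s‖ ≤ B) →
      ∀ s, ‖u s - v s‖ ≤ 2 * B := fun hu hv s =>
    (norm_sub_le _ _).trans (by linarith [hu s, hv s])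
  have hEg := fun k => hsub (hEb k) (hgb k)
  have hEg' := fun k => hsub (hEb k) (hgb' k)
  have hgg' := fun k => hsub (hgb' k) (hgb k)
  have mE := fun k => (hEm k).aestronglyMeasurable (μ := P.law)
  have mg := fun k => (hgm k).aestronglyMeasurable (μ := P.law)
  have mEg : ∀ k, AEStronglyMeasurable (fun s => E k s - g k s) P.law := fun k =>
    ((hEm k).sub (hgm k)).aestronglyMeasurable
  have mEg' : ∀ k, AEStronglyMeasurable (fun s => E k s - g' k s) P.law := fun k =>
    ((hEm k).sub (hgm' k)).aestronglyMeasurable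
  have mgg' : ∀ k, AEStronglyMeasurable (fun s => g' k s - g k s) P.law := fun k =>
    ((hgm' k).sub (hgm k)).aestronglyMeasurable
  -- The inner errors have no pointwise bound, so their moments stay in `ENNReal` until the
  -- recursions have propagated finiteness.
  set t : ℕ → ENNReal := fun k => ∫⁻ s, ‖Y k θ.D s - P.yStar (X k s)‖ₑ ^ 2 ∂P.law with ht
  set δ : ℕ → ENNReal := fun k => ∫⁻ s, ‖Y k 0 s - P.yStar (X k s)‖ₑ ^ 2 ∂P.law with hδ
  have h1 : ∀ k, t k ≤ ENNReal.ofReal ((1 - θ.α * μ) ^ (2 * θ.D)) * δ k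
      + ENNReal.ofReal (σ ^ 2 / (L * μ * θ.S)) := lintegral_innerY_le hP hθ hμ hμL
  have h2 : ∀ k, δ (k + 1) ≤ ENNReal.ofReal 2 * t k
      + ENNReal.ofReal (2 * (L / μ) ^ 2 * θ.β ^ 2) * ∫⁻ s, ‖E k s‖ₑ ^ 2 ∂P.law :=
    lintegral_innerY_succ_zero_le hP hμ hμL
  have hEt : ∀ k, ∫⁻ s, ‖E k s‖ₑ ^ 2 ∂P.law ≠ ⊤ := fun k => by
    rw [lintegral_sq_eq_ofReal_integral (mE k) (hEb k)]
    exact ENNReal.ofReal_ne_top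
  have hδ0 : δ 0 ≤ ENNReal.ofReal (R ^ 2) :=
    Problem.Assumptions.lintegral_enorm_sq_le_of_norm_le fun s => hR
  have htt : ∀ k, δ k ≠ ⊤ → t k ≠ ⊤ := fun k h =>
    ne_top_of_le_ne_top (ENNReal.add_ne_top.2 ⟨ENNReal.mul_ne_top ENNReal.ofReal_ne_top h,
      ENNReal.ofReal_ne_top⟩) (h1 k)
  have hδt : ∀ k, δ k ≠ ⊤ := by
    intro k
    induction k with
    | zero => exact ne_top_of_le_ne_top ENNReal.ofReal_ne_top hδ0
    | succ k ih =>
      exact ne_top_of_le_ne_top (ENNReal.add_ne_top.2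
        ⟨ENNReal.mul_ne_top ENNReal.ofReal_ne_top (htt k ih),
          ENNReal.mul_ne_top ENNReal.ofReal_ne_top (hEt k)⟩) (h2 k)
  have hint : ∀ k, Integrable (fun s => P.Phi (X k s)) P.law := by
    intro k
    obtain ⟨c, hc⟩ := exists_abs_Phi_outerX_le (x₀ := x₀) (y₀ := y₀) hP hθ hM hτ hρ hμ hμL k
    refine .of_bound (Measurable.aestronglyMeasurable ?_) c (Eventually.of_forall hc)
    exact (continuous_iff_continuousAt.2 fun x =>
      (hP.hasGradientAt_Phi hM hμ hμL x).continuousAt).measurable.comp (hXm k)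
  have iE := fun k => integrable_sq_of_norm_le (mE k) (hEb k)
  have ig := fun k => integrable_sq_of_norm_le (mg k) (hgb k)
  have iEg := fun k => integrable_sq_of_norm_le (mEg k) (hEg k)
  have iEg' := fun k => integrable_sq_of_norm_le (mEg' k) (hEg' k)
  have igg' := fun k => integrable_sq_of_norm_le (mgg' k) (hgg' k)
  have key := sum_grad_le (lam := (1 - θ.α * μ) ^ (2 * θ.D)) (s := σ ^ 2 / (L * μ * θ.S))
    (c := 2 * (L / μ) ^ 2 * θ.β ^ 2) (A := errConst L M τ ρ μ) (H := 2 * B) (R := R) (β := θ.β)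
    (Δ := Δ) (N := θ.noise L M μ) (t := fun k => (t k).toReal) (δ := fun k => (δ k).toReal)
    (G := fun k => ∫ s, ‖E k s‖ ^ 2 ∂P.law) (φ := fun k => ∫ s, P.Phi (X k s) ∂P.law)
    (γ := fun k => ∫ s, ‖g k s‖ ^ 2 ∂P.law) (ε := fun k => ∫ s, ‖E k s - g k s‖ ^ 2 ∂P.law)
    (e := fun k => ∫ s, ‖g' k s - g k s‖ ^ 2 ∂P.law)
    ((even_two_mul _).pow_nonneg _) hD (by positivity) (by positivity) hA.le (by positivity) hR0 hβ0
    (fun k => ENNReal.toReal_nonneg) (fun k => integral_nonneg fun _ => by positivity)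
    (ENNReal.toReal_le_of_le_ofReal (by positivity) hδ0)
    (fun k => by
      have h := ENNReal.toReal_mono (ENNReal.add_ne_top.2
        ⟨ENNReal.mul_ne_top ENNReal.ofReal_ne_top (hδt k), ENNReal.ofReal_ne_top⟩) (h1 k)
      rwa [ENNReal.toReal_add (ENNReal.mul_ne_top ENNReal.ofReal_ne_top (hδt k))
        ENNReal.ofReal_ne_top, ENNReal.toReal_mul,
        ENNReal.toReal_ofReal ((even_two_mul _).pow_nonneg _),
        ENNReal.toReal_ofReal (by positivity)] at h)
    (fun k => by
      have t1 := ENNReal.mul_ne_top (a := ENNReal.ofReal 2) ENNReal.ofReal_ne_top (htt k (hδt k))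
      have t2 := ENNReal.mul_ne_top (a := ENNReal.ofReal (2 * (L / μ) ^ 2 * θ.β ^ 2))
        ENNReal.ofReal_ne_top (hEt k)
      have h := ENNReal.toReal_mono (ENNReal.add_ne_top.2 ⟨t1, t2⟩) (h2 k)
      rwa [ENNReal.toReal_add t1 t2, ENNReal.toReal_mul, ENNReal.toReal_mul,
        ENNReal.toReal_ofReal (by positivity), ENNReal.toReal_ofReal (by positivity),
        ← integral_sq_eq_toReal_lintegral (mE k) (hEb k)] at h)
    (fun k => by
      have h : ∫ s, ‖E k s - g' k s‖ ^ 2 ∂P.law ≤ θ.noise L M μ := by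
        rw [integral_sq_eq_toReal_lintegral (mEg' k) (hEg' k)]
        refine ENNReal.toReal_le_of_le_ofReal ?_ (lintegral_estim_sub_hyper_le hP hθ hM hμ hμL k)
        have := hθ.B_pos hμ hμL
        have := hθ.contr_pos hμ hμL
        rw [Params.noise]
        positivity
      have h' := integral_mono (iEg k) (((iEg' k).const_mul 2).add ((igg' k).const_mul 2))
        fun s => by
          have h3 : E k s - g k s = (E k s - g' k s) + (g' k s - g k s) := by abel
          have h4 : ‖E k s - g k s‖ ^ 2 ≤ (‖E k s - g' k s‖ + ‖g' k s - g k s‖) ^ 2 := by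
            gcongr
            rw [h3]
            exact norm_add_le _ _
          simp only [Pi.add_apply]
          nlinarith [sq_nonneg (‖E k s - g' k s‖ - ‖g' k s - g k s‖)]
      simp only [Pi.add_apply] at h'
      rw [integral_add ((iEg' k).const_mul 2) ((igg' k).const_mul 2), integral_const_mul,
        integral_const_mul] at h'
      linarith)
    (fun k => by
      rw [integral_sq_eq_toReal_lintegral (mgg' k) (hgg' k),
        ← ENNReal.toReal_ofReal (sq_nonneg (errConst L M τ ρ μ)), ← ENNReal.toReal_mul]
      refine ENNReal.toReal_mono (ENNReal.mul_ne_top ENNReal.ofReal_ne_top (htt k (hδt k))) ?_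
      rw [← lintegral_const_mul' _ _ ENNReal.ofReal_ne_top]
      refine lintegral_mono fun s => ?_
      simp only
      rw [norm_sq_eq_enorm, norm_sq_eq_enorm, ← ENNReal.ofReal_mul (by positivity), ← mul_pow]
      refine ENNReal.ofReal_le_ofReal ?_
      gcongr
      refine (hP.hyper_lipschitz hM hμ hμL _ _ _ _).trans (le_of_eq ?_)
      rw [pair_sub, sub_self, norm_pair_zero_left])
    (fun k => integral_sq_le_of_norm_le (mgg' k) (hgg' k))
    (fun k => by
      have i1 : Integrable (fun s => P.Phi (X k s) - θ.β / 2 * ‖g k s‖ ^ 2) P.law :=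
        (hint k).sub ((ig k).const_mul _)
      have i2 : Integrable (fun s => P.Phi (X k s) - θ.β / 2 * ‖g k s‖ ^ 2
          - θ.β / 4 * ‖E k s‖ ^ 2) P.law := i1.sub ((iE k).const_mul _)
      have h' := integral_mono (hint (k + 1)) (i2.add ((iEg k).const_mul (θ.β / 2))) fun s =>
        Phi_sub_smul_le hP hM hτ hρ hμ hμL hθ.β_eq (X k s) (E k s)
      refine h'.trans (le_of_eq ?_)
      refine (integral_add i2 ((iEg k).const_mul _)).trans ?_
      rw [integral_sub i1 ((iE k).const_mul _), integral_sub (hint k) ((ig k).const_mul _),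
        integral_const_mul, integral_const_mul, integral_const_mul])
    (by
      have h := mul_errConst_le_LPhi hM hτ hρ hμ hμL
      have h' : (L / μ * errConst L M τ ρ μ) ^ 2 ≤ LPhi L M τ ρ μ ^ 2 := by gcongr
      calc _ = 2 * θ.β ^ 2 * (L / μ * errConst L M τ ρ μ) ^ 2 := by ring
        _ ≤ 2 * θ.β ^ 2 * LPhi L M τ ρ μ ^ 2 := by gcongr
        _ = 1 / 8 := by rw [hθ.β_eq]; field_simp; norm_num)
    (fun k => by
      have h0 : ∫ s, P.Phi (X 0 s) ∂P.law = P.Phi x₀ := by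
        simp [hX, outerX, stocBiO]
      have h : ∫ _ : Samples Ξ Z, (⨅ x, P.Phi x) ∂P.law ≤ ∫ s, P.Phi (X k s) ∂P.law :=
        integral_mono (integrable_const _) (hint k) fun s => ciInf_le hP.bddBelow _
      rw [integral_const, probReal_univ, one_smul] at h
      rw [h0]
      linarith)
    hθ.K_pos
  refine key.trans ?_
  have e1 : 2 * Δ / θ.β = 8 * Δ * LPhi L M τ ρ μ := by
    rw [hθ.β_eq]; field_simp; ring
  -- Here M + LM/μ ≤ 2Mκ and κP ≤ L_Φ, so the initial inner error costs as much as a gap of Φ; 4/3 ·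
  -- 4 ≤ 6 gives the coefficient in the claim.
  have e2 : errConst L M τ ρ μ * (2 * B) * R ≤ 4 * M * R * LPhi L M τ ρ μ := by
    have h3 : B ≤ 2 * M * (L / μ) := by
      have : L * (M / μ) = M * (L / μ) := by ring
      rw [hB, this]
      nlinarith
    calc _ ≤ errConst L M τ ρ μ * (2 * (2 * M * (L / μ))) * R := by gcongr
      _ = 4 * M * R * (L / μ * errConst L M τ ρ μ) := by ring
      _ ≤ _ := by
        gcongr
        exact mul_errConst_le_LPhi hM hτ hρ hμ hμL
  have e3 : 0 ≤ M * R * LPhi L M τ ρ μ := by positivity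
  have e4 : 0 ≤ (θ.K : ℝ) * (errConst L M τ ρ μ ^ 2 * (σ ^ 2 / (L * μ * θ.S))) := by positivity
  rw [e1]
  linarith

end Rate

/-! ### Rate and random output on the original probability space -/

/-- Constant in the convergence rate. -/
def rateConst (L M τ ρ Δ R : ℝ) : ℝ :=
  |8 * Δ + 6 * M * R| + 20 * M ^ 2 + 5 * (2 * L + M * τ / L + M * ρ / L) ^ 2 / L ^ 2 + 1

/-- The bound is needed when the accuracy is divided by this constant. The absolute value in
`rateConst` is there because the bounds on the gap and the distance may have any sign. -/
lemma one_le_rateConst {L M τ ρ Δ R : ℝ} : 1 ≤ rateConst L M τ ρ Δ R := by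
  rw [rateConst]
  have : 0 ≤ |8 * Δ + 6 * M * R| + 20 * M ^ 2
      + 5 * (2 * L + M * τ / L + M * ρ / L) ^ 2 / L ^ 2 := by positivity
  linarith

section Transfer

variable {p q : ℕ} {Ξ Z Ω : Type*} [MeasurableSpace Ξ] [MeasurableSpace Z] [MeasurableSpace Ω]
  {P : Problem p q Ξ Z} {θ : Params} {L M τ ρ μ σ : ℝ} {x₀ : Vec p} {y₀ : Vec q}
  {Pr : Measure Ω} [IsProbabilityMeasure Pr] {ξ : ℕ × ℕ → Ω → Ξ} {ζ : GDraw → Ω → Z}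
  (hP : P.Assumptions L M τ ρ μ σ) (hs : IsSampling P Pr ξ ζ)
include hP

lemma measurable_gradient_Phi (hM : 0 ≤ M) (hμ : 0 < μ) (hμL : μ ≤ L) :
    Measurable (gradient P.Phi) := by
  have e : gradient P.Phi = fun x => P.hyper x (P.yStar x) :=
    funext (hP.gradient_Phi hM hμ hμL)
  rw [e]
  exact Measurable.comp (g := fun z : Vec p × Vec q => P.hyper z.1 z.2)
    (f := fun x => (x, P.yStar x)) (measurable_hyper hP hM hμ hμL)
    (measurable_id.prodMk (measurable_yStar hP hμ hμL))

lemma norm_gradient_Phi_le (hM : 0 ≤ M) (hμ : 0 < μ) (hμL : μ ≤ L) (x : Vec p) :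
    ‖gradient P.Phi x‖ ≤ M + L * (M / μ) := by
  rw [hP.gradient_Phi hM hμ hμL]
  exact hP.norm_hyper_le hM hμ hμL _ _

include hs

lemma measurable_iterate (k : ℕ) : Measurable (iterate P θ μ x₀ y₀ ξ ζ k) :=
  Measurable.comp (g := outerX P θ μ x₀ y₀ k)
    (f := fun ω => ((fun i => ξ i ω, fun d => ζ d ω) : Samples Ξ Z)) (measurable_outerX hP k)
    (hs.map_eq_law hP).measurable

lemma integrable_gradient_iterate (hM : 0 ≤ M) (hμ : 0 < μ) (hμL : μ ≤ L) (k : ℕ) :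
    Integrable (fun ω => ‖gradient P.Phi (iterate P θ μ x₀ y₀ ξ ζ k ω)‖ ^ 2) Pr :=
  integrable_sq_of_norm_le ((measurable_gradient_Phi hP hM hμ hμL).comp
    (measurable_iterate hP hs k)).aestronglyMeasurable
    fun _ => norm_gradient_Phi_le hP hM hμ hμL _

lemma integral_gradient_iterate (hM : 0 ≤ M) (hμ : 0 < μ) (hμL : μ ≤ L) (k : ℕ) :
    ∫ ω, ‖gradient P.Phi (iterate P θ μ x₀ y₀ ξ ζ k ω)‖ ^ 2 ∂Pr
      = ∫ s, ‖P.hyper (outerX P θ μ x₀ y₀ k s) (P.yStar (outerX P θ μ x₀ y₀ k s))‖ ^ 2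
        ∂P.law := by
  have hm : Measurable fun s : Samples Ξ Z =>
      ‖gradient P.Phi (outerX P θ μ x₀ y₀ k s)‖ ^ 2 :=
    ((measurable_gradient_Phi hP hM hμ hμL).comp (measurable_outerX hP k)).norm.pow_const 2
  have hmap := hs.map_eq_law hP
  simp only [← hP.gradient_Phi hM hμ hμL]
  rw [← hmap.map_eq, integral_map hmap.measurable.aemeasurable hm.aestronglyMeasurable]
  rfl

/-- Convergence rate of stocBiO. -/
lemma average_gradient_le (hM : 0 ≤ M) (hτ : 0 ≤ τ) (hρ : 0 ≤ ρ) (hμ : 0 < μ) (hμL : μ ≤ L)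
    (hθ : θ.IsTuned L M τ ρ μ) (hD : (1 - θ.α * μ) ^ (2 * θ.D) ≤ 1 / 12) {Δ R : ℝ}
    (hΔ : P.Phi x₀ - (⨅ x, P.Phi x) ≤ Δ) (hR : ‖y₀ - P.yStar x₀‖ ≤ R) :
    (1 / (θ.K : ℝ)) * ∑ k ∈ Finset.range θ.K,
        ∫ ω, ‖gradient P.Phi (iterate P θ μ x₀ y₀ ξ ζ k ω)‖ ^ 2 ∂Pr
      ≤ rateConst L M τ ρ Δ R * (LPhi L M τ ρ μ / θ.K
          + (L / μ) ^ 2 * (1 - θ.η * μ) ^ (2 * θ.Q) + (L / μ) ^ 5 * σ ^ 2 / θ.S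
          + (L / μ) ^ 2 / θ.Dg + (L / μ) ^ 2 / θ.Df + (L / μ) ^ 2 / (θ.B * θ.Q)) := by
  have hL : 0 < L := hμ.trans_le hμL
  have hLP := LPhi_pos hM hτ hρ hμ hμL
  have hA := errConst_pos hM hτ hρ hμ hμL
  have ha := hθ.contr_pos hμ hμL
  have hB := hθ.B_pos hμ hμL
  have hK : (0 : ℝ) < θ.K := by exact_mod_cast hθ.K_pos
  have hS : (0 : ℝ) < θ.S := by exact_mod_cast hθ.S_pos
  have h := sum_integral_hyper_le (x₀ := x₀) (y₀ := y₀) hP hθ hM hτ hρ hμ hμL hD hΔ hR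
  simp only [← integral_gradient_iterate (Pr := Pr) (ξ := ξ) (ζ := ζ) hP hs hM hμ hμL] at h
  have h' := mul_le_mul_of_nonneg_left h (by positivity : 0 ≤ 1 / (θ.K : ℝ))
  refine h'.trans ?_
  set T1 := LPhi L M τ ρ μ / θ.K with hT1
  set T2 := (L / μ) ^ 2 * (1 - θ.η * μ) ^ (2 * θ.Q) with hT2
  set T3 := (L / μ) ^ 5 * σ ^ 2 / θ.S with hT3
  set T4 := (L / μ) ^ 2 / θ.Dg with hT4
  set T5 := (L / μ) ^ 2 / θ.Df with hT5
  set T6 := (L / μ) ^ 2 / (θ.B * θ.Q) with hT6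
  have p1 : 0 ≤ T1 := by positivity
  have p2 : 0 ≤ T2 := by positivity
  have p3 : 0 ≤ T3 := by positivity
  have p4 : 0 ≤ T4 := by positivity
  have p5 : 0 ≤ T5 := by positivity
  have p6 : 0 ≤ T6 := by positivity
  set b := 5 * (2 * L + M * τ / L + M * ρ / L) ^ 2 / L ^ 2 with hb
  have hb0 : 0 ≤ b := by positivity
  have e : 1 / (θ.K : ℝ) * ((8 * Δ + 6 * M * R) * LPhi L M τ ρ μ + 2 * θ.K * θ.noise L M μ
        + 5 * θ.K * (errConst L M τ ρ μ ^ 2 * (σ ^ 2 / (L * μ * θ.S))))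
      = (8 * Δ + 6 * M * R) * T1 + 20 * M ^ 2 * (T2 + T4 + T5 + T6)
        + 5 * (errConst L M τ ρ μ ^ 2 * (σ ^ 2 / (L * μ * θ.S))) := by
    rw [Params.noise, hT1, hT2, hT4, hT5, hT6]
    field_simp
    ring
  have h3 : 5 * (errConst L M τ ρ μ ^ 2 * (σ ^ 2 / (L * μ * θ.S))) ≤ b * T3 := by
    have hE := errConst_le hM hτ hρ hμ hμL
    calc _ ≤ 5 * (((2 * L + M * τ / L + M * ρ / L) * (L / μ) ^ 2) ^ 2
          * (σ ^ 2 / (L * μ * θ.S))) := by gcongr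
      _ = b * T3 := by
        rw [hb, hT3]
        field_simp
  have h1 : (8 * Δ + 6 * M * R) * T1 ≤ |8 * Δ + 6 * M * R| * T1 := by
    gcongr
    exact le_abs_self _
  have hc : rateConst L M τ ρ Δ R = |8 * Δ + 6 * M * R| + 20 * M ^ 2 + b + 1 := rfl
  set d := |8 * Δ + 6 * M * R| with hd
  have hd0 : 0 ≤ d := abs_nonneg _
  have hM2 : 0 ≤ 20 * M ^ 2 := by positivity
  rw [e, hc]
  calc _ ≤ d * T1 + 20 * M ^ 2 * (T2 + T4 + T5 + T6) + b * T3 := by linarith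
    _ ≤ (d + 20 * M ^ 2 + b + 1) * T1
        + (d + 20 * M ^ 2 + b + 1) * (T2 + T4 + T5 + T6) + (d + 20 * M ^ 2 + b + 1) * T3 := by
      gcongr <;> linarith
    _ = _ := by ring

/-- Mean square gradient norm at the random output. -/
lemma integral_output (hM : 0 ≤ M) (hμ : 0 < μ) (hμL : μ ≤ L) (hK : 1 ≤ θ.K) :
    Integrable (fun s => ‖gradient P.Phi (output P θ μ x₀ y₀ ξ ζ s)‖ ^ 2)
        (outputMeasure Pr θ.K) ∧
      ∫ s, ‖gradient P.Phi (output P θ μ x₀ y₀ ξ ζ s)‖ ^ 2 ∂outputMeasure Pr θ.K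
        = (1 / (θ.K : ℝ)) * ∑ k ∈ Finset.range θ.K,
          ∫ ω, ‖gradient P.Phi (iterate P θ μ x₀ y₀ ξ ζ k ω)‖ ^ 2 ∂Pr := by
  have : Nonempty (Fin θ.K) := ⟨⟨0, hK⟩⟩
  have : IsProbabilityMeasure (uniformOn (Set.univ : Set (Fin θ.K))) :=
    isProbabilityMeasure_uniformOn Set.finite_univ Set.univ_nonempty
  have hm : Measurable (output P θ μ x₀ y₀ ξ ζ) := by
    refine measurable_from_prod_countable_left fun k => ?_
    exact measurable_iterate hP hs k
  have hi : Integrable (fun s => ‖gradient P.Phi (output P θ μ x₀ y₀ ξ ζ s)‖ ^ 2)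
      (Pr.prod (uniformOn (Set.univ : Set (Fin θ.K)))) :=
    integrable_sq_of_norm_le ((measurable_gradient_Phi hP hM hμ hμL).comp hm).aestronglyMeasurable
      fun _ => norm_gradient_Phi_le hP hM hμ hμL _
  refine ⟨hi, ?_⟩
  rw [outputMeasure, integral_prod_symm _ hi]
  have hu : uniformOn (Set.univ : Set (Fin θ.K))
      = (θ.K : ENNReal)⁻¹ • (Measure.count : Measure (Fin θ.K)) := by
    rw [uniformOn, ProbabilityTheory.cond, Measure.restrict_univ]
    simp
  rw [hu, integral_smul_measure, integral_count, Finset.sum_range, smul_eq_mul]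
  simp [output]

end Transfer

/-! ### The number of inner steps -/

section InnerThreshold

variable {L M τ ρ μ : ℝ} (hM : 0 ≤ M) (hτ : 0 ≤ τ) (hρ : 0 ≤ ρ) (hμ : 0 < μ) (hμL : μ ≤ L)

/-- log x ≥ 1 − 1/x gives the lower bound 2μ/(L + μ) ≥ μ/L. Dividing by this logarithm therefore
costs at most a factor κ. -/
lemma div_le_log_div (hμ : 0 < μ) (hμL : μ < L) : μ / L ≤ Real.log ((L + μ) / (L - μ)) := by
  have hL : 0 < L := hμ.trans hμL
  have h1 : 0 < L - μ := by linarith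
  refine le_trans ?_ (Real.one_sub_inv_le_log_of_pos (by positivity))
  rw [inv_div, div_le_iff₀ hL, sub_mul, div_mul_eq_mul_div, one_mul, le_sub_iff_add_le,
    ← le_sub_iff_add_le', div_le_iff₀ (by positivity)]
  nlinarith

lemma one_sub_alpha_mul (hμ : 0 < μ) (hμL : μ ≤ L) :
    1 - 2 / (L + μ) * μ = (L - μ) / (L + μ) := by
  have : L + μ ≠ 0 := by have := hμ.trans_le hμL; positivity
  field_simp
  ring

include hM hτ hρ hμ hμL

/-- The first entry of the maximum forces ((L + μ)/(L − μ))^{2D} ≥ 12. When μ = L the contraction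
factor is 0, and D ≥ 1 is needed. -/
lemma contraction_le_of_innerThreshold_le {D : ℕ} (hD1 : 1 ≤ D)
    (hD : innerThreshold L M τ ρ μ ≤ D) : (1 - 2 / (L + μ) * μ) ^ (2 * D) ≤ 1 / 12 := by
  have hL : 0 < L := hμ.trans_le hμL
  have hLP := LPhi_pos hM hτ hρ hμ hμL
  rw [one_sub_alpha_mul hμ hμL]
  rcases hμL.eq_or_lt with h | h
  · rw [h, sub_self, zero_div, zero_pow (by omega)]
    norm_num
  have h1 : 0 < L - μ := by linarith
  have hl : 0 < Real.log ((L + μ) / (L - μ)) := lt_of_lt_of_le (by positivity) (div_le_log_div hμ h)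
  have h2 := (le_max_left _ _).trans hD
  rw [div_le_iff₀ (by positivity)] at h2
  have h3 : Real.log 12 ≤ (2 * D : ℕ) * Real.log ((L + μ) / (L - μ)) := by
    refine (Real.log_le_log (by norm_num) (le_add_of_nonneg_right ?_)).trans (h2.trans (le_of_eq ?_))
    · positivity
    · push_cast; ring
  rw [← Real.log_pow, Real.log_le_log_iff (by norm_num) (by positivity)] at h3
  rw [← inv_div, inv_pow, one_div]
  exact inv_anti₀ (by norm_num) h3

lemma innerThreshold_le :
    innerThreshold L M τ ρ μ
      ≤ (9 + |Real.log ((2 * L + M * τ / L + M * ρ / L) / √(4 * L))|)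
        * (L / μ * (1 + Real.log (L / μ))) := by
  have hL : 0 < L := hμ.trans_le hμL
  have hLP := LPhi_pos hM hτ hρ hμ hμL
  have hA := errConst_pos hM hτ hρ hμ hμL
  have hκ : 1 ≤ L / μ := (one_le_div hμ).2 hμL
  have hlκ : 0 ≤ Real.log (L / μ) := Real.log_nonneg hκ
  set c := (2 * L + M * τ / L + M * ρ / L) / √(4 * L) with hc
  have hc0 : 0 < c := by positivity
  set lc := |Real.log c| with hlc
  have hlc0 : 0 ≤ lc := abs_nonneg _
  rcases hμL.eq_or_lt with h | h
  · rw [innerThreshold, ← h, sub_self, div_zero, Real.log_zero, mul_zero, div_zero, div_zero,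
      max_self]
    have : 0 ≤ Real.log (μ / μ) := by rw [div_self hμ.ne', Real.log_one]
    positivity
  have hl := div_le_log_div hμ h
  have hl0 : 0 < Real.log ((L + μ) / (L - μ)) := lt_of_lt_of_le (by positivity) hl
  have hdiv : ∀ x N : ℝ, x ≤ N → 0 ≤ N → x / Real.log ((L + μ) / (L - μ)) ≤ N * (L / μ) := by
    intro x N hx hN
    rw [div_le_iff₀ hl0]
    calc x ≤ N * 1 := by linarith
      _ = N * (L / μ) * (μ / L) := by field_simp
      _ ≤ _ := by gcongr
  refine max_le ?_ ?_
  · rw [mul_comm (2 : ℝ), ← div_div, div_right_comm]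
    have h1 := mul_errConst_le_LPhi hM hτ hρ hμ hμL
    -- By κP ≤ L_Φ the argument of the logarithm is at most 15, so the logarithm is at most 14, and
    -- half of that is the constant 7.
    have h2 : 48 * (1 / (4 * LPhi L M τ ρ μ)) ^ 2 * L ^ 2 / μ ^ 2 * errConst L M τ ρ μ ^ 2
        ≤ 3 := by
      have h' : (L / μ * errConst L M τ ρ μ) ^ 2 ≤ LPhi L M τ ρ μ ^ 2 := by gcongr
      calc _ = 48 * (1 / (4 * LPhi L M τ ρ μ)) ^ 2 * (L / μ * errConst L M τ ρ μ) ^ 2 := by ring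
        _ ≤ 48 * (1 / (4 * LPhi L M τ ρ μ)) ^ 2 * LPhi L M τ ρ μ ^ 2 := by gcongr
        _ = 3 := by field_simp; norm_num
    have h3 : 0 ≤ 48 * (1 / (4 * LPhi L M τ ρ μ)) ^ 2 * L ^ 2 / μ ^ 2 * errConst L M τ ρ μ ^ 2 := by
      positivity
    have h4 := Real.log_le_sub_one_of_pos (x := 12 + 48 * (1 / (4 * LPhi L M τ ρ μ)) ^ 2 * L ^ 2
      / μ ^ 2 * errConst L M τ ρ μ ^ 2) (by linarith)
    refine (hdiv _ 7 (by linarith) (by norm_num)).trans ?_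
    have h5 : 0 ≤ L / μ := by linarith
    have h6 : 0 ≤ L / μ * Real.log (L / μ) := by positivity
    have h7 : 0 ≤ lc * (L / μ * (1 + Real.log (L / μ))) := by positivity
    linarith
  -- √β ≤ (4L)^{−1/2} and P = O(κ²), so this logarithm is at most a constant plus 2 log κ.
  · have h1 : √(1 / (4 * LPhi L M τ ρ μ)) * errConst L M τ ρ μ ≤ c * (L / μ) ^ 2 := by
      have h2 : L ≤ LPhi L M τ ρ μ := by
        have h3 : L / μ * errConst L M τ ρ μ ≥ 1 * L := by
          have : L ≤ errConst L M τ ρ μ := by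
            rw [errConst, add_assoc, add_assoc]
            exact le_add_of_nonneg_right (by positivity)
          exact mul_le_mul hκ this hL.le (by linarith)
        linarith [mul_errConst_le_LPhi hM hτ hρ hμ hμL]
      calc _ ≤ √(1 / (4 * L)) * ((2 * L + M * τ / L + M * ρ / L) * (L / μ) ^ 2) := by
            gcongr
            exact errConst_le hM hτ hρ hμ hμL
        _ = _ := by
            rw [one_div, Real.sqrt_inv, hc]
            ring
    have h2 : Real.log (√(1 / (4 * LPhi L M τ ρ μ)) * errConst L M τ ρ μ)
        ≤ lc + 2 * Real.log (L / μ) := by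
      refine (Real.log_le_log (by positivity) h1).trans ?_
      rw [Real.log_mul hc0.ne' (by positivity), Real.log_pow]
      push_cast
      gcongr
      exact le_abs_self _
    refine (hdiv _ _ h2 (by positivity)).trans ?_
    have h5 : 0 ≤ L / μ := by linarith
    have h6 : 0 ≤ L / μ * Real.log (L / μ) := by positivity
    have h7 : 0 ≤ lc * (L / μ * Real.log (L / μ)) := by positivity
    linarith

-- αμ ≥ μ/L and 1 − x ≤ e^{−x} give the bound e^{−12}. A fixed factor is all that the potential
-- argument asks for, so no logarithm of κ enters D.
omit hM hτ hρ in
lemma contraction_le_of_le {D : ℕ} (hD : 6 * (L / μ) ≤ D) :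
    (1 - 2 / (L + μ) * μ) ^ (2 * D) ≤ 1 / 12 := by
  have hL : 0 < L := hμ.trans_le hμL
  have h0 : 0 ≤ 1 - 2 / (L + μ) * μ := by
    rw [one_sub_alpha_mul hμ hμL]
    exact div_nonneg (by linarith) (by positivity)
  have h1 : μ / L ≤ 2 / (L + μ) * μ := by
    rw [div_mul_eq_mul_div, div_le_div_iff₀ hL (by positivity)]
    nlinarith
  have h2 : (1 - 2 / (L + μ) * μ) ^ (2 * D) ≤ Real.exp (-12) := by
    calc _ ≤ Real.exp (-(2 / (L + μ) * μ)) ^ (2 * D) := by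
          gcongr
          exact Real.one_sub_le_exp_neg _
      _ = Real.exp (-((2 * D : ℕ) * (2 / (L + μ) * μ))) := by
          rw [← Real.exp_nat_mul]
          congr 1
          ring
      _ ≤ _ := by
          rw [Real.exp_le_exp, neg_le_neg_iff]
          have h3 : 6 * (L / μ) * (μ / L) = 6 := by field_simp
          have h4 : 6 * (L / μ) * (μ / L) ≤ D * (2 / (L + μ) * μ) := by gcongr
          push_cast
          linarith
  refine h2.trans ?_
  rw [Real.exp_neg, one_div]
  refine inv_anti₀ (by norm_num) ?_
  linarith [Real.add_one_le_exp (12 : ℝ)]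

end InnerThreshold

/-! ### Length of the Neumann series -/

/-- Q is the least positive index with a^{2Q} ≤ 1/T. For Q ≥ 2 minimality gives a^{Q−1} ≥ a^{2(Q−1)}
> 1/T, which is the required lower bound on B when BQ = T, however small a is. The bound on Q, from
Bernoulli's inequality, is crude, but it does not exceed the order of the total Hessian batch size.
-/
lemma exists_truncation {a T : ℝ} (ha : 0 < a) (ha1 : a < 1) (hT : 1 ≤ T) :
    ∃ Q : ℕ, 1 ≤ Q ∧ a ^ (2 * Q) ≤ 1 / T ∧ 1 / a ^ (Q - 1) ≤ T ∧ (Q : ℝ) ≤ 1 + T / (1 - a) := by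
  classical
  have hT0 : 0 < T := by linarith
  have h1a : 0 < 1 - a := by linarith
  have hex : ∃ Q : ℕ, 1 ≤ Q ∧ a ^ (2 * Q) ≤ 1 / T := by
    obtain ⟨n, hn⟩ := exists_pow_lt_of_lt_one (by positivity : 0 < 1 / T) ha1
    exact ⟨n + 1, by omega, (pow_le_pow_of_le_one ha.le ha1.le (by omega)).trans hn.le⟩
  obtain ⟨h1, h2⟩ := Nat.find_spec hex
  have hmin := fun m => Nat.find_min hex (m := m)
  set Q := Nat.find hex
  refine ⟨Q, h1, h2, ?_⟩
  obtain hQ | ⟨m, hm⟩ : Q = 1 ∨ ∃ m, Q = m + 2 := by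
    rcases Nat.lt_or_ge Q 2 with h | h
    · exact Or.inl (by omega)
    · exact Or.inr ⟨Q - 2, by omega⟩
  · rw [hQ]
    refine ⟨by simpa using hT, ?_⟩
    have : 0 ≤ T / (1 - a) := by positivity
    push_cast
    linarith
  · have h3 : 1 / T < a ^ (2 * (m + 1)) := by
      by_contra h
      exact hmin (m + 1) (by omega) ⟨by omega, not_lt.1 h⟩
    have h4 : a ^ (2 * (m + 1)) ≤ a ^ (m + 1) := pow_le_pow_of_le_one ha.le ha1.le (by omega)
    have h5 : 1 / a ^ (m + 1) ≤ T := by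
      rw [div_le_comm₀ (by positivity) hT0]
      exact h3.le.trans h4
    rw [hm]
    refine ⟨h5, ?_⟩
    have h6 := one_add_mul_sub_le_pow (a := 1 / a)
      (by have : 0 < 1 / a := by positivity
          linarith) (m + 1)
    rw [one_div_pow] at h6
    have h7 : 1 - a ≤ 1 / a - 1 := by
      have := Real.one_sub_inv_le_log_of_pos (x := a) ha
      have := Real.log_le_sub_one_of_pos ha
      rw [one_div]
      linarith
    have h8 : ((m + 1 : ℕ) : ℝ) * (1 - a) ≤ ((m + 1 : ℕ) : ℝ) * (1 / a - 1) := by gcongr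
    have h9 : ((m + 1 : ℕ) : ℝ) ≤ T / (1 - a) := by
      rw [le_div_iff₀ h1a]
      linarith
    push_cast at h9 ⊢
    linarith

/-- A geometric sum, plus at most one sample per batch from rounding up. -/
lemma sum_hessBatch_le {θ : Params} {μ : ℝ} (hB : 0 ≤ θ.B * θ.Q) (ha : 0 ≤ 1 - θ.η * μ)
    (hημ : 0 < θ.η * μ) :
    ((∑ j ∈ Finset.Icc 1 θ.Q, θ.hessBatch μ j : ℕ) : ℝ) ≤ θ.Q + θ.B * θ.Q / (θ.η * μ) := by
  have h1 : ((∑ j ∈ Finset.Icc 1 θ.Q, θ.hessBatch μ j : ℕ) : ℝ)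
      ≤ ∑ j ∈ Finset.Icc 1 θ.Q, (1 + θ.B * θ.Q * (1 - θ.η * μ) ^ (θ.Q - j)) := by
    rw [Nat.cast_sum]
    refine Finset.sum_le_sum fun j _ => ?_
    rw [add_comm]
    exact (Nat.ceil_lt_add_one (by positivity)).le
  have h2 : ∑ j ∈ Finset.Icc 1 θ.Q, (1 - θ.η * μ) ^ (θ.Q - j)
      = ∑ i ∈ Finset.range θ.Q, (1 - θ.η * μ) ^ i := by
    refine Finset.sum_nbij' (fun j => θ.Q - j) (fun i => θ.Q - i) ?_ ?_ ?_ ?_ fun _ _ => rfl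
    all_goals
      intro j hj
      simp only [Finset.mem_Icc, Finset.mem_range] at hj ⊢
      omega
  have h3 : ∑ i ∈ Finset.range θ.Q, (1 - θ.η * μ) ^ i ≤ 1 / (θ.η * μ) := by
    rw [le_div_iff₀ hημ]
    have := geom_sum_mul_neg (1 - θ.η * μ) θ.Q
    rw [sub_sub_cancel] at this
    rw [this]
    have : 0 ≤ (1 - θ.η * μ) ^ θ.Q := by positivity
    linarith
  refine h1.trans ?_
  rw [Finset.sum_add_distrib, ← Finset.mul_sum, h2]
  simp only [Finset.sum_const, Nat.card_Icc, nsmul_eq_mul, mul_one, Nat.add_sub_cancel]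
  gcongr
  calc _ ≤ θ.B * θ.Q * (1 / (θ.η * μ)) := by gcongr
    _ = _ := by ring

/-! ### Choice of the parameters -/

lemma LPhi_le {L M τ ρ μ : ℝ} (hM : 0 ≤ M) (hτ : 0 ≤ τ) (hρ : 0 ≤ ρ) (hμ : 0 < μ)
    (hμL : μ ≤ L) :
    LPhi L M τ ρ μ
      ≤ (4 * L + τ * M ^ 2 / L + 2 * (ρ * M / L) + τ * M / L) * (L / μ) ^ 3 := by
  have hL : 0 < L := hμ.trans_le hμL
  have hκ : 1 ≤ L / μ := (one_le_div hμ).2 hμL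
  have e : LPhi L M τ ρ μ = L * 1 + (2 * L + τ * M ^ 2 / L) * (L / μ)
      + (ρ * M / L + L + τ * M / L) * (L / μ) ^ 2 + ρ * M / L * (L / μ) ^ 3 := by
    rw [LPhi]
    field_simp
  have h0 : 1 ≤ (L / μ) ^ 3 := one_le_pow₀ hκ
  have h1 : L / μ ≤ (L / μ) ^ 3 := le_self_pow₀ hκ (by norm_num)
  have h2 : (L / μ) ^ 2 ≤ (L / μ) ^ 3 := pow_le_pow_right₀ hκ (by norm_num)
  rw [e]
  calc _ ≤ L * (L / μ) ^ 3 + (2 * L + τ * M ^ 2 / L) * (L / μ) ^ 3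
      + (ρ * M / L + L + τ * M / L) * (L / μ) ^ 3 + ρ * M / L * (L / μ) ^ 3 := by gcongr
    _ = _ := by ring

lemma natCeil_mul_le {a x : ℝ} (ha : 0 ≤ a) (hx : 1 ≤ x) : (⌈a * x⌉₊ : ℝ) ≤ (a + 1) * x := by
  have := Nat.ceil_lt_add_one (a := a * x) (by positivity)
  linarith

/-- With BQ = T = 6Aκ²/ε, D_f and D_g of order κ²/ε, K of order κ³/ε and S of order κ⁵/ε, each of
the six terms is at most ε/(6A). The Hessian batches of one iteration have O(κ³/ε) elements, which
gives κ³ · κ³; the inner loops give κ³ · κ · κ⁵. -/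
lemma exists_params {L M τ ρ σ c A : ℝ} (hM : 0 ≤ M) (hτ : 0 ≤ τ) (hρ : 0 ≤ ρ) (hL : 0 < L)
    (hσ : 0 < σ) (hc : 0 < c) (hA : 1 ≤ A) :
    ∃ C : ℝ, 0 < C ∧ ∀ μ η ε : ℝ, 0 < μ → μ ≤ L → c / L ≤ η → η < 1 / L → 0 < ε → ε ≤ 1 →
      ∃ θ : Params, θ.IsTuned L M τ ρ μ ∧ θ.η = η ∧ 6 * (L / μ) ≤ θ.D ∧
        (θ.gcF : ℝ) ≤ C * ((L / μ) ^ 5 / ε ^ 2) ∧ (θ.gcG μ : ℝ) ≤ C * ((L / μ) ^ 9 / ε ^ 2) ∧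
        (θ.jvG : ℝ) ≤ C * ((L / μ) ^ 5 / ε ^ 2) ∧ (θ.hvG μ : ℝ) ≤ C * ((L / μ) ^ 6 / ε ^ 2) ∧
        A * (LPhi L M τ ρ μ / θ.K + (L / μ) ^ 2 * (1 - θ.η * μ) ^ (2 * θ.Q)
          + (L / μ) ^ 5 * σ ^ 2 / θ.S + (L / μ) ^ 2 / θ.Dg + (L / μ) ^ 2 / θ.Df
          + (L / μ) ^ 2 / (θ.B * θ.Q)) ≤ ε := by
  set cΦ := 4 * L + τ * M ^ 2 / L + 2 * (ρ * M / L) + τ * M / L with hcΦ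
  have hcΦ0 : 0 < cΦ := by positivity
  have hA0 : 0 < A := by linarith
  set cK := 6 * A * cΦ with hcK
  set cS := 6 * A * σ ^ 2 with hcS
  set cD := 6 * A with hcD
  have hcK0 : 0 < cK := by positivity
  have hcS0 : 0 < cS := by positivity
  have hcD0 : 0 < cD := by positivity
  set cH := 1 + 2 * (cD / c) with hcH
  have hcH0 : 0 < cH := by positivity
  refine ⟨(cK + 1) * (2 * (cD + 1) + 7 * (cS + 1) + cH), by positivity, ?_⟩
  intro μ η ε hμ hμL hcη hηL hε hε1
  set κ := L / μ with hκdef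
  have hκ : 1 ≤ κ := (one_le_div hμ).2 hμL
  have hκ0 : 0 < κ := by linarith
  have hη0 : 0 < η := lt_of_lt_of_le (by positivity) hcη
  -- The lower bound on η makes the Neumann length scale 1/(ημ) at most κ/c.
  have hημ : c / κ ≤ η * μ := by
    calc c / κ = c / L * μ := by rw [hκdef]; field_simp
      _ ≤ _ := by gcongr
  have hημ1 : η * μ < 1 := by
    rw [lt_div_iff₀ hL] at hηL
    exact (mul_le_mul_of_nonneg_left hμL hη0.le).trans_lt hηL
  -- κⁿ/ε ≥ 1 is what allows rounding up to be absorbed in the constants.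
  have hdiv : ∀ n : ℕ, 1 ≤ κ ^ n / ε := fun n => by
    rw [le_div_iff₀ hε, one_mul]
    exact hε1.trans (one_le_pow₀ hκ)
  set T := cD * (κ ^ 2 / ε) with hT
  have hT1 : 1 ≤ T := by
    have := hdiv 2
    nlinarith
  have hT0 : 0 < T := by linarith
  obtain ⟨Q, hQ1, hQ2, hQ3, hQ4⟩ :=
    exists_truncation (a := 1 - η * μ) (T := T) (by linarith)
      (by have : 0 < η * μ := by positivity
          linarith) hT1
  have hQ0 : (0 : ℝ) < Q := by exact_mod_cast hQ1
  rw [sub_sub_cancel] at hQ4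
  set K := ⌈cK * (κ ^ 3 / ε)⌉₊ with hK
  set S := ⌈cS * (κ ^ 5 / ε)⌉₊ with hS
  set N := ⌈T⌉₊ with hN
  set D := ⌈6 * κ⌉₊ with hD
  have hK1 : 1 ≤ K := Nat.ceil_pos.2 (by positivity)
  have hS1 : 1 ≤ S := Nat.ceil_pos.2 (by positivity)
  have hN1 : 1 ≤ N := Nat.ceil_pos.2 hT0
  have hD1 : 1 ≤ D := Nat.ceil_pos.2 (by positivity)
  let θ : Params := ⟨K, D, Q, S, N, N, T / Q, 2 / (L + μ), 1 / (4 * LPhi L M τ ρ μ), η⟩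
  have hBQ : θ.B * θ.Q = T := div_mul_cancel₀ T hQ0.ne'
  have hKle : (K : ℝ) ≤ (cK + 1) * (κ ^ 3 / ε) := natCeil_mul_le hcK0.le (hdiv 3)
  have hSle : (S : ℝ) ≤ (cS + 1) * (κ ^ 5 / ε) := natCeil_mul_le hcS0.le (hdiv 5)
  have hNle : (N : ℝ) ≤ (cD + 1) * (κ ^ 2 / ε) := natCeil_mul_le hcD0.le (hdiv 2)
  have hDle : (D : ℝ) ≤ 7 * κ := (natCeil_mul_le (by norm_num) hκ).trans (by linarith)
  have hHle : ((∑ j ∈ Finset.Icc 1 θ.Q, θ.hessBatch μ j : ℕ) : ℝ) ≤ cH * (κ ^ 3 / ε) := by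
    have h1 := sum_hessBatch_le (θ := θ) (μ := μ) (by rw [hBQ]; exact hT0.le)
      (by change 0 ≤ 1 - η * μ; linarith) (by change 0 < η * μ; positivity)
    rw [hBQ] at h1
    change _ ≤ (Q : ℝ) + T / (η * μ) at h1
    have h2 : T / (η * μ) ≤ cD / c * (κ ^ 3 / ε) := by
      calc T / (η * μ) ≤ T / (c / κ) := by gcongr
        _ = _ := by rw [hT]; field_simp
    have h3 := hdiv 3
    linarith
  refine ⟨θ, ⟨hK1, hD1, hQ1, hS1, hN1, hN1, rfl, rfl, hη0, hηL, ?_⟩, rfl, Nat.le_ceil _,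
    ?_, ?_, ?_, ?_, ?_⟩
  -- With B = T/Q the lower bound on B is 1/(1 − ημ)^{Q−1} ≤ T.
  · change 1 / ((Q : ℝ) * (1 - η * μ) ^ (Q - 1)) ≤ T / Q
    rw [← div_div, div_right_comm]
    gcongr
  · calc ((θ.gcF : ℕ) : ℝ) = K * (2 * N) := by simp [Params.gcF, θ]
      _ ≤ (cK + 1) * (κ ^ 3 / ε) * (2 * ((cD + 1) * (κ ^ 2 / ε))) := by gcongr
      _ = (cK + 1) * (2 * (cD + 1)) * (κ ^ 5 / ε ^ 2) := by ring
      _ ≤ _ := by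
        gcongr (cK + 1) * ?_ * (κ ^ 5 / ε ^ 2)
        linarith
  · calc ((θ.gcG μ : ℕ) : ℝ)
        = K * (D * S + ((∑ j ∈ Finset.Icc 1 θ.Q, θ.hessBatch μ j : ℕ) : ℝ)) := by
          simp [Params.gcG, θ]
      _ ≤ (cK + 1) * (κ ^ 3 / ε) * (7 * κ * ((cS + 1) * (κ ^ 5 / ε)) + cH * (κ ^ 3 / ε)) := by
        gcongr
      _ ≤ (cK + 1) * (κ ^ 3 / ε) * (7 * κ * ((cS + 1) * (κ ^ 5 / ε)) + cH * (κ ^ 6 / ε)) := by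
        gcongr
        norm_num
      _ = (cK + 1) * (7 * (cS + 1) + cH) * (κ ^ 9 / ε ^ 2) := by ring
      _ ≤ _ := by
        gcongr (cK + 1) * ?_ * (κ ^ 9 / ε ^ 2)
        linarith
  · calc ((θ.jvG : ℕ) : ℝ) = K * N := by simp [Params.jvG, θ]
      _ ≤ (cK + 1) * (κ ^ 3 / ε) * ((cD + 1) * (κ ^ 2 / ε)) := by gcongr
      _ = (cK + 1) * (cD + 1) * (κ ^ 5 / ε ^ 2) := by ring
      _ ≤ _ := by
        gcongr (cK + 1) * ?_ * (κ ^ 5 / ε ^ 2)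
        linarith
  · calc ((θ.hvG μ : ℕ) : ℝ)
        = K * ((∑ j ∈ Finset.Icc 1 θ.Q, θ.hessBatch μ j : ℕ) : ℝ) := by
          simp [Params.hvG, θ]
      _ ≤ (cK + 1) * (κ ^ 3 / ε) * (cH * (κ ^ 3 / ε)) := by gcongr
      _ = (cK + 1) * cH * (κ ^ 6 / ε ^ 2) := by ring
      _ ≤ _ := by
        gcongr (cK + 1) * ?_ * (κ ^ 6 / ε ^ 2)
        linarith
  · rw [hBQ]
    change A * (LPhi L M τ ρ μ / (K : ℝ) + κ ^ 2 * (1 - η * μ) ^ (2 * Q)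
      + κ ^ 5 * σ ^ 2 / (S : ℝ) + κ ^ 2 / (N : ℝ) + κ ^ 2 / (N : ℝ) + κ ^ 2 / T) ≤ ε
    have t6 : κ ^ 2 / T = ε / (6 * A) := by
      rw [hT, hcD]; field_simp
    have t4 : κ ^ 2 / (N : ℝ) ≤ ε / (6 * A) := by
      rw [← t6]
      gcongr
      exact Nat.le_ceil _
    have t1 : LPhi L M τ ρ μ / (K : ℝ) ≤ ε / (6 * A) := by
      calc _ ≤ cΦ * κ ^ 3 / (cK * (κ ^ 3 / ε)) := by
            gcongr
            · exact LPhi_le hM hτ hρ hμ hμL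
            · exact Nat.le_ceil _
        _ = _ := by rw [hcK, hcD]; field_simp
    have t3 : κ ^ 5 * σ ^ 2 / (S : ℝ) ≤ ε / (6 * A) := by
      calc _ ≤ κ ^ 5 * σ ^ 2 / (cS * (κ ^ 5 / ε)) := by
            gcongr
            exact Nat.le_ceil _
        _ = _ := by rw [hcS, hcD]; field_simp
    have t2 : κ ^ 2 * (1 - η * μ) ^ (2 * Q) ≤ ε / (6 * A) := by
      calc _ ≤ κ ^ 2 * (1 / T) := by gcongr
        _ = κ ^ 2 / T := by ring
        _ = _ := t6
    calc _ ≤ A * (6 * (ε / (6 * A))) := mul_le_mul_of_nonneg_left (by linarith) hA0.le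
      _ = ε := by field_simp

end StocBiO

end

theorem mainTheorem8 (L M τ ρ Δ₀ R₀ : ℝ) (hL : 0 < L) (hM : 0 ≤ M) (hτ : 0 ≤ τ) (hρ : 0 ≤ ρ) :
    -- convergence rate, with a constant that depends on `L, M, τ, ρ, Δ₀, R₀` only
    (∃ C : ℝ, 0 < C ∧ ∀ μ : ℝ, 0 < μ → μ ≤ L →
      StocBiO.innerThreshold L M τ ρ μ ≤ C * ((L / μ) * (1 + Real.log (L / μ))) ∧
      ∀ (σ : ℝ) (θ : StocBiO.Params), 0 < σ → θ.IsTuned L M τ ρ μ →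
        StocBiO.innerThreshold L M τ ρ μ ≤ (θ.D : ℝ) →
        ∀ (p q : ℕ) (Ξ : Type*) (Z : Type*) (Ω : Type*)
          [MeasurableSpace Ξ] [MeasurableSpace Z] [MeasurableSpace Ω]
          (P : StocBiO.Problem p q Ξ Z) (Pr : MeasureTheory.Measure Ω)
          [MeasureTheory.IsProbabilityMeasure Pr]
          (ξ : ℕ × ℕ → Ω → Ξ) (ζ : StocBiO.GDraw → Ω → Z)
          (x₀ : StocBiO.Vec p) (y₀ : StocBiO.Vec q),
          P.Assumptions L M τ ρ μ σ → StocBiO.IsSampling P Pr ξ ζ →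
          P.Phi x₀ - (⨅ x, P.Phi x) ≤ Δ₀ → ‖y₀ - P.yStar x₀‖ ≤ R₀ →
          Differentiable ℝ P.Phi ∧
          (∀ k < θ.K, MeasureTheory.Integrable
            (fun ω => ‖gradient P.Phi (StocBiO.iterate P θ μ x₀ y₀ ξ ζ k ω)‖ ^ 2) Pr) ∧
          (1 / (θ.K : ℝ)) * ∑ k ∈ Finset.range θ.K,
              ∫ ω, ‖gradient P.Phi (StocBiO.iterate P θ μ x₀ y₀ ξ ζ k ω)‖ ^ 2 ∂Pr
            ≤ C * (StocBiO.LPhi L M τ ρ μ / θ.K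
                + (L / μ) ^ 2 * (1 - θ.η * μ) ^ (2 * θ.Q)
                + (L / μ) ^ 5 * σ ^ 2 / θ.S
                + (L / μ) ^ 2 / θ.Dg
                + (L / μ) ^ 2 / θ.Df
                + (L / μ) ^ 2 / θ.B)) ∧
    -- complexities; the constant may moreover depend on `σ` and on a lower bound `c` for `η L`
    (∀ σ c : ℝ, 0 < σ → 0 < c → c < 1 → ∃ C : ℝ, 0 < C ∧
      ∀ μ η ε : ℝ, 0 < μ → μ ≤ L → c / L ≤ η → η < 1 / L → 0 < ε → ε ≤ 1 →
        ∃ θ : StocBiO.Params, θ.IsTuned L M τ ρ μ ∧ θ.η = η ∧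
          (θ.gcF : ℝ) ≤ C * ((L / μ) ^ 5 / ε ^ 2) ∧
          (θ.gcG μ : ℝ) ≤ C * ((L / μ) ^ 9 / ε ^ 2) ∧
          (θ.jvG : ℝ) ≤ C * ((L / μ) ^ 5 / ε ^ 2) ∧
          (θ.hvG μ : ℝ) ≤ C * ((L / μ) ^ 6 / ε ^ 2 * (1 + Real.log ((L / μ) ^ 2 / ε))) ∧
          ∀ (p q : ℕ) (Ξ : Type*) (Z : Type*) (Ω : Type*)
            [MeasurableSpace Ξ] [MeasurableSpace Z] [MeasurableSpace Ω]
            (P : StocBiO.Problem p q Ξ Z) (Pr : MeasureTheory.Measure Ω)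
            [MeasureTheory.IsProbabilityMeasure Pr]
            (ξ : ℕ × ℕ → Ω → Ξ) (ζ : StocBiO.GDraw → Ω → Z)
            (x₀ : StocBiO.Vec p) (y₀ : StocBiO.Vec q),
            P.Assumptions L M τ ρ μ σ → StocBiO.IsSampling P Pr ξ ζ →
            P.Phi x₀ - (⨅ x, P.Phi x) ≤ Δ₀ → ‖y₀ - P.yStar x₀‖ ≤ R₀ →
            StocBiO.IsAccurateStationary P (StocBiO.outputMeasure Pr θ.K)
              (StocBiO.output P θ μ x₀ y₀ ξ ζ) ε) := by
  have hr := StocBiO.one_le_rateConst (L := L) (M := M) (τ := τ) (ρ := ρ) (Δ := Δ₀) (R := R₀)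
  refine ⟨?_, fun σ c hσ hc _ => ?_⟩
  -- b is the constant for D_min; adding it to the constant of the rate gives one C for both claims.
  · set b := 9 + |Real.log ((2 * L + M * τ / L + M * ρ / L) / √(4 * L))| with hb
    have hb0 : 0 ≤ b := by positivity
    refine ⟨StocBiO.rateConst L M τ ρ Δ₀ R₀ + b, by linarith, fun μ hμ hμL => ⟨?_, ?_⟩⟩
    · refine (StocBiO.innerThreshold_le hM hτ hρ hμ hμL).trans ?_
      have := Real.log_nonneg ((one_le_div hμ).2 hμL)
      exact mul_le_mul_of_nonneg_right (by linarith) (by positivity)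
    · intro σ θ hσ hθ hD p q Ξ Z Ω _ _ _ P Pr _ ξ ζ x₀ y₀ hP hs hΔ hR
      refine ⟨fun x => (hP.hasGradientAt_Phi hM hμ hμL x).differentiableAt,
        fun k _ => StocBiO.integrable_gradient_iterate hP hs hM hμ hμL k, ?_⟩
      have hq : (1 - θ.α * μ) ^ (2 * θ.D) ≤ 1 / 12 := by
        rw [hθ.α_eq]
        exact StocBiO.contraction_le_of_innerThreshold_le hM hτ hρ hμ hμL hθ.D_pos hD
      refine (StocBiO.average_gradient_le hP hs hM hτ hρ hμ hμL hθ hq hΔ hR).trans ?_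
      have hLP := StocBiO.LPhi_pos hM hτ hρ hμ hμL
      have ha := hθ.contr_pos hμ hμL
      have hB := hθ.B_pos hμ hμL
      -- The estimate obtained has κ²/(BQ), which is weaker than or equal in size to the κ²/B of the
      -- claim because Q ≥ 1.
      have hBQ : θ.B ≤ θ.B * θ.Q :=
        le_mul_of_one_le_right hB.le (by exact_mod_cast hθ.Q_pos)
      gcongr
      linarith
  · obtain ⟨C, hC, h⟩ := StocBiO.exists_params hM hτ hρ hL hσ hc hr
    refine ⟨C, hC, fun μ η ε hμ hμL hcη hηL hε hε1 => ?_⟩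
    obtain ⟨θ, hθ, hη, hD, h1, h2, h3, h4, h5⟩ := h μ η ε hμ hμL hcη hηL hε hε1
    have hκ : 1 ≤ L / μ := (one_le_div hμ).2 hμL
    refine ⟨θ, hθ, hη, h1, h2, h3, h4.trans ?_, ?_⟩
    -- The parameters already meet κ⁶ε⁻²; the logarithm is slack, as κ²/ε ≥ 1.
    · gcongr
      refine le_mul_of_one_le_right (by positivity) (le_add_of_nonneg_right (Real.log_nonneg ?_))
      rw [le_div_iff₀ hε, one_mul]
      exact hε1.trans (one_le_pow₀ hκ)
    · intro p q Ξ Z Ω _ _ _ P Pr _ ξ ζ x₀ y₀ hP hs hΔ hR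
      have hq : (1 - θ.α * μ) ^ (2 * θ.D) ≤ 1 / 12 := by
        rw [hθ.α_eq]
        exact StocBiO.contraction_le_of_le hμ hμL hD
      obtain ⟨hi, he⟩ := StocBiO.integral_output (x₀ := x₀) (y₀ := y₀) hP hs hM hμ hμL hθ.K_pos
      refine ⟨hi, he.trans_le ?_⟩
      exact (StocBiO.average_gradient_le hP hs hM hτ hρ hμ hμL hθ hq hΔ hR).trans h5
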